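/- **Model.** Ground base stations (BSs), all at height $h_g>0$ and with transmit power $P_g>0$, have horizontal positions forming a homogeneous Poisson point process $\Phi_g=\{\mathbf x_i\}$ of density $\lambda_g>0$ in $\mathbb R^2$. The user equipment (UE) is on the ground at $\mathbf v_0=(v_0,0)$, $v_0\ge 0$. A BS at horizontal distance $r$ from the UE is received with power $P_g(r^2+h_g^2)^{-\eta_g/2}\,\Omega$, where $\eta_g>2$ and $\Omega$ is exponential with mean $1$ (Rayleigh fading). There are $N_u$ UAVs at altitude $h_u>0$, with horizontal positions independent and uniform in the disk of radius $r_u>0$ centred at the origin. A UAV at (three-dimensional) distance $z$ from the UE has a line-of-sight (LOS, $\zeta=l$) link with probability $\kappa_{u_l}(z)=\bigl(1+a\exp(-b[\tfrac{180}{\pi}\arctan(h_u/\sqrt{z^2-h_u^2})-a])\bigr)^{-1}$, $a>0$, $b\in\mathbb R$, and otherwise, with probability $\kappa_{u_n}(z)=1-\kappa_{u_l}(z)$, an NLOS link ($\zeta=n$). It is received with power $P_u z^{-\eta_\zeta}\Omega_\zeta$, where $P_u,\eta_\zeta>0$ and $\Omega_\zeta$ is gamma distributed with shape $m_\zeta>0$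 and mean $1$ (Nakagami fading). The BS process, the pairs (position, link state) of the different UAVs, and the fading gains of the different transmitters are independent. The UE is served by the transmitter with the largest average received power (fading gains replaced by their mean $1$). Let $\hat I_g$ be the sum of the powers received from all BSs except the one nearest to the UE, and $I_u$ the sum of the powers received from all $N_u$ UAVs. **Lemma 3.** Almost surely the series defining $\hat I_g$ converges. Moreover, conditionally on the event that the UE is served by a BS and that this BS is at horizontal distance $x_g$, for almost every value $x_g$ and all $s>0$, the Laplace transform of $\hat I_g$ is $$\mathcal L_{\hat I_g}(s)=\exp\left[\frac{-2\pi\lambda_g sP_g(x_g^2+h_g^2)}{(\eta_g-2)\left((x_g^2+h_g^2)^{\eta_g/2}+sP_g\right)}\;{}_2F_1\!\left(1,1;2-\frac{2}{\eta_g};\frac{1}{1+\frac{(x_g^2+h_g^2)^{\eta_g/2}}{sP_g}}\right)\right],$$ and, if $v_0\le r_u$, the Laplace transform of $I_u$ is $$\mathcal L_{I_u}(s)=\left[\frac{\displaystyle\int_{E_{g_l}(x_g)}^{w_p}\Bigl(1+\tfrac{sP_uv^{-\eta_l}}{m_l}\Bigr)^{-m_l}f_W(v)\kappa_{u_l}(v)\,dv+\int_{E_{g_n}(x_g)}^{w_p}\Bigl(1+\tfrac{sP_uv^{-\eta_n}}{m_n}\Bigr)^{-m_n}f_W(v)\kappa_{u_n}(v)\,dv}{\displaystyle\int_{E_{g_l}(x_g)}^{w_p}f_W(w)\kappa_{u_l}(w)\,dw+\int_{E_{g_n}(x_g)}^{w_p}f_W(w)\kappa_{u_n}(w)\,dw}\right]^{N_u}.$$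 Here ${}_2F_1$ is the Gauss hypergeometric function, $E_{g_\zeta}(x)=(P_u/P_g)^{1/\eta_\zeta}(x^2+h_g^2)^{\eta_g/(2\eta_\zeta)}$, $w_m=\sqrt{(r_u-v_0)^2+h_u^2}$, $w_p=\sqrt{(r_u+v_0)^2+h_u^2}$, and $f_W$ is the function with $f_W(w)=\frac{2w}{r_u^2}$ for $h_u\le w\le w_m$, $f_W(w)=\frac{2w}{\pi r_u^2}\arccos\left(\frac{w^2+v_0^2-d^2}{2v_0\sqrt{w^2-h_u^2}}\right)$ with $d=\sqrt{r_u^2+h_u^2}$ for $w_m<w\le w_p$, and $f_W(w)=0$ otherwise. -/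

import Mathlib

open MeasureTheory ProbabilityTheory

namespace HybridNet

/-- The horizontal plane. -/
abbrev Plane : Type := EuclideanSpace ℝ (Fin 2)

/-- State of a UAV-UE link: `true` means line-of-sight (LOS), `false` means NLOS. -/
abbrev Link : Type := Bool

/-- A line-of-sight link. -/
abbrev LOS : Link := true

/-- A non-line-of-sight link. -/
abbrev NLOS : Link := false

/-- Deterministic parameters of the network, with the ranges in which they live. -/
structure Params where
  /-- density of the ground base stations -/
  lam : ℝ
  /-- height of the base stations -/
  hg : ℝ
  /-- transmit power of the base stations -/
  Pg : ℝ
  /-- terrestrial path-loss exponent -/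
  etag : ℝ
  /-- number of UAVs -/
  Nu : ℕ
  /-- altitude of the UAVs -/
  hu : ℝ
  /-- radius of the disk in which the UAVs hover -/
  ru : ℝ
  /-- transmit power of the UAVs -/
  Pu : ℝ
  /-- path-loss exponent of a LOS, respectively NLOS, aerial link -/
  eta : Link → ℝ
  /-- Nakagami fading parameter of a LOS, respectively NLOS, aerial link -/
  m : Link → ℝ
  /-- first environment constant of the LOS probability -/
  a : ℝ
  /-- second environment constant of the LOS probability -/
  b : ℝ
  /-- distance of the user equipment (UE) from the origin -/
  v0 : ℝ
  lam_pos : 0 < lam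
  hg_pos : 0 < hg
  Pg_pos : 0 < Pg
  etag_gt : 2 < etag
  hu_pos : 0 < hu
  ru_pos : 0 < ru
  Pu_pos : 0 < Pu
  eta_pos : ∀ ζ, 0 < eta ζ
  m_pos : ∀ ζ, 0 < m ζ
  a_pos : 0 < a
  v0_nonneg : 0 ≤ v0

namespace Params

variable (p : Params)

/-- Position of the UE on the ground. -/
noncomputable def ue : Plane := !₂[p.v0, 0]

/-- Horizontal distance between the UE and the projection `x` of a base station. -/
noncomputable def bsHorizDist (x : Plane) : ℝ := dist x p.ue

/-- Three-dimensional distance between the UE and a UAV above the point `y`. -/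
noncomputable def uavDist (y : Plane) : ℝ := √(dist y p.ue ^ 2 + p.hu ^ 2)

/-- Average received power from a base station at horizontal distance `s`. -/
noncomputable def bsMeanPower (s : ℝ) : ℝ :=
  p.Pg * (s ^ 2 + p.hg ^ 2) ^ (-p.etag / 2)

/-- Average received power from a UAV at distance `z` through a link of type `ζ`. -/
noncomputable def uavMeanPower (ζ : Link) (z : ℝ) : ℝ := p.Pu * z ^ (-p.eta ζ)

/-- Elevation angle in radians of a UAV at distance `r` from the UE; it is `π / 2` for a UAV
exactly above the UE (`r = hu`). -/
noncomputable def elevation (r : ℝ) : ℝ :=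
  if r = p.hu then Real.pi / 2 else Real.arctan (p.hu / √(r ^ 2 - p.hu ^ 2))

/-- Probability that the link to a UAV at distance `r` is LOS. -/
noncomputable def losProb (r : ℝ) : ℝ :=
  1 / (1 + p.a * Real.exp (-p.b * (180 / Real.pi * p.elevation r - p.a)))

/-- Probability that the link to a UAV at distance `r` is of type `ζ`. -/
noncomputable def kappa : Link → ℝ → ℝ
  | true, r => p.losProb r
  | false, r => 1 - p.losProb r

/-- Exclusion radius for UAVs of link type `ζ` when the serving base station is at horizontal
distance `x`. -/
noncomputable def exclRadius (ζ : Link) (x : ℝ) : ℝ :=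
  (p.Pu / p.Pg) ^ (1 / p.eta ζ) * (x ^ 2 + p.hg ^ 2) ^ (p.etag / (2 * p.eta ζ))

/-- The threshold distance `w_m`. -/
noncomputable def wm : ℝ := √((p.ru - p.v0) ^ 2 + p.hu ^ 2)

/-- The largest possible distance `w_p` between a UAV and the UE. -/
noncomputable def wp : ℝ := √((p.ru + p.v0) ^ 2 + p.hu ^ 2)

/-- The density `f_W` of the distance between an arbitrary UAV and the UE (the UE lies under
the disk of UAVs); here `d ^ 2 = ru ^ 2 + hu ^ 2`. -/
noncomputable def fW (w : ℝ) : ℝ :=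
  if p.hu ≤ w ∧ w ≤ p.wm then 2 * w / p.ru ^ 2
  else if p.wm ≤ w ∧ w ≤ p.wp then
    2 * w / (Real.pi * p.ru ^ 2) *
      Real.arccos ((w ^ 2 + p.v0 ^ 2 - √(p.ru ^ 2 + p.hu ^ 2) ^ 2) /
        (2 * p.v0 * √(w ^ 2 - p.hu ^ 2)))
  else 0

/-- The uniform law on the disk of radius `ru` centred at the origin. -/
noncomputable def diskLaw : Measure Plane :=
  ProbabilityTheory.cond volume (Metric.closedBall (0 : Plane) p.ru)

end Params

/-- `X 0, X 1, …` is an enumeration of the points of a homogeneous Poisson point process of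
intensity `lam` in the plane: the numbers of points in sets of finite area are Poisson
distributed, and the numbers of points in disjoint sets are independent. -/
structure IsPoissonProcess {Ω : Type*} [MeasurableSpace Ω] (lam : ℝ) (X : ℕ → Ω → Plane)
    (μ : Measure Ω) : Prop where
  measurable : ∀ i, Measurable (X i)
  count_law : ∀ A : Set Plane, MeasurableSet A → volume A ≠ ⊤ → ∀ k : ℕ,
    μ {ω | {i | X i ω ∈ A}.encard = k}
      = poissonMeasure (lam.toNNReal * (volume A).toNNReal) {k}
  count_indep : ∀ (n : ℕ) (A : Fin n → Set Plane), (∀ l, MeasurableSet (A l)) →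
    (∀ l l', l ≠ l' → Disjoint (A l) (A l')) →
    iIndepFun (fun l ω => {i | X i ω ∈ A l}.encard) μ

/-- The independent sources of randomness of the network. -/
inductive Source (N : ℕ) : Type
  | bs : Source N
  | bsFading (i : ℕ) : Source N
  | uav (j : Fin N) : Source N
  | uavFading (j : Fin N) : Source N

/-- The random network: base stations, UAVs with the states of their links to the UE, and the
small-scale fading gains. -/
structure Network (p : Params) {Ω : Type*} [MeasurableSpace Ω] (μ : Measure Ω) where
  /-- projection on the ground of the `i`-th base station -/
  bs : ℕ → Ω → Plane
  /-- fading gain of the `i`-th base station -/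
  bsFading : ℕ → Ω → ℝ
  /-- projection on the ground of the `j`-th UAV -/
  uav : Fin p.Nu → Ω → Plane
  /-- state of the link between the UE and the `j`-th UAV -/
  link : Fin p.Nu → Ω → Link
  /-- fading gain of the `j`-th UAV for each of the two possible link states -/
  uavFading : Fin p.Nu → Link → Ω → ℝ
  bs_poisson : IsPoissonProcess p.lam bs μ
  bsFading_measurable : ∀ i, Measurable (bsFading i)
  /-- Rayleigh fading: the power gain is exponential with unit mean -/
  bsFading_law : ∀ i, μ.map (bsFading i) = expMeasure 1
  uav_measurable : ∀ j, Measurable (uav j)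
  link_measurable : ∀ j, Measurable (link j)
  uav_law : ∀ j, μ.map (uav j) = p.diskLaw
  /-- given its position, a UAV has a link of type `ζ` with probability `kappa ζ` -/
  link_law : ∀ j ζ, ∀ A : Set Plane, MeasurableSet A →
    μ {ω | uav j ω ∈ A ∧ link j ω = ζ}
      = ∫⁻ y in A, ENNReal.ofReal (p.kappa ζ (p.uavDist y)) ∂p.diskLaw
  uavFading_measurable : ∀ j ζ, Measurable (uavFading j ζ)
  /-- Nakagami fading: the power gain is gamma distributed with shape `m ζ` and unit mean -/
  uavFading_law : ∀ j ζ, μ.map (uavFading j ζ) = gammaMeasure (p.m ζ) (p.m ζ)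
  /-- the base station process, the fading gains and the (position, link state) pairs of the
  UAVs are mutually independent -/
  indep : iIndep (fun k : Source p.Nu => match k with
    | .bs => MeasurableSpace.comap (fun ω i => bs i ω) inferInstance
    | .bsFading i => MeasurableSpace.comap (bsFading i) inferInstance
    | .uav j => MeasurableSpace.comap (fun ω => (uav j ω, link j ω)) inferInstance
    | .uavFading j => MeasurableSpace.comap (fun ω ζ => uavFading j ζ ω) inferInstance) μ

namespace Network

variable {p : Params} {Ω : Type*} [MeasurableSpace Ω] {μ : Measure Ω} (net : Network p μ)

/-- Average power received by the UE from the `i`-th base station. -/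
noncomputable def bsAvg (i : ℕ) (ω : Ω) : ℝ := p.bsMeanPower (p.bsHorizDist (net.bs i ω))

/-- Average power received by the UE from the `j`-th UAV. -/
noncomputable def uavAvg (j : Fin p.Nu) (ω : Ω) : ℝ :=
  p.uavMeanPower (net.link j ω) (p.uavDist (net.uav j ω))

/-- Index of the base station offering the largest average received power. -/
noncomputable def bestBS (ω : Ω) : ℕ := sInf {i | ∀ i', net.bsAvg i' ω ≤ net.bsAvg i ω}

/-- Horizontal distance between the UE and the base station `bestBS`. -/
noncomputable def bestDist (ω : Ω) : ℝ := p.bsHorizDist (net.bs (net.bestBS ω) ω)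

/-- The event that the UE associates to a base station (necessarily `bestBS`): no other base
station and no UAV offers a larger average received power. -/
def servedByBS : Set Ω :=
  {ω | (∀ i, net.bsAvg i ω ≤ net.bsAvg (net.bestBS ω) ω) ∧
    ∀ j, net.uavAvg j ω ≤ net.bsAvg (net.bestBS ω) ω}

/-- Power received by the UE from the `i`-th base station, set to zero for `bestBS`. -/
noncomputable def bsInterfTerm (i : ℕ) (ω : Ω) : ℝ :=
  if i = net.bestBS ω then 0 else net.bsAvg i ω * net.bsFading i ω

/-- Aggregate interference of all the base stations except `bestBS`. -/
noncomputable def bsInterf (ω : Ω) : ℝ := ∑' i, net.bsInterfTerm i ω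

/-- Aggregate interference of all the UAVs. -/
noncomputable def uavInterf (ω : Ω) : ℝ :=
  ∑ j, net.uavAvg j ω * net.uavFading j (net.link j ω) ω

end Network

/-- Laplace transform of a law on the real line. -/
noncomputable def laplace (ν : Measure ℝ) (s : ℝ) : ℝ := ∫ t, Real.exp (-s * t) ∂ν

end HybridNet

/-!
Conditionally on the distance `x` of the serving base station, each interference is a functional of
independent pieces, and its Laplace transform is an expectation of a product.

*Base stations.* Integrating out the exponential gains turns `exp (-s I)` into an infinite product
over the points of the Poisson process, of factors `1 - g (|X i|)` with the nearest point left out.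
The law of the points other than the nearest one given the nearest one is not available directly.
Instead, the product over *all* points is the product over the other points times a function of the
distance of the nearest one, so it is enough to know the law of the nearest distance weighted by the
product over all points. Its tail, the event that a disk is empty, is an instance of the probability
generating functional (`IsPoissonProcess.lintegral_iInf_prod`,
`IsPoissonProcess.lintegral_nearest_tail`), and differentiating the tail and dividing by the one
factor gives `IsPoissonProcess.lintegral_nearest_mul_iprod`. The exponent is the integral of the loss
`A / ((q + h ^ 2) ^ (η / 2) + A)` over the squared distances `q > x ^ 2`; the Gauss hypergeometric
function appears because its differential equation makes `tailExponent` a primitive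
(`tailExponent_hasDerivAt`).

*UAVs.* In polar coordinates around the user equipment the distance of a UAV has density `fW`
(`Params.lintegral_uavDist`), and a UAV with a link of type `ζ` is not stronger than the base station
iff its distance is at least `exclRadius ζ x` (`Params.uavMeanPower_le_bsMeanPower_iff`). Since the
UAVs are independent and identically distributed, the expectation of `exp (-s I)` on the event that
no UAV is stronger is an `Nu`-th power (`Network.lintegral_prod_uavFactor`), and so is the probability
of this event, its value at `s = 0`.

*Conditioning.* Almost surely, the user equipment is served by a base station iff no UAV is stronger
than the nearest base station. The UAVs being independent of the base stations, they can be
integrated out given the nearest distance (`Network.lintegral_mul_uavProd`). This computes the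
integrals of `exp (-s I)` over the events that the nearest distance lies in a given set, which
identify the conditional law for almost every distance and all rational `s`. Continuity and
monotonicity in `s` give all `s > 0` with one null set (`ae_laplace_condDistrib_eq`).
-/

namespace HybridNet

open Filter Topology
open scoped ENNReal NNReal

/-! ### The hypergeometric exponent -/

/-- The `n`-th Taylor coefficient `n! / (c)_n` of `₂F₁(1, 1; c; z)`. -/
noncomputable def hypCoeff (c : ℝ) (n : ℕ) : ℝ := (n.factorial : ℝ) * ((ascPochhammer ℝ n).eval c)⁻¹

theorem hypergeometric_one_one_eq_tsum (c z : ℝ) :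
    ordinaryHypergeometric (1 : ℝ) 1 c z = ∑' n : ℕ, hypCoeff c n * z ^ n := by
  rw [ordinaryHypergeometric_eq_tsum]
  refine tsum_congr fun n => ?_
  rw [ascPochhammer_eval_one, hypCoeff, smul_eq_mul]
  field_simp

theorem hypCoeff_zero (c : ℝ) : hypCoeff c 0 = 1 := by simp [hypCoeff]

/-- The recursion between the Taylor coefficients, which is the differential equation of the series
coefficientwise. -/
theorem hypCoeff_succ {c : ℝ} (hc : 0 < c) (n : ℕ) :
    (c + n) * hypCoeff c (n + 1) = (n + 1) * hypCoeff c n := by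
  simp only [hypCoeff, ascPochhammer_succ_eval, Nat.factorial_succ, Nat.cast_mul, Nat.cast_succ]
  field_simp

theorem hypCoeff_nonneg {c : ℝ} (hc : 0 < c) (n : ℕ) : 0 ≤ hypCoeff c n :=
  mul_nonneg (by positivity) (inv_nonneg.2 (ascPochhammer_pos n c hc).le)

theorem hypCoeff_le_one {c : ℝ} (hc : 1 ≤ c) (n : ℕ) : hypCoeff c n ≤ 1 := by
  induction n with
  | zero => simp [hypCoeff_zero]
  | succ n ih =>
    have h := hypCoeff_succ (c := c) (by linarith) n
    by_contra hlt
    push Not at hlt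
    nlinarith

theorem hypSeries_summable {c z : ℝ} (hc : 1 ≤ c) (hz : |z| < 1) :
    Summable fun n : ℕ => hypCoeff c n * z ^ n := by
  refine Summable.of_norm_bounded (summable_geometric_of_abs_lt_one (r := |z|) (by simpa)) ?_
  intro n
  rw [norm_mul, norm_pow, Real.norm_eq_abs, Real.norm_eq_abs,
    abs_of_nonneg (hypCoeff_nonneg (by linarith) n)]
  exact mul_le_of_le_one_left (by positivity) (hypCoeff_le_one hc n)

theorem hypDerivSeries_summable {c z : ℝ} (hc : 1 ≤ c) (hz : |z| < 1) :
    Summable fun n : ℕ => (n : ℝ) * hypCoeff c n * z ^ n := by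
  have h := summable_pow_mul_geometric_of_norm_lt_one 1 (r := |z|) (by simpa)
  refine Summable.of_norm_bounded h ?_
  intro n
  rw [norm_mul, norm_mul, norm_pow, Real.norm_eq_abs, Real.norm_eq_abs, Real.norm_eq_abs,
    abs_of_nonneg (hypCoeff_nonneg (by linarith) n), Nat.abs_cast, pow_one]
  exact mul_le_mul_of_nonneg_right
    (mul_le_of_le_one_right (by positivity) (hypCoeff_le_one hc n)) (by positivity)

/-- The function `F = ₂F₁(1, 1; c; ·)` solves `(1 - z) (z F)' = 1 + (2 - c) (F - 1)` on the unit
disk. -/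
theorem hypergeometric_hasDerivAt {c z : ℝ} (hc : 1 ≤ c) (hz : |z| < 1) :
    HasDerivAt (fun z => z * ordinaryHypergeometric (1 : ℝ) 1 c z)
      ((1 + (2 - c) * (ordinaryHypergeometric (1 : ℝ) 1 c z - 1)) / (1 - z)) z := by
  obtain ⟨r, hzr, hr1⟩ := exists_between hz
  have hr0 : 0 < r := (abs_nonneg z).trans_lt hzr
  have hc0 : 0 < c := by linarith
  have hb : Summable fun n : ℕ => ((n : ℝ) + 1) * r ^ n := by
    have h1 := summable_pow_mul_geometric_of_norm_lt_one 1 (r := r)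
      (by rwa [Real.norm_eq_abs, abs_of_pos hr0])
    have h2 := summable_geometric_of_lt_one hr0.le hr1
    simpa [add_mul] using h1.add h2
  have key : HasDerivAt (fun y => ∑' n : ℕ, hypCoeff c n * y ^ (n + 1))
      (∑' n : ℕ, ((n : ℝ) + 1) * hypCoeff c n * z ^ n) z := by
    refine hasDerivAt_tsum_of_isPreconnected hb (t := Metric.ball (0 : ℝ) r) Metric.isOpen_ball
      (convex_ball _ _).isPreconnected (g := fun (n : ℕ) y => hypCoeff c n * y ^ (n + 1))
      (g' := fun (n : ℕ) y => ((n : ℝ) + 1) * hypCoeff c n * y ^ n) ?_ ?_ (y₀ := 0) (by simpa) ?_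
      (by simpa using hzr)
    · intro n y _
      have := (hasDerivAt_pow (n + 1) y).const_mul (hypCoeff c n)
      refine this.congr_deriv ?_
      push_cast
      ring_nf
    · intro n y hy
      have hy' : |y| < r := by simpa using hy
      rw [norm_mul, norm_mul, norm_pow, Real.norm_eq_abs, Real.norm_eq_abs, Real.norm_eq_abs,
        abs_of_nonneg (hypCoeff_nonneg hc0 n), abs_of_nonneg (by positivity : (0 : ℝ) ≤ n + 1)]
      have h1 := hypCoeff_le_one hc n
      gcongr
      exact mul_le_of_le_one_right (by positivity) h1
    · simp
  have hfun : (fun y => y * ordinaryHypergeometric (1 : ℝ) 1 c y)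
      = fun y => ∑' n : ℕ, hypCoeff c n * y ^ (n + 1) := by
    funext y
    rw [hypergeometric_one_one_eq_tsum, ← tsum_mul_left]
    exact tsum_congr fun n => by ring
  rw [hfun]
  refine key.congr_deriv ?_
  have h1z : 1 - z ≠ 0 := by
    have := (abs_lt.1 hz).2
    linarith
  rw [eq_div_iff h1z]
  have hA := hypSeries_summable hc hz
  have hB := hypDerivSeries_summable hc hz
  have hD : Summable fun n : ℕ => ((n : ℝ) + 1) * hypCoeff c n * z ^ n :=
    (hB.add hA).congr fun n => by ring
  have eF : ordinaryHypergeometric (1 : ℝ) 1 c z - 1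
      = ∑' n : ℕ, hypCoeff c (n + 1) * z ^ (n + 1) := by
    rw [hypergeometric_one_one_eq_tsum, hA.tsum_eq_zero_add, hypCoeff_zero]
    simp
  have eD : ∑' n : ℕ, ((n : ℝ) + 1) * hypCoeff c n * z ^ n
      = 1 + ∑' n : ℕ, ((n : ℝ) + 2) * hypCoeff c (n + 1) * z ^ (n + 1) := by
    rw [hD.tsum_eq_zero_add, hypCoeff_zero]
    simp only [Nat.cast_zero, Nat.cast_succ, zero_add, pow_zero, mul_one]
    congr 2
    funext n
    ring
  have hD1 : Summable fun n : ℕ => ((n : ℝ) + 2) * hypCoeff c (n + 1) * z ^ (n + 1) :=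
    ((summable_nat_add_iff 1).2 hD).congr fun n => by push_cast; ring
  rw [mul_sub, mul_one]
  nth_rw 1 [eD]
  rw [eF, ← tsum_mul_right, ← tsum_mul_left, add_sub_assoc,
    ← hD1.tsum_sub (hD.mul_right z)]
  congr 1
  refine tsum_congr fun n => ?_
  linear_combination (z ^ (n + 1)) * hypCoeff_succ hc0 n

theorem hypergeometric_continuousAt {c z : ℝ} (hc : 1 ≤ c) (hz : |z| < 1) :
    ContinuousAt (fun z => ordinaryHypergeometric (1 : ℝ) 1 c z) z := by
  obtain ⟨r, hzr, hr1⟩ := exists_between hz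
  have hr0 : 0 < r := (abs_nonneg z).trans_lt hzr
  have hc0 : 0 < c := by linarith
  simp_rw [hypergeometric_one_one_eq_tsum]
  have : ContinuousOn (fun z => ∑' n : ℕ, hypCoeff c n * z ^ n) (Metric.ball (0 : ℝ) r) := by
    refine continuousOn_tsum (fun n => by fun_prop) (summable_geometric_of_lt_one hr0.le hr1) ?_
    intro n y hy
    have hy' : |y| < r := by simpa using hy
    rw [norm_mul, norm_pow, Real.norm_eq_abs, Real.norm_eq_abs,
      abs_of_nonneg (hypCoeff_nonneg hc0 n)]
    refine (mul_le_of_le_one_left (by positivity) (hypCoeff_le_one hc n)).trans ?_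
    gcongr
  exact this.continuousAt (Metric.isOpen_ball.mem_nhds (by simpa using hzr))

/-- The exponent, up to the factor `π * lam`, in the Laplace transform of the interference of the
base stations at squared three-dimensional distance more than `U`, where `A = s * Pg`. -/
noncomputable def tailExponent (A η U : ℝ) : ℝ :=
  2 / (η - 2) * U * (1 / (1 + U ^ (η / 2) / A) *
    ordinaryHypergeometric (1 : ℝ) 1 (2 - 2 / η) (1 / (1 + U ^ (η / 2) / A)))

theorem abs_one_div_one_add_lt_one {y : ℝ} (hy : 0 < y) : |1 / (1 + y)| < 1 := by
  rw [abs_of_pos (by positivity), div_lt_one (by positivity)]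
  linarith

/-- The differential equation of `₂F₁(1, 1; c; ·)` makes `tailExponent` a primitive of minus the loss
`A / (U ^ (η / 2) + A)` caused by a base station at squared distance `U`. -/
theorem tailExponent_hasDerivAt {A η U : ℝ} (hA : 0 < A) (hη : 2 < η) (hU : 0 < U) :
    HasDerivAt (tailExponent A η) (-(A / (U ^ (η / 2) + A))) U := by
  have hη2 : η - 2 ≠ 0 := by linarith
  have hc : 1 ≤ 2 - 2 / η := by
    have : 2 / η ≤ 1 := by rw [div_le_one (by linarith)]; exact hη.le
    linarith
  have hp : 0 < U ^ (η / 2) := Real.rpow_pos_of_pos hU _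
  have hw : 0 < U ^ (η / 2) / A := by positivity
  have hz := abs_one_div_one_add_lt_one hw
  have hF := hypergeometric_hasDerivAt hc hz
  have hz' : HasDerivAt (fun U : ℝ => 1 / (1 + U ^ (η / 2) / A))
      (-(η / 2 * U ^ (η / 2 - 1) / A) / (1 + U ^ (η / 2) / A) ^ 2) U := by
    have h1 := ((Real.hasDerivAt_rpow_const (p := η / 2) (Or.inl hU.ne')).div_const A).const_add 1
    have h2 := h1.inv (by positivity)
    simp only [one_div]
    exact h2
  have hcomp := hF.comp U hz'
  have hlin : HasDerivAt (fun U : ℝ => 2 / (η - 2) * U) (2 / (η - 2)) U := by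
    simpa using (hasDerivAt_id U).const_mul (2 / (η - 2))
  have h := hlin.mul hcomp
  refine HasDerivAt.congr_deriv (f := tailExponent A η) h ?_
  simp only [Function.comp_apply]
  generalize ordinaryHypergeometric (1 : ℝ) 1 (2 - 2 / η) (1 / (1 + U ^ (η / 2) / A)) = F
  rw [Real.rpow_sub_one hU.ne']
  generalize U ^ (η / 2) = y at *
  have h3 : 1 + y / A = (y + A) / A := by field_simp; ring
  have h4 : 1 - A / (y + A) = y / (y + A) := by field_simp; ring
  rw [h3, one_div_div, h4]
  field_simp
  ring

theorem tailExponent_tendsto {A η : ℝ} (hA : 0 < A) (hη : 2 < η) :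
    Tendsto (tailExponent A η) atTop (𝓝 0) := by
  have hc : 1 ≤ 2 - 2 / η := by
    have : 2 / η ≤ 1 := by rw [div_le_one (by linarith)]; exact hη.le
    linarith
  have h1 : Tendsto (fun U : ℝ => U ^ (η / 2)) atTop atTop := tendsto_rpow_atTop (by linarith)
  have h2 : Tendsto (fun U : ℝ => 1 / (1 + U ^ (η / 2) / A)) atTop (𝓝 0) := by
    simp only [one_div]
    exact (tendsto_atTop_add_const_left _ _ (h1.atTop_div_const hA)).inv_tendsto_atTop
  have h3 : Tendsto (fun U : ℝ => ordinaryHypergeometric (1 : ℝ) 1 (2 - 2 / η)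
      (1 / (1 + U ^ (η / 2) / A))) atTop (𝓝 1) := by
    have := (hypergeometric_continuousAt hc (z := 0) (by simp)).tendsto.comp h2
    simpa [Function.comp_def] using this
  have h4 : Tendsto (fun U : ℝ => U * (1 / (1 + U ^ (η / 2) / A))) atTop (𝓝 0) := by
    have h5 : Tendsto (fun U : ℝ => A * U ^ (-(η / 2 - 1))) atTop (𝓝 0) := by
      simpa using (tendsto_rpow_neg_atTop (y := η / 2 - 1) (by linarith)).const_mul A
    refine tendsto_of_tendsto_of_tendsto_of_le_of_le' tendsto_const_nhds h5 ?_ ?_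
    · filter_upwards [eventually_gt_atTop 0] with U hU
      positivity
    · filter_upwards [eventually_gt_atTop 0] with U hU
      have hp : 0 < U ^ (η / 2) := Real.rpow_pos_of_pos hU _
      rw [neg_sub, Real.rpow_sub hU, Real.rpow_one]
      have h6 : 1 / (1 + U ^ (η / 2) / A) ≤ A / U ^ (η / 2) := by
        rw [div_le_div_iff₀ (by positivity) hp]
        have : A * (U ^ (η / 2) / A) = U ^ (η / 2) := by field_simp
        nlinarith
      calc U * (1 / (1 + U ^ (η / 2) / A)) ≤ U * (A / U ^ (η / 2)) := by gcongr
        _ = A * (U / U ^ (η / 2)) := by ring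
  have h7 := (h4.mul h3).const_mul (2 / (η - 2))
  simp only [zero_mul, mul_zero] at h7
  refine h7.congr fun U => ?_
  simp only [tailExponent]
  ring

/-! ### Probability generating functional of a Poisson process -/

theorem measurable_encard {Ω : Type*} [MeasurableSpace Ω] {P : ℕ → Ω → Prop}
    (hP : ∀ i, MeasurableSet {ω | P i ω}) : Measurable fun ω => {i | P i ω}.encard := by
  have hge : ∀ k : ℕ, MeasurableSet {ω | (k : ℕ∞) ≤ {i | P i ω}.encard} := by
    intro k
    have : {ω | (k : ℕ∞) ≤ {i | P i ω}.encard}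
        = ⋃ s : Finset ℕ, ⋃ _ : s.card = k, ⋂ i ∈ s, {ω | P i ω} := by
      ext ω
      simp only [Set.mem_ofPred_eq, Set.mem_iUnion, Set.mem_iInter, exists_prop]
      constructor
      · intro h
        obtain ⟨t, ht, htk⟩ := Set.exists_subset_encard_eq h
        have hfin : t.Finite := Set.finite_of_encard_eq_coe htk
        refine ⟨hfin.toFinset, ?_, fun i hi => ht (by simpa using hi)⟩
        rw [hfin.encard_eq_coe_toFinset_card] at htk
        exact_mod_cast htk
      · rintro ⟨s, rfl, hs⟩
        rw [← Set.encard_coe_eq_coe_finsetCard]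
        exact Set.encard_le_encard fun i hi => hs i hi
    rw [this]
    exact MeasurableSet.iUnion fun s => MeasurableSet.iUnion fun _ =>
      Finset.measurableSet_biInter _ fun i _ => hP i
  refine measurable_to_countable' fun x => ?_
  induction x with
  | top =>
    have : (fun ω => {i | P i ω}.encard) ⁻¹' {⊤}
        = ⋂ k : ℕ, {ω | (k : ℕ∞) ≤ {i | P i ω}.encard} := by
      ext ω
      simp only [Set.mem_preimage, Set.mem_singleton_iff, Set.mem_iInter, Set.mem_ofPred_eq]
      exact ⟨fun h k => h ▸ le_top, fun h => ENat.eq_top_iff_forall_ge.2 h⟩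
    rw [this]
    exact MeasurableSet.iInter hge
  | coe k =>
    have : (fun ω => {i | P i ω}.encard) ⁻¹' {(k : ℕ∞)}
        = {ω | (k : ℕ∞) ≤ {i | P i ω}.encard} \ {ω | ((k + 1 : ℕ) : ℕ∞) ≤ {i | P i ω}.encard} := by
      ext ω
      simp only [Set.mem_preimage, Set.mem_singleton_iff, Set.mem_sdiff, Set.mem_ofPred_eq]
      generalize {i | P i ω}.encard = n
      induction n with
      | top => simp
      | coe n =>
        norm_cast
        omega
    rw [this]
    exact (hge _).diff (hge _)

theorem antitone_prod_range {u : ℕ → ℝ≥0∞} (hu : ∀ i, u i ≤ 1) :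
    Antitone fun n => ∏ i ∈ Finset.range n, u i := by
  refine antitone_nat_of_succ_le fun n => ?_
  rw [Finset.prod_range_succ]
  exact mul_le_of_le_one_right' (hu n)

theorem iInf_eq_of_antitone_of_eventually_const {u : ℕ → ℝ≥0∞} (hu : Antitone u) {c : ℝ≥0∞} {M : ℕ}
    (h : ∀ n, M ≤ n → u n = c) : ⨅ n, u n = c := by
  refine le_antisymm ((iInf_le _ M).trans (h M le_rfl).le) (le_iInf fun n => ?_)
  rw [← h (max M n) (le_max_left _ _)]
  exact hu (le_max_right _ _)

namespace IsPoissonProcess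

variable {Ω : Type*} [MeasurableSpace Ω] {lam : ℝ} {X : ℕ → Ω → Plane} {μ : Measure Ω}

/-- The number of points of the process in `A`. -/
noncomputable def count (X : ℕ → Ω → Plane) (A : Set Plane) (ω : Ω) : ℕ∞ := {i | X i ω ∈ A}.encard

theorem measurable_count (hX : IsPoissonProcess lam X μ) {A : Set Plane} (hA : MeasurableSet A) :
    Measurable (count X A) :=
  measurable_encard fun i => hX.measurable i hA

variable [IsProbabilityMeasure μ]

/-- The defining property of the process gives the masses of the finite numbers of points; as they add
up to one, the number of points is almost surely finite. -/
theorem map_count (hX : IsPoissonProcess lam X μ) {A : Set Plane} (hA : MeasurableSet A)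
    (hA' : volume A ≠ ⊤) :
    μ.map (count X A)
      = (poissonMeasure (lam.toNNReal * (volume A).toNNReal)).map (Nat.cast : ℕ → ℕ∞) := by
  have hm := hX.measurable_count hA
  have hnat : Measurable (Nat.cast : ℕ → ℕ∞) := measurable_from_top
  have : IsProbabilityMeasure (μ.map (count X A)) :=
    Measure.isProbabilityMeasure_map hm.aemeasurable
  set r := lam.toNNReal * (volume A).toNNReal
  have h1 : ∀ k : ℕ, μ.map (count X A) {(k : ℕ∞)} = poissonMeasure r {k} := by
    intro k
    rw [Measure.map_apply hm (measurableSet_singleton _)]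
    exact hX.count_law A hA hA' k
  have h2 : ∀ k : ℕ, (poissonMeasure r).map (Nat.cast : ℕ → ℕ∞) {(k : ℕ∞)}
      = poissonMeasure r {k} := by
    intro k
    rw [Measure.map_apply hnat (measurableSet_singleton _)]
    congr 1
    ext n
    simp
  have h3 : ∀ ν : Measure ℕ∞, IsProbabilityMeasure ν →
      (∀ k : ℕ, ν {(k : ℕ∞)} = poissonMeasure r {k}) → ν {⊤} = 0 := by
    intro ν hν h
    have hrange : ν (⋃ k : ℕ, {(k : ℕ∞)}) = 1 := by
      rw [measure_iUnion (fun i j hij => by simpa using hij) fun _ => measurableSet_singleton _]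
      simp_rw [h]
      have := measure_iUnion (μ := poissonMeasure r) (f := fun k : ℕ => {k})
        (fun i j hij => by simpa using hij) fun _ => measurableSet_singleton _
      rw [← this]
      simp [Set.iUnion_of_singleton]
    rw [← prob_compl_eq_zero_iff (MeasurableSet.iUnion fun _ => measurableSet_singleton _)] at hrange
    refine measure_mono_null ?_ hrange
    intro x hx
    rw [Set.mem_singleton_iff] at hx
    simp [hx]
  refine Measure.ext_of_singleton fun x => ?_
  induction x with
  | top => rw [h3 _ inferInstance h1, h3 _ inferInstance h2]
  | coe k => rw [h1, h2]

theorem ae_count_ne_top (hX : IsPoissonProcess lam X μ) {A : Set Plane} (hA : MeasurableSet A)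
    (hA' : volume A ≠ ⊤) : ∀ᵐ ω ∂μ, count X A ω ≠ ⊤ := by
  have hm := hX.measurable_count hA
  have h : ∀ᵐ x ∂(μ.map (count X A)), x ≠ ⊤ := by
    rw [hX.map_count hA hA']
    exact (ae_map_iff (measurable_from_top (f := (Nat.cast : ℕ → ℕ∞))).aemeasurable
      (measurableSet_singleton _).compl).2 (Eventually.of_forall fun k => ENat.natCast_ne_top k)
  exact ae_of_ae_map hm.aemeasurable h

theorem lintegral_count (hX : IsPoissonProcess lam X μ) {A : Set Plane} (hA : MeasurableSet A)
    (hA' : volume A ≠ ⊤) (f : ℕ∞ → ℝ≥0∞) :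
    ∫⁻ ω, f (count X A ω) ∂μ
      = ∑' k : ℕ, f k * poissonMeasure (lam.toNNReal * (volume A).toNNReal) {k} := by
  have hm := hX.measurable_count hA
  rw [← lintegral_map (f := f) measurable_from_top hm, hX.map_count hA hA',
    lintegral_map measurable_from_top measurable_from_top, lintegral_countable']

/-- The probability generating function of the number of points in a set of finite area. -/
theorem lintegral_pow_count (hX : IsPoissonProcess lam X μ) (hlam : 0 ≤ lam) {A : Set Plane}
    (hA : MeasurableSet A) (hA' : volume A ≠ ⊤) {v : ℝ≥0∞} (hv : v ≤ 1) :
    ∫⁻ ω, (1 - v) ^ (count X A ω).toNat ∂μ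
      = ENNReal.ofReal (Real.exp (-(lam * (v * volume A).toReal))) := by
  rw [hX.lintegral_count hA hA' fun n => (1 - v) ^ n.toNat]
  set r := lam.toNNReal * (volume A).toNNReal with hr
  have hv' : v ≠ ⊤ := ne_top_of_le_ne_top ENNReal.one_ne_top hv
  obtain ⟨w, rfl⟩ : ∃ w : ℝ≥0, v = w := ⟨v.toNNReal, (ENNReal.coe_toNNReal hv').symm⟩
  have hw : (w : ℝ) ≤ 1 := by exact_mod_cast hv
  have e1 : (1 : ℝ≥0∞) - w = ENNReal.ofReal (1 - w) := by
    rw [ENNReal.ofReal_sub _ w.coe_nonneg]; simp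
  have hsum : HasSum (fun k : ℕ => (1 - (w : ℝ)) ^ k * (Real.exp (-r) * r ^ k / k.factorial))
      (Real.exp (-(lam * (w * volume A).toReal))) := by
    have := (NormedSpace.expSeries_div_hasSum_exp ((1 - (w : ℝ)) * r)).mul_left (Real.exp (-r))
    rw [← Real.exp_eq_exp_ℝ, ← Real.exp_add] at this
    convert! this using 1
    · funext k
      rw [mul_pow]
      ring
    · congr 1
      have : (r : ℝ) = lam * (volume A).toReal := by
        rw [hr, NNReal.coe_mul, Real.coe_toNNReal _ hlam]; rfl
      rw [this, ENNReal.toReal_mul, ENNReal.coe_toReal]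
      ring
  rw [← hsum.tsum_eq, ENNReal.ofReal_tsum_of_nonneg _ hsum.summable]
  · refine tsum_congr fun k => ?_
    rw [poissonMeasure_singleton, e1, ENat.toNat_natCast, ← ENNReal.ofReal_pow (by linarith),
      ← ENNReal.ofReal_mul (by positivity)]
  · intro k
    positivity

/-- The mean number of points in a set of finite area. -/
theorem lintegral_count_eq (hX : IsPoissonProcess lam X μ) {A : Set Plane}
    (hA : MeasurableSet A) (hA' : volume A ≠ ⊤) :
    ∫⁻ ω, (count X A ω : ℝ≥0∞) ∂μ = ENNReal.ofReal lam * volume A := by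
  rw [hX.lintegral_count hA hA' fun n => (n : ℝ≥0∞)]
  set r := lam.toNNReal * (volume A).toNNReal with hr
  have hsum : HasSum (fun k : ℕ => (k : ℝ) * (Real.exp (-r) * r ^ k / k.factorial)) r := by
    rw [← hasSum_nat_add_iff' 1]
    have := (NormedSpace.expSeries_div_hasSum_exp (r : ℝ)).mul_left (Real.exp (-r) * r)
    rw [← Real.exp_eq_exp_ℝ] at this
    convert! this using 1
    · funext k
      rw [Nat.factorial_succ]
      push_cast
      field_simp
      ring
    · have : Real.exp (-(r : ℝ)) * Real.exp r = 1 := by rw [← Real.exp_add]; simp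
      simp only [Finset.range_one, Finset.sum_singleton, Nat.cast_zero, zero_mul, sub_zero]
      linear_combination -(r : ℝ) * this
  have : ENNReal.ofReal lam * volume A = ENNReal.ofReal r := by
    rw [hr, ENNReal.ofReal_coe_nnreal, ENNReal.coe_mul, ENNReal.coe_toNNReal hA']
    rfl
  rw [this, ← hsum.tsum_eq, ENNReal.ofReal_tsum_of_nonneg (fun k => by positivity) hsum.summable]
  refine tsum_congr fun k => ?_
  rw [poissonMeasure_singleton, ENNReal.ofReal_mul (by positivity)]
  simp

/-- Campbell's formula: the intensity measure of the process is `lam` times Lebesgue measure. -/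
theorem lintegral_tsum_points (hX : IsPoissonProcess lam X μ) {f : Plane → ℝ≥0∞}
    (hf : Measurable f) :
    ∫⁻ ω, ∑' i, f (X i ω) ∂μ = ENNReal.ofReal lam * ∫⁻ y, f y := by
  have hfin : ∀ A, MeasurableSet A → volume A ≠ ⊤ →
      Measure.sum (fun i => μ.map (X i)) A = (ENNReal.ofReal lam • volume : Measure Plane) A := by
    intro A hA hA'
    rw [Measure.smul_apply, smul_eq_mul, ← hX.lintegral_count_eq hA hA',
      Measure.sum_apply _ hA]
    simp_rw [Measure.map_apply (hX.measurable _) hA]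
    have : ∀ ω, (count X A ω : ℝ≥0∞) = ∑' i, (X i ⁻¹' A).indicator 1 ω := by
      intro ω
      rw [count, ← ENNReal.tsum_set_one, tsum_subtype {i | X i ω ∈ A} fun _ => (1 : ℝ≥0∞)]
      rfl
    simp_rw [this]
    rw [MeasureTheory.lintegral_tsum fun i =>
      (measurable_one.indicator (hX.measurable i hA)).aemeasurable]
    exact tsum_congr fun i => (lintegral_indicator_one (hX.measurable i hA)).symm
  have hsum : Measure.sum (fun i => μ.map (X i)) = (ENNReal.ofReal lam • volume : Measure Plane) := by
    ext A hA
    have hU : A = ⋃ n : ℕ, A ∩ Metric.ball 0 n := by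
      rw [← Set.inter_iUnion, Metric.iUnion_ball_nat, Set.inter_univ]
    have hmono : Monotone fun n : ℕ => A ∩ Metric.ball (0 : Plane) n := fun m n hmn =>
      Set.inter_subset_inter_right _ (Metric.ball_subset_ball (by exact_mod_cast hmn))
    rw [hU, hmono.measure_iUnion, hmono.measure_iUnion]
    refine iSup_congr fun n => hfin _ (hA.inter measurableSet_ball) ?_
    exact ne_top_of_le_ne_top measure_ball_lt_top.ne (measure_mono Set.inter_subset_right)
  rw [MeasureTheory.lintegral_tsum (f := fun i ω => f (X i ω))
    fun i => (hf.comp (hX.measurable i)).aemeasurable]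
  calc ∑' i, ∫⁻ ω, f (X i ω) ∂μ = ∑' i, ∫⁻ y, f y ∂(μ.map (X i)) :=
        tsum_congr fun i => (lintegral_map hf (hX.measurable i)).symm
    _ = ENNReal.ofReal lam * ∫⁻ y, f y := by
        rw [← lintegral_sum_measure, hsum, lintegral_smul_measure, smul_eq_mul]

/-- The probability generating functional, evaluated at a simple function. -/
theorem lintegral_iInf_prod_simpleFunc (hX : IsPoissonProcess lam X μ) (hlam : 0 ≤ lam)
    (f : SimpleFunc Plane ℝ≥0∞) (hf : ∀ y, f y ≤ 1) (hfin : f.lintegral volume ≠ ⊤) :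
    ∫⁻ ω, ⨅ n, ∏ i ∈ Finset.range n, (1 - f (X i ω)) ∂μ
      = ENNReal.ofReal (Real.exp (-(lam * (f.lintegral volume).toReal))) := by
  classical
  set S := f.range.filter (· ≠ 0) with hS
  let e : Fin S.card ≃ S := S.equivFin.symm
  let A : Fin S.card → Set Plane := fun l => f ⁻¹' {(e l : ℝ≥0∞)}
  have hA : ∀ l, MeasurableSet (A l) := fun l => f.measurableSet_preimage _
  have hS0 : ∀ v ∈ S, v ≠ 0 := fun v hv => (Finset.mem_filter.1 hv).2
  have hS1 : ∀ v ∈ S, v ≤ 1 := by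
    intro v hv
    obtain ⟨y, rfl⟩ := SimpleFunc.mem_range.1 (Finset.mem_filter.1 hv).1
    exact hf y
  have hvol : ∀ v ≠ 0, volume (f ⁻¹' {v}) ≠ ⊤ := fun v hv =>
    ((SimpleFunc.FinMeasSupp.of_lintegral_ne_top hfin).meas_preimage_singleton_ne_zero hv).ne
  have hA' : ∀ l, volume (A l) ≠ ⊤ := fun l => hvol _ (hS0 _ (e l).2)
  have hdisj : ∀ l l', l ≠ l' → Disjoint (A l) (A l') := by
    intro l l' hl
    refine Disjoint.preimage _ (Set.disjoint_singleton.2 fun h => hl ?_)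
    exact e.injective (Subtype.ext h)
  -- Almost surely only finitely many points lie in the support of `f`, and then the product is
  -- a finite product over the values of `f`.
  have hae : ∀ᵐ ω ∂μ, ⨅ n, ∏ i ∈ Finset.range n, (1 - f (X i ω))
      = ∏ l, (1 - (e l : ℝ≥0∞)) ^ (count X (A l) ω).toNat := by
    have hall : ∀ᵐ ω ∂μ, ∀ l, count X (A l) ω ≠ ⊤ :=
      ae_all_iff.2 fun l => hX.ae_count_ne_top (hA l) (hA' l)
    filter_upwards [hall] with ω hω
    have hcount : ∀ v ∈ S, {i | f (X i ω) = v}.Finite := by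
      intro v hv
      have := hω (e.symm ⟨v, hv⟩)
      rw [count, Set.encard_ne_top_iff] at this
      simpa [A] using this
    have hI : {i | f (X i ω) ≠ 0}.Finite := by
      refine (S.finite_toSet.biUnion fun v hv => hcount v hv).subset fun i hi => ?_
      simp only [Set.mem_iUnion]
      exact ⟨f (X i ω), Finset.mem_filter.2 ⟨SimpleFunc.mem_range_self _ _, hi⟩, rfl⟩
    obtain ⟨M, hM⟩ := hI.bddAbove
    refine iInf_eq_of_antitone_of_eventually_const
      (antitone_prod_range fun i => tsub_le_self) (M := M + 1) fun n hn => ?_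
    have h1 : ∏ i ∈ Finset.range n, (1 - f (X i ω)) = ∏ i ∈ hI.toFinset, (1 - f (X i ω)) := by
      symm
      refine Finset.prod_subset (fun i hi => ?_) fun i _ hi => ?_
      · rw [Set.Finite.mem_toFinset] at hi
        have := hM hi
        rw [Finset.mem_range]
        omega
      · rw [Set.Finite.mem_toFinset, Set.mem_ofPred_eq, not_not] at hi
        rw [hi, tsub_zero]
    have hmaps : ∀ i ∈ hI.toFinset, f (X i ω) ∈ S := by
      intro i hi
      rw [Set.Finite.mem_toFinset] at hi
      exact Finset.mem_filter.2 ⟨SimpleFunc.mem_range_self _ _, hi⟩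
    rw [h1, ← Finset.prod_fiberwise_of_maps_to hmaps,
      e.prod_comp fun v : S => (1 - (v : ℝ≥0∞)) ^ (count X (f ⁻¹' {(v : ℝ≥0∞)}) ω).toNat,
      Finset.prod_coe_sort S fun v => (1 - v) ^ (count X (f ⁻¹' {v}) ω).toNat]
    refine Finset.prod_congr rfl fun v hv => ?_
    rw [Finset.prod_congr rfl (g := fun _ => 1 - v)
      fun i hi => by rw [(Finset.mem_filter.1 hi).2], Finset.prod_const]
    congr 1
    have : {i | X i ω ∈ f ⁻¹' {v}} = ((hI.toFinset.filter fun i => f (X i ω) = v : Finset ℕ) : Set ℕ) := by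
      ext i
      simp only [Set.mem_preimage, Set.mem_singleton_iff, Set.mem_ofPred_eq, Finset.coe_filter,
        Set.Finite.mem_toFinset]
      exact ⟨fun h => ⟨h ▸ hS0 v hv, h⟩, fun h => h.2⟩
    rw [count, this, Set.encard_coe_eq_coe_finsetCard, ENat.toNat_natCast]
  rw [lintegral_congr_ae hae]
  have hind : iIndepFun (fun l ω => (1 - (e l : ℝ≥0∞)) ^ (count X (A l) ω).toNat) μ :=
    (hX.count_indep _ A hA hdisj).comp (fun l (n : ℕ∞) => (1 - (e l : ℝ≥0∞)) ^ n.toNat)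
      fun l => measurable_from_top
  rw [lintegral_prod_eq_prod_lintegral_of_indepFun _ _ hind fun l =>
    (measurable_from_top (f := fun n : ℕ∞ => (1 - (e l : ℝ≥0∞)) ^ n.toNat)).comp
      (hX.measurable_count (hA l))]
  simp_rw [fun l => hX.lintegral_pow_count hlam (hA l) (hA' l) (hS1 _ (e l).2)]
  rw [← ENNReal.ofReal_prod_of_nonneg fun l _ => (Real.exp_pos _).le, ← Real.exp_sum,
    Finset.sum_neg_distrib, ← Finset.mul_sum]
  congr 4
  have hne : ∀ l, (e l : ℝ≥0∞) * volume (A l) ≠ ⊤ := fun l =>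
    ENNReal.mul_ne_top (ne_top_of_le_ne_top ENNReal.one_ne_top (hS1 _ (e l).2)) (hA' l)
  rw [← ENNReal.toReal_sum fun l _ => hne l]
  congr 1
  rw [e.sum_comp fun v : S => (v : ℝ≥0∞) * volume (f ⁻¹' {(v : ℝ≥0∞)}),
    Finset.sum_coe_sort S fun v => v * volume (f ⁻¹' {v}), SimpleFunc.lintegral, hS,
    Finset.sum_filter_of_ne]
  intro v _ h hv
  simp [hv] at h

/-- The probability generating functional of a Poisson process. The infinite product
`∏ i, (1 - g (X i))` of factors in `[0, 1]` is the infimum of its partial products. -/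
theorem lintegral_iInf_prod (hX : IsPoissonProcess lam X μ) (hlam : 0 ≤ lam) {g : Plane → ℝ≥0∞}
    (hg : Measurable g) (hg1 : ∀ y, g y ≤ 1) (hfin : ∫⁻ y, g y ≠ ⊤) :
    ∫⁻ ω, ⨅ n, ∏ i ∈ Finset.range n, (1 - g (X i ω)) ∂μ
      = ENNReal.ofReal (Real.exp (-(lam * (∫⁻ y, g y).toReal))) := by
  let f := SimpleFunc.eapprox g
  have hmono : Monotone f := SimpleFunc.monotone_eapprox g
  have hfg : ∀ m y, f m y ≤ g y := fun m y => by
    rw [← SimpleFunc.iSup_eapprox_apply hg]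
    exact le_iSup (fun n => f n y) m
  have hf1 : ∀ m y, f m y ≤ 1 := fun m y => (hfg m y).trans (hg1 y)
  have hlf : ∀ m, (f m).lintegral volume ≤ ∫⁻ y, g y := fun m => by
    rw [← SimpleFunc.lintegral_eq_lintegral]
    exact lintegral_mono (hfg m)
  have hlf' : ∀ m, (f m).lintegral volume ≠ ⊤ := fun m => ne_top_of_le_ne_top hfin (hlf m)
  have hanti : ∀ ω n, Antitone fun m => ∏ i ∈ Finset.range n, (1 - f m (X i ω)) :=
    fun ω n m m' h => Finset.prod_le_prod' fun i _ => tsub_le_tsub_left (hmono h _) _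
  have hlim : ∀ ω n, ⨅ m, ∏ i ∈ Finset.range n, (1 - f m (X i ω))
      = ∏ i ∈ Finset.range n, (1 - g (X i ω)) := by
    intro ω n
    refine tendsto_nhds_unique (tendsto_atTop_iInf (hanti ω n)) ?_
    refine ENNReal.tendsto_finsetProd_of_ne_top _ (fun i _ => ?_) fun i _ => ?_
    · exact ENNReal.Tendsto.sub tendsto_const_nhds (SimpleFunc.tendsto_eapprox hg _)
        (Or.inl ENNReal.one_ne_top)
    · exact ne_top_of_le_ne_top ENNReal.one_ne_top tsub_le_self
  have hswap : ∀ ω, ⨅ n, ∏ i ∈ Finset.range n, (1 - g (X i ω))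
      = ⨅ m, ⨅ n, ∏ i ∈ Finset.range n, (1 - f m (X i ω)) := by
    intro ω
    rw [iInf_comm]
    exact iInf_congr fun n => (hlim ω n).symm
  simp_rw [hswap]
  rw [lintegral_iInf]
  · have hval := fun m => hX.lintegral_iInf_prod_simpleFunc hlam (f m) (hf1 m) (hlf' m)
    simp_rw [hval]
    have hanti' : Antitone fun m =>
        ENNReal.ofReal (Real.exp (-(lam * ((f m).lintegral volume).toReal))) := by
      intro m m' h
      refine ENNReal.ofReal_le_ofReal (Real.exp_le_exp.2 (neg_le_neg ?_))
      refine mul_le_mul_of_nonneg_left (ENNReal.toReal_mono (hlf' _) ?_) hlam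
      exact SimpleFunc.lintegral_mono (hmono h) le_rfl
    refine tendsto_nhds_unique (tendsto_atTop_iInf hanti') ?_
    have h1 : Tendsto (fun m => (f m).lintegral volume) atTop (𝓝 (∫⁻ y, g y)) := by
      rw [lintegral_eq_iSup_eapprox_lintegral hg]
      exact tendsto_atTop_iSup fun m m' h => SimpleFunc.lintegral_mono (hmono h) le_rfl
    have h2 := (ENNReal.tendsto_toReal hfin).comp h1
    exact (ENNReal.continuous_ofReal.comp Real.continuous_exp).continuousAt.tendsto.comp
      (h2.const_mul lam).neg
  · intro m
    refine Measurable.iInf fun n => Finset.measurable_prod _ fun i _ => ?_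
    exact measurable_const.sub ((f m).measurable.comp (hX.measurable i))
  · intro m m' h ω
    exact iInf_mono fun n => hanti ω n h
  · refine ne_top_of_le_ne_top ENNReal.one_ne_top ?_
    calc _ ≤ ∫⁻ _, 1 ∂μ := lintegral_mono fun ω => iInf_le_of_le 0 (by simp)
      _ = 1 := by simp

end IsPoissonProcess

/-! ### The nearest point of a Poisson process -/

/-- The integral of a nonnegative function over a half-line from a primitive vanishing at infinity. -/
theorem lintegral_Ioi_of_hasDerivAt {K k : ℝ → ℝ} {a : ℝ}
    (hderiv : ∀ x, a ≤ x → HasDerivAt K (-k x) x) (hk : ∀ x, a ≤ x → 0 ≤ k x)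
    (hK : Tendsto K atTop (𝓝 0)) :
    ∫⁻ x in Set.Ioi a, ENNReal.ofReal (k x) = ENNReal.ofReal (K a) := by
  have hneg : ∀ x ∈ Set.Ioi a, -k x ≤ 0 := fun x hx => neg_nonpos.2 (hk x (le_of_lt hx))
  have hint := (integrableOn_Ioi_deriv_of_nonpos' hderiv hneg hK).neg
  have hval := integral_Ioi_of_hasDerivAt_of_nonpos' hderiv hneg hK
  rw [integral_neg, zero_sub, neg_inj] at hval
  rw [← hval, ofReal_integral_eq_lintegral_ofReal]
  · exact hint.congr (Eventually.of_forall fun x => by simp)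
  · exact (ae_restrict_iff' measurableSet_Ioi).2 (Eventually.of_forall fun x hx => hk x (le_of_lt hx))

/-- A finite measure on `[0, ∞)` whose tail function is a `C¹` function `K` has density `-K'`. -/
theorem eq_withDensity_of_tail {ν : Measure ℝ} [IsFiniteMeasure ν] {K k : ℝ → ℝ}
    (hν : ∀ t, ν (Set.Ici t) = ENNReal.ofReal (K (max t 0)))
    (hderiv : ∀ x, 0 ≤ x → HasDerivAt K (-k x) x) (hk : ∀ x, 0 ≤ x → 0 ≤ k x)
    (hK : Tendsto K atTop (𝓝 0)) :
    ν = (volume.restrict (Set.Ioi 0)).withDensity fun x => ENNReal.ofReal (k x) := by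
  refine Measure.ext_of_Ici _ _ fun t => ?_
  have ht : (0 : ℝ) ≤ max t 0 := le_max_right _ _
  rw [hν, withDensity_apply _ measurableSet_Ici, Measure.restrict_restrict measurableSet_Ici,
    ← lintegral_Ioi_of_hasDerivAt (fun x hx => hderiv x (ht.trans hx))
      (fun x hx => hk x (ht.trans hx)) hK]
  rcases le_or_gt t 0 with h | h
  · have hset : Set.Ici t ∩ Set.Ioi 0 = Set.Ioi 0 :=
      Set.inter_eq_self_of_subset_right fun x hx => h.trans (le_of_lt hx)
    rw [max_eq_right h, hset]
  · have hset : Set.Ici t ∩ Set.Ioi 0 = Set.Ici t :=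
      Set.inter_eq_self_of_subset_left fun x hx => h.trans_le hx
    rw [max_eq_left h.le, hset]
    exact setLIntegral_congr Ioi_ae_eq_Ici

/-- The image of Lebesgue measure on the plane under the squared distance to a point. -/
theorem map_sq_dist (u : Plane) :
    (volume : Measure Plane).map (fun y => dist y u ^ 2)
      = ENNReal.ofReal Real.pi • volume.restrict (Set.Ioi 0) := by
  have hm : Measurable fun y : Plane => dist y u ^ 2 := by fun_prop
  have hIic : ∀ t : ℝ, volume ((fun y : Plane => dist y u ^ 2) ⁻¹' Set.Iic t)
      = ENNReal.ofReal t * ENNReal.ofReal Real.pi := by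
    intro t
    rcases lt_or_ge t 0 with ht | ht
    · have : (fun y : Plane => dist y u ^ 2) ⁻¹' Set.Iic t = ∅ := by
        ext y
        simp only [Set.mem_preimage, Set.mem_Iic, Set.mem_empty_iff_false, iff_false, not_le]
        exact ht.trans_le (by positivity)
      rw [this, ENNReal.ofReal_of_nonpos ht.le]
      simp
    · have : (fun y : Plane => dist y u ^ 2) ⁻¹' Set.Iic t = Metric.closedBall u √t := by
        ext y
        simp only [Set.mem_preimage, Set.mem_Iic, Metric.mem_closedBall]
        exact (Real.le_sqrt dist_nonneg ht).symm
      rw [this, EuclideanSpace.volume_closedBall_fin_two, ← ENNReal.ofReal_pow (Real.sqrt_nonneg _),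
        Real.sq_sqrt ht]
  have hne : ∀ t : ℝ, volume ((fun y : Plane => dist y u ^ 2) ⁻¹' Set.Iic t) ≠ ⊤ := fun t => by
    rw [hIic]
    finiteness
  have hIoc : ∀ ⦃a b : ℝ⦄, a < b → (volume : Measure Plane).map (fun y => dist y u ^ 2) (Set.Ioc a b)
      = ENNReal.ofReal b * ENNReal.ofReal Real.pi - ENNReal.ofReal a * ENNReal.ofReal Real.pi := by
    intro a b hab
    rw [Measure.map_apply hm measurableSet_Ioc, ← Set.Iic_sdiff_Iic, Set.preimage_sdiff,
      measure_sdiff (Set.preimage_mono (Set.Iic_subset_Iic.2 hab.le))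
        (hm measurableSet_Iic).nullMeasurableSet (hne a), hIic, hIic]
  refine Measure.ext_of_Ioc' _ _ (fun a b hab => ?_) fun a b hab => ?_
  · rw [hIoc hab]
    finiteness
  · rw [hIoc hab, Measure.smul_apply, Measure.restrict_apply measurableSet_Ioc, smul_eq_mul,
      ← ENNReal.sub_mul (fun _ _ => ENNReal.ofReal_ne_top), mul_comm]
    congr 1
    rw [Set.Ioc_inter_Ioi, Real.volume_Ioc]
    rcases le_total a 0 with h | h
    · rw [ENNReal.ofReal_of_nonpos h, max_eq_right h]
      simp
    · rw [max_eq_left h, ENNReal.ofReal_sub _ h]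

theorem lintegral_comp_sq_dist (u : Plane) {G : ℝ → ℝ≥0∞} (hG : Measurable G) :
    ∫⁻ y : Plane, G (dist y u ^ 2) = ENNReal.ofReal Real.pi * ∫⁻ q in Set.Ioi 0, G q := by
  rw [← lintegral_map hG (by fun_prop), map_sq_dist, lintegral_smul_measure, smul_eq_mul]

/-- The infinite product of the values of `u` along a configuration, as the infimum of its partial
products; the factors will always lie in `[0, 1]`. -/
noncomputable def iprod (u : ℕ → ℝ≥0∞) : ℝ≥0∞ := ⨅ n, ∏ i ∈ Finset.range n, u i

theorem iprod_le_one (u : ℕ → ℝ≥0∞) : iprod u ≤ 1 := iInf_le_of_le 0 (by simp)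

theorem tendsto_iprod {u : ℕ → ℝ≥0∞} (hu : ∀ i, u i ≤ 1) :
    Tendsto (fun n => ∏ i ∈ Finset.range n, u i) atTop (𝓝 (iprod u)) :=
  tendsto_atTop_iInf (antitone_prod_range hu)

theorem iprod_eq_zero {u : ℕ → ℝ≥0∞} {j : ℕ} (hj : u j = 0) : iprod u = 0 := by
  refine le_antisymm (iInf_le_of_le (j + 1) ?_) zero_le
  rw [Finset.prod_eq_zero (Finset.self_mem_range_succ j) hj]

/-- One factor can be taken out of the infinite product, even if it is zero. -/
theorem iprod_eq_mul {u : ℕ → ℝ≥0∞} (hu : ∀ i, u i ≤ 1) (j : ℕ) :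
    iprod u = u j * iprod fun i => if i = j then 1 else u i := by
  have hv : ∀ i, (if i = j then 1 else u i) ≤ 1 := fun i => by
    split_ifs
    · exact le_rfl
    · exact hu i
  have hj : u j ≠ ⊤ := ne_top_of_le_ne_top ENNReal.one_ne_top (hu j)
  refine tendsto_nhds_unique (tendsto_iprod hu)
    ((ENNReal.Tendsto.const_mul (tendsto_iprod hv) (Or.inr hj)).congr' ?_)
  filter_upwards [eventually_gt_atTop j] with n hn
  have hmem : j ∈ Finset.range n := Finset.mem_range.2 hn
  rw [← Finset.mul_prod_erase _ _ hmem, ← Finset.mul_prod_erase _ u hmem, if_pos rfl, one_mul]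
  congr 1
  exact Finset.prod_congr rfl fun i hi => by rw [if_neg (Finset.ne_of_mem_erase hi)]

theorem measurable_iprod {α : Type*} [MeasurableSpace α] {u : ℕ → α → ℝ≥0∞}
    (hu : ∀ i, Measurable (u i)) : Measurable fun a => iprod fun i => u i a :=
  Measurable.iInf fun _ => Finset.measurable_prod _ fun i _ => hu i

namespace Params

variable (p : Params)

theorem bsMeanPower_le_iff {s t : ℝ} (hs : 0 ≤ s) (ht : 0 ≤ t) :
    p.bsMeanPower s ≤ p.bsMeanPower t ↔ t ≤ s := by
  have hg := p.hg_pos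
  have he := p.etag_gt
  rw [bsMeanPower, bsMeanPower, mul_le_mul_iff_right₀ p.Pg_pos,
    Real.rpow_le_rpow_iff_of_neg (by positivity) (by positivity) (by linarith), add_le_add_iff_right,
    sq_le_sq₀ ht hs]

@[fun_prop]
theorem measurable_bsHorizDist : Measurable p.bsHorizDist := by
  unfold bsHorizDist
  fun_prop

@[fun_prop]
theorem measurable_bsMeanPower : Measurable p.bsMeanPower := by
  unfold bsMeanPower
  fun_prop

/-- Index of the base station with the largest average received power in a configuration. -/
noncomputable def nearest (x : ℕ → Plane) : ℕ :=
  sInf {i | ∀ i', p.bsMeanPower (p.bsHorizDist (x i')) ≤ p.bsMeanPower (p.bsHorizDist (x i))}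

/-- Horizontal distance of the base station `nearest`. -/
noncomputable def nearestDist (x : ℕ → Plane) : ℝ := p.bsHorizDist (x (p.nearest x))

/-- The event that no station is nearest, on which `nearest` is `sInf ∅ = 0`, needs separate care. -/
theorem measurable_nearest : Measurable p.nearest := by
  have hP : ∀ i, MeasurableSet {x : ℕ → Plane | ∀ i', p.bsMeanPower (p.bsHorizDist (x i')) ≤
      p.bsMeanPower (p.bsHorizDist (x i))} := by
    intro i
    have : {x : ℕ → Plane | ∀ i', p.bsMeanPower (p.bsHorizDist (x i')) ≤
      p.bsMeanPower (p.bsHorizDist (x i))} = ⋂ i', {x : ℕ → Plane |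
        p.bsMeanPower (p.bsHorizDist (x i')) ≤ p.bsMeanPower (p.bsHorizDist (x i))} := by
      ext x
      simp
    rw [this]
    exact MeasurableSet.iInter fun i' => measurableSet_le (by fun_prop) (by fun_prop)
  set P : ℕ → (ℕ → Plane) → Prop := fun i x => ∀ i', p.bsMeanPower (p.bsHorizDist (x i')) ≤
      p.bsMeanPower (p.bsHorizDist (x i))
  have hE : MeasurableSet {x | ∀ m, ¬ P m x} := by
    have : {x | ∀ m, ¬ P m x} = ⋂ m, {x | P m x}ᶜ := by
      ext x
      simp
    rw [this]
    exact MeasurableSet.iInter fun m => (hP m).compl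
  refine measurable_to_countable' fun n => ?_
  have : p.nearest ⁻¹' {n}
      = ({x | P n x} ∩ ⋂ m ∈ Finset.range n, {x | P m x}ᶜ) ∪ ({x | ∀ m, ¬ P m x} ∩ {_x | n = 0}) := by
    ext x
    simp only [Set.mem_preimage, Set.mem_singleton_iff, Set.mem_union, Set.mem_inter_iff,
      Set.mem_iInter, Set.mem_compl_iff, Set.mem_ofPred_eq, Finset.mem_range]
    change sInf {i | P i x} = n ↔ _
    by_cases hne : ∃ m, P m x
    · have hmem : P (sInf {i | P i x}) x := Nat.sInf_mem hne
      constructor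
      · rintro rfl
        exact Or.inl ⟨hmem, fun m hm h => Nat.notMem_of_lt_sInf hm h⟩
      · rintro (⟨h1, h2⟩ | ⟨h1, -⟩)
        · refine le_antisymm (Nat.sInf_le h1) (not_lt.1 fun h => h2 _ h hmem)
        · exact absurd hne (not_exists.2 h1)
    · have hemp : {i | P i x} = ∅ := Set.eq_empty_of_forall_notMem fun m hm => hne ⟨m, hm⟩
      rw [hemp, Nat.sInf_empty]
      constructor
      · rintro rfl
        exact Or.inr ⟨not_exists.1 hne, rfl⟩
      · rintro (⟨h1, -⟩ | ⟨-, h2⟩)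
        · exact absurd ⟨n, h1⟩ hne
        · exact h2.symm
  rw [this]
  refine MeasurableSet.union ((hP n).inter (Finset.measurableSet_biInter _ fun m _ => (hP m).compl))
    (hE.inter (MeasurableSet.const _))

@[fun_prop]
theorem measurable_nearestDist : Measurable p.nearestDist := by
  have h : Measurable fun z : ℕ × (ℕ → Plane) => z.2 z.1 :=
    measurable_from_prod_countable_right fun n => measurable_pi_apply n
  exact p.measurable_bsHorizDist.comp (h.comp (p.measurable_nearest.prodMk measurable_id))

theorem nearestDist_nonneg (x : ℕ → Plane) : 0 ≤ p.nearestDist x := dist_nonneg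

theorem nearest_spec {x : ℕ → Plane} (hx : ∃ i, ∀ i', p.bsHorizDist (x i) ≤ p.bsHorizDist (x i'))
    (i : ℕ) : p.nearestDist x ≤ p.bsHorizDist (x i) := by
  obtain ⟨j, hj⟩ := hx
  have hmem := Nat.sInf_mem (s := {i | ∀ i', p.bsMeanPower (p.bsHorizDist (x i')) ≤
    p.bsMeanPower (p.bsHorizDist (x i))}) ⟨j, fun i' =>
      (p.bsMeanPower_le_iff dist_nonneg dist_nonneg).2 (hj i')⟩
  exact (p.bsMeanPower_le_iff dist_nonneg dist_nonneg).1 (hmem i)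

end Params

namespace IsPoissonProcess

variable {Ω : Type*} [MeasurableSpace Ω] {lam : ℝ} {X : ℕ → Ω → Plane} {μ : Measure Ω}
  [IsProbabilityMeasure μ]

/-- Almost surely some point of the process is nearest to the user equipment. -/
theorem ae_exists_nearest (hX : IsPoissonProcess lam X μ) (p : Params) :
    ∀ᵐ ω ∂μ, ∃ i, ∀ i', p.bsHorizDist (X i ω) ≤ p.bsHorizDist (X i' ω) := by
  have hfin : ∀ᵐ ω ∂μ, ∀ R : ℕ, count X (Metric.closedBall p.ue R) ω ≠ ⊤ :=
    ae_all_iff.2 fun R => hX.ae_count_ne_top measurableSet_closedBall measure_closedBall_lt_top.ne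
  filter_upwards [hfin] with ω hω
  obtain ⟨R, hR⟩ := exists_nat_ge (p.bsHorizDist (X 0 ω))
  have hfinite := Set.encard_ne_top_iff.1 (hω R)
  obtain ⟨i, hi, hmin⟩ := Set.exists_min_image _ (fun i => p.bsHorizDist (X i ω)) hfinite ⟨0, hR⟩
  refine ⟨i, fun i' => ?_⟩
  by_cases h : X i' ω ∈ Metric.closedBall p.ue R
  · exact hmin i' h
  · rw [Metric.mem_closedBall, not_le] at h
    exact (Metric.mem_closedBall.1 hi).trans h.le

/-- The joint transform of the squared distance of the nearest point, through its tail, and of a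
radial multiplicative functional of the process. -/
theorem lintegral_nearest_tail {p : Params} (hX : IsPoissonProcess p.lam X μ) {G : ℝ → ℝ≥0∞}
    (hG : Measurable G) (hG1 : ∀ q, 0 ≤ q → G q ≤ 1) (hfin : ∫⁻ q in Set.Ioi 0, G q ≠ ⊤) {t : ℝ}
    (ht : 0 ≤ t) :
    ∫⁻ ω in {ω | t ≤ p.nearestDist (fun i => X i ω) ^ 2},
        iprod (fun i => 1 - G (p.bsHorizDist (X i ω) ^ 2)) ∂μ
      = ENNReal.ofReal (Real.exp
          (-(Real.pi * p.lam * (t + (∫⁻ q in Set.Ioi t, G q).toReal)))) := by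
  have hXm : Measurable fun ω i => X i ω := measurable_pi_lambda _ hX.measurable
  have hS : MeasurableSet {ω | t ≤ p.nearestDist (fun i => X i ω) ^ 2} :=
    measurableSet_le measurable_const ((p.measurable_nearestDist.comp hXm).pow_const 2)
  -- The nearest point is at squared distance at least `t` iff no point lies nearer; replacing `G` by
  -- `1` on the disk makes the product vanish unless this happens.
  set Gt : ℝ → ℝ≥0∞ := fun q => if q < t then 1 else G q with hGt
  have hGtm : Measurable Gt := Measurable.ite measurableSet_Iio measurable_const hG
  have hGt1 : ∀ q, 0 ≤ q → Gt q ≤ 1 := fun q hq => by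
    simp only [hGt]
    split_ifs
    · exact le_rfl
    · exact hG1 q hq
  have hfin' : ∫⁻ q in Set.Ioi t, G q ≠ ⊤ :=
    ne_top_of_le_ne_top hfin (lintegral_mono_set (Set.Ioi_subset_Ioi ht))
  have hint : ∫⁻ y : Plane, Gt (dist y p.ue ^ 2)
      = ENNReal.ofReal Real.pi * (ENNReal.ofReal t + ∫⁻ q in Set.Ioi t, G q) := by
    rw [lintegral_comp_sq_dist p.ue hGtm, ← Set.Ioc_union_Ioi_eq_Ioi ht,
      lintegral_union measurableSet_Ioi (Set.disjoint_left.2 fun x hx hx' => not_lt.2 hx.2 hx')]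
    congr 2
    · rw [setLIntegral_congr Ioo_ae_eq_Ioc.symm, setLIntegral_congr_fun (g := fun _ => 1)
        measurableSet_Ioo fun q hq => if_pos hq.2]
      simp
    · exact setLIntegral_congr_fun measurableSet_Ioi fun q hq => if_neg (not_lt.2 (le_of_lt hq))
  have hpgfl := hX.lintegral_iInf_prod p.lam_pos.le (g := fun y => Gt (dist y p.ue ^ 2))
    (hGtm.comp (by fun_prop)) (fun y => hGt1 _ (by positivity))
    (by rw [hint]; exact ENNReal.mul_ne_top ENNReal.ofReal_ne_top (by finiteness))
  rw [hint, ENNReal.toReal_mul, ENNReal.toReal_ofReal Real.pi_pos.le,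
    ENNReal.toReal_add (by finiteness) hfin', ENNReal.toReal_ofReal ht] at hpgfl
  have hexp : Real.pi * p.lam * (t + (∫⁻ q in Set.Ioi t, G q).toReal)
      = p.lam * (Real.pi * (t + (∫⁻ q in Set.Ioi t, G q).toReal)) := by ring
  rw [hexp, ← hpgfl, ← lintegral_indicator hS]
  refine lintegral_congr_ae ?_
  filter_upwards [hX.ae_exists_nearest p] with ω hω
  change _ = iprod fun i => 1 - Gt (p.bsHorizDist (X i ω) ^ 2)
  by_cases h : ω ∈ {ω | t ≤ p.nearestDist (fun i => X i ω) ^ 2}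
  · rw [Set.indicator_of_mem h]
    congr 1
    funext i
    have hle : t ≤ p.bsHorizDist (X i ω) ^ 2 := le_trans h
      (pow_le_pow_left₀ (p.nearestDist_nonneg _) (p.nearest_spec hω i) 2)
    simp only [hGt]
    rw [if_neg (not_lt.2 hle)]
  · rw [Set.indicator_of_notMem h, iprod_eq_zero (j := p.nearest fun i => X i ω)]
    have hlt : p.nearestDist (fun i => X i ω) ^ 2 < t := not_le.1 h
    have hlt' : p.bsHorizDist (X (p.nearest fun i => X i ω) ω) ^ 2 < t := hlt
    simp only [hGt]
    rw [if_pos hlt', tsub_self]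

end IsPoissonProcess

/-! ### The product over the points other than the nearest one -/

/-- One minus the Laplace transform, at `s = A / Pg`, of the power received from a base station at
squared horizontal distance `q`; here `η` is the path-loss exponent and `h` the height. -/
noncomputable def bsLoss (A η h q : ℝ) : ℝ := A / ((q + h ^ 2) ^ (η / 2) + A)

section bsLoss

variable {A η h q : ℝ}

theorem bsLoss_nonneg (hA : 0 < A) (hq : 0 ≤ q) : 0 ≤ bsLoss A η h q := by
  unfold bsLoss
  positivity

theorem bsLoss_lt_one (hA : 0 < A) (hh : 0 < h) (hq : 0 ≤ q) : bsLoss A η h q < 1 := by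
  have : 0 < (q + h ^ 2) ^ (η / 2) := by positivity
  rw [bsLoss, div_lt_one (by positivity)]
  linarith

@[fun_prop]
theorem measurable_bsLoss : Measurable (bsLoss A η h) := by
  unfold bsLoss
  fun_prop

theorem tailExponent_shift_hasDerivAt (hA : 0 < A) (hη : 2 < η) (hh : 0 < h) (hq : 0 ≤ q) :
    HasDerivAt (fun q => tailExponent A η (q + h ^ 2)) (-bsLoss A η h q) q := by
  have := (tailExponent_hasDerivAt hA hη (U := q + h ^ 2) (by positivity)).comp_add_const q (h ^ 2)
  exact this

theorem tailExponent_shift_tendsto (hA : 0 < A) (hη : 2 < η) :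
    Tendsto (fun q => tailExponent A η (q + h ^ 2)) atTop (𝓝 0) :=
  (tailExponent_tendsto hA hη).comp (tendsto_atTop_add_const_right _ _ tendsto_id)

theorem continuous_tailExponent_comp {α : Type*} [TopologicalSpace α] {f : α → ℝ}
    (hA : 0 < A) (hη : 2 < η) (hf : Continuous f) (hf0 : ∀ x, 0 < f x) :
    Continuous fun x => tailExponent A η (f x) :=
  continuous_iff_continuousAt.2 fun x =>
    (tailExponent_hasDerivAt hA hη (hf0 x)).continuousAt.comp_of_eq hf.continuousAt rfl

theorem lintegral_bsLoss (hA : 0 < A) (hη : 2 < η) (hh : 0 < h) {t : ℝ} (ht : 0 ≤ t) :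
    ∫⁻ q in Set.Ioi t, ENNReal.ofReal (bsLoss A η h q)
      = ENNReal.ofReal (tailExponent A η (t + h ^ 2)) :=
  lintegral_Ioi_of_hasDerivAt (K := fun q => tailExponent A η (q + h ^ 2))
    (fun _ hx => tailExponent_shift_hasDerivAt hA hη hh (ht.trans hx))
    (fun _ hx => bsLoss_nonneg hA (ht.trans hx)) (tailExponent_shift_tendsto hA hη)

theorem tailExponent_nonneg (hA : 0 < A) (hη : 2 < η) (hh : 0 < h) {t : ℝ} (ht : 0 ≤ t) :
    0 ≤ tailExponent A η (t + h ^ 2) := by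
  have hneg : ∀ x ∈ Set.Ioi t, -bsLoss A η h x ≤ 0 := fun x hx =>
    neg_nonpos.2 (bsLoss_nonneg hA (ht.trans (le_of_lt hx)))
  have hval := integral_Ioi_of_hasDerivAt_of_nonpos'
    (fun x hx => tailExponent_shift_hasDerivAt hA hη hh (ht.trans hx)) hneg
    (tailExponent_shift_tendsto (h := h) hA hη)
  have : ∫ x in Set.Ioi t, -bsLoss A η h x ≤ 0 := setIntegral_nonpos measurableSet_Ioi hneg
  linarith

end bsLoss

namespace IsPoissonProcess

variable {Ω : Type*} [MeasurableSpace Ω] {X : ℕ → Ω → Plane} {μ : Measure Ω}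
  [IsProbabilityMeasure μ] {p : Params}

/-- The law of the squared distance of the nearest point, weighted by a radial multiplicative
functional, has the tail function given by the probability generating functional. -/
theorem map_nearest_tail (hX : IsPoissonProcess p.lam X μ) {G : ℝ → ℝ≥0∞}
    (hG : Measurable G) (hG1 : ∀ q, 0 ≤ q → G q ≤ 1) (hfin : ∫⁻ q in Set.Ioi 0, G q ≠ ⊤) (t : ℝ) :
    (μ.withDensity fun ω => iprod fun i => 1 - G (p.bsHorizDist (X i ω) ^ 2)).map
        (fun ω => p.nearestDist (fun i => X i ω) ^ 2) (Set.Ici t)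
      = ENNReal.ofReal (Real.exp (-(Real.pi * p.lam *
          (max t 0 + (∫⁻ q in Set.Ioi (max t 0), G q).toReal)))) := by
  have hXm : Measurable fun ω i => X i ω := measurable_pi_lambda _ hX.measurable
  have hT : Measurable fun ω => p.nearestDist (fun i => X i ω) ^ 2 :=
    (p.measurable_nearestDist.comp hXm).pow_const 2
  rw [Measure.map_apply hT measurableSet_Ici, withDensity_apply _ (hT measurableSet_Ici),
    ← hX.lintegral_nearest_tail hG hG1 hfin (le_max_right t 0)]
  congr 2
  ext ω
  have : 0 ≤ p.nearestDist (fun i => X i ω) ^ 2 := by positivity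
  simp [this]

/-- Given the distance of the nearest point, the product over the other points is distributed as
the product over a Poisson process outside the corresponding disk.

The product over all points is the product over the points other than the nearest one times a
function of the distance of the nearest point, so it suffices to know the law of this distance
weighted by the product over all points; that is given by the probability generating functional. -/
theorem lintegral_nearest_mul_iprod (hX : IsPoissonProcess p.lam X μ) {A : ℝ} (hA : 0 < A)
    {k : ℝ → ℝ≥0∞} (hk : Measurable k) :
    ∫⁻ ω, k (p.nearestDist fun i => X i ω) *
        iprod (fun i => if i = p.nearest (fun i => X i ω) then 1 else
          ENNReal.ofReal (1 - bsLoss A p.etag p.hg (p.bsHorizDist (X i ω) ^ 2))) ∂μ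
      = ∫⁻ ω, k (p.nearestDist fun i => X i ω) * ENNReal.ofReal (Real.exp (-(Real.pi * p.lam *
          tailExponent A p.etag (p.nearestDist (fun i => X i ω) ^ 2 + p.hg ^ 2)))) ∂μ := by
  have hη := p.etag_gt
  have hh := p.hg_pos
  have hc : 0 < Real.pi * p.lam := mul_pos Real.pi_pos p.lam_pos
  set c := Real.pi * p.lam
  set D : Ω → ℝ := fun ω => p.nearestDist fun i => X i ω
  set L : ℝ → ℝ := bsLoss A p.etag p.hg with hL
  set H : ℝ → ℝ := fun q => tailExponent A p.etag (q + p.hg ^ 2) with hH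
  have hXm : Measurable fun ω i => X i ω := measurable_pi_lambda _ hX.measurable
  have hDm : Measurable D := p.measurable_nearestDist.comp hXm
  have hT : Measurable fun ω => D ω ^ 2 := hDm.pow_const 2
  -- The absolute values extend the functions to negative `q`, where the laws below have no mass.
  have hHm : Measurable fun q => H |q| :=
    (continuous_tailExponent_comp hA hη (by fun_prop) fun q => by positivity).measurable
  -- The weighted law of the squared distance of the nearest point.
  set W : Ω → ℝ≥0∞ := fun ω => iprod fun i =>
    1 - ENNReal.ofReal (L (p.bsHorizDist (X i ω) ^ 2)) with hW
  have hWm : Measurable W := measurable_iprod fun i => by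
    have := hX.measurable i
    fun_prop
  have hW_fin : ∫⁻ ω, W ω ∂μ ≠ ⊤ := by
    refine ne_top_of_le_ne_top ENNReal.one_ne_top ?_
    calc ∫⁻ ω, W ω ∂μ ≤ ∫⁻ _, 1 ∂μ := lintegral_mono fun ω => iprod_le_one _
      _ = 1 := by simp
  have : IsFiniteMeasure (μ.withDensity W) := isFiniteMeasure_withDensity hW_fin
  have hm1 : (μ.withDensity W).map (fun ω => D ω ^ 2)
      = (volume.restrict (Set.Ioi 0)).withDensity fun q =>
        ENNReal.ofReal (c * (1 - L |q|) * Real.exp (-(c * (|q| + H |q|)))) := by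
    refine eq_withDensity_of_tail (K := fun q => Real.exp (-(c * (q + H q)))) ?_ ?_ ?_ ?_
    · intro t
      have ht : 0 ≤ max t 0 := le_max_right _ _
      have h := hX.map_nearest_tail (G := fun q => ENNReal.ofReal (L q))
        (by fun_prop) (fun q hq => ENNReal.ofReal_le_one.2 (bsLoss_lt_one hA hh hq).le)
        (by rw [lintegral_bsLoss hA hη hh le_rfl]; exact ENNReal.ofReal_ne_top) t
      rw [lintegral_bsLoss hA hη hh ht, ENNReal.toReal_ofReal (tailExponent_nonneg hA hη hh ht)] at h
      exact h
    · intro x hx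
      have h := (((hasDerivAt_id x).add
        (tailExponent_shift_hasDerivAt hA hη hh hx)).const_mul c).neg.exp
      refine HasDerivAt.congr_deriv (f := fun q => Real.exp (-(c * (q + H q)))) h ?_
      rw [abs_of_nonneg hx]
      simp only [hL, hH, Pi.neg_apply, Pi.add_apply, id]
      ring
    · intro x hx
      have := bsLoss_lt_one (η := p.etag) hA hh (abs_nonneg x)
      positivity
    · refine Real.tendsto_exp_neg_atTop_nhds_zero.comp (Tendsto.const_mul_atTop hc ?_)
      exact tendsto_atTop_add_right_of_le' atTop (-1) tendsto_id
        ((tailExponent_shift_tendsto hA hη).eventually (Ici_mem_nhds (by norm_num)))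
  -- The law itself, which is the case of the constant functional `1`.
  have hm0 : μ.map (fun ω => D ω ^ 2)
      = (volume.restrict (Set.Ioi 0)).withDensity fun q =>
        ENNReal.ofReal (c * Real.exp (-(c * q))) := by
    refine eq_withDensity_of_tail (K := fun q => Real.exp (-(c * q))) ?_ ?_ ?_ ?_
    · intro t
      have h := hX.map_nearest_tail (G := fun _ => 0) measurable_const (by simp) (by simp) t
      simpa [iprod] using h
    · intro x hx
      have h := ((hasDerivAt_id x).const_mul c).neg.exp
      refine HasDerivAt.congr_deriv (f := fun q => Real.exp (-(c * q))) h ?_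
      simp only [Pi.neg_apply, id]
      ring
    · intro x hx
      positivity
    · exact Real.tendsto_exp_neg_atTop_nhds_zero.comp (Tendsto.const_mul_atTop hc tendsto_id)
  -- The factor of the nearest point is a function of its distance alone.
  have hfac : ∀ ω, W ω = ENNReal.ofReal (1 - L (D ω ^ 2)) *
      iprod (fun i => if i = p.nearest (fun i => X i ω) then 1 else
        ENNReal.ofReal (1 - L (p.bsHorizDist (X i ω) ^ 2))) := by
    intro ω
    have hsub : ∀ q, 0 ≤ q → 1 - ENNReal.ofReal (L q) = ENNReal.ofReal (1 - L q) := fun q hq => by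
      rw [ENNReal.ofReal_sub _ (bsLoss_nonneg hA hq), ENNReal.ofReal_one]
    simp only [hW]
    rw [iprod_eq_mul (fun i => tsub_le_self) (p.nearest fun i => X i ω)]
    simp_rw [fun i => hsub _ (sq_nonneg (p.bsHorizDist (X i ω)))]
    rfl
  set φ : ℝ → ℝ≥0∞ := fun q => ENNReal.ofReal (1 - L |q|) with hφ
  have hφm : Measurable φ := by fun_prop
  have hφ0 : ∀ q, φ q ≠ 0 := fun q => by
    have := bsLoss_lt_one (η := p.etag) hA hh (abs_nonneg q)
    exact (ENNReal.ofReal_pos.2 (by linarith)).ne'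
  set k' : ℝ → ℝ≥0∞ := fun q => k √q with hk'
  have hk'm : Measurable k' := hk.comp (by fun_prop)
  have hkD : ∀ ω, k (D ω) = k' (D ω ^ 2) := fun ω => by
    simp only [hk']
    rw [Real.sqrt_sq (p.nearestDist_nonneg _)]
  set F : ℝ → ℝ≥0∞ := fun q => ENNReal.ofReal (Real.exp (-(c * H |q|))) with hF
  have hFm : Measurable F := ((hHm.const_mul c).neg.exp).ennreal_ofReal
  have hkφ : Measurable fun q => k' q * (φ q)⁻¹ := hk'm.mul hφm.inv
  have hkF : Measurable fun q => k' q * F q := hk'm.mul hFm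
  calc ∫⁻ ω, k (D ω) * iprod (fun i => if i = p.nearest (fun i => X i ω) then 1 else
          ENNReal.ofReal (1 - L (p.bsHorizDist (X i ω) ^ 2))) ∂μ
      = ∫⁻ ω, W ω * (k' (D ω ^ 2) * (φ (D ω ^ 2))⁻¹) ∂μ := by
        refine lintegral_congr fun ω => ?_
        have h1 : ENNReal.ofReal (1 - L (D ω ^ 2)) = φ (D ω ^ 2) := by
          simp only [hφ]
          rw [abs_of_nonneg (sq_nonneg _)]
        rw [hfac, hkD, h1]
        generalize iprod _ = Z
        calc k' (D ω ^ 2) * Z = k' (D ω ^ 2) * Z * (φ (D ω ^ 2) * (φ (D ω ^ 2))⁻¹) := by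
              rw [ENNReal.mul_inv_cancel (hφ0 _) ENNReal.ofReal_ne_top, mul_one]
          _ = _ := by ring
    _ = ∫⁻ q, k' q * (φ q)⁻¹ ∂((μ.withDensity W).map fun ω => D ω ^ 2) := by
        rw [lintegral_map hkφ hT]
        exact (lintegral_withDensity_eq_lintegral_mul _ hWm (hkφ.comp hT)).symm
    _ = ∫⁻ q in Set.Ioi 0, ENNReal.ofReal (c * Real.exp (-(c * q))) * (k' q * F q) := by
        have hdens : Measurable fun q =>
            ENNReal.ofReal (c * (1 - L |q|) * Real.exp (-(c * (|q| + H |q|)))) :=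
          (Measurable.mul (by fun_prop)
            ((measurable_id.abs.add hHm).const_mul c).neg.exp).ennreal_ofReal
        rw [hm1, lintegral_withDensity_eq_lintegral_mul _ hdens hkφ]
        refine setLIntegral_congr_fun measurableSet_Ioi fun q hq => ?_
        have hq' : |q| = q := abs_of_pos hq
        have h1 : 0 ≤ 1 - L |q| := by
          have := bsLoss_lt_one (η := p.etag) hA hh (abs_nonneg q)
          simp only [hL]
          linarith
        have h2 : ENNReal.ofReal (c * (1 - L |q|) * Real.exp (-(c * (|q| + H |q|))))
            = φ q * (ENNReal.ofReal (c * Real.exp (-(c * q))) * F q) := by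
          simp only [hφ, hF]
          rw [← ENNReal.ofReal_mul (by positivity), ← ENNReal.ofReal_mul h1, hq', mul_add, neg_add,
            Real.exp_add]
          ring_nf
        simp only [Pi.mul_apply]
        rw [h2]
        calc φ q * (ENNReal.ofReal (c * Real.exp (-(c * q))) * F q) * (k' q * (φ q)⁻¹)
            = (φ q * (φ q)⁻¹) * (ENNReal.ofReal (c * Real.exp (-(c * q))) * (k' q * F q)) := by ring
          _ = _ := by rw [ENNReal.mul_inv_cancel (hφ0 _) ENNReal.ofReal_ne_top, one_mul]
    _ = ∫⁻ q, k' q * F q ∂(μ.map fun ω => D ω ^ 2) := by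
        rw [hm0, lintegral_withDensity_eq_lintegral_mul _ (by fun_prop) hkF]
        rfl
    _ = ∫⁻ ω, k (D ω) * ENNReal.ofReal (Real.exp (-(c * H (D ω ^ 2)))) ∂μ := by
        rw [lintegral_map hkF hT]
        refine lintegral_congr fun ω => ?_
        simp only [hF]
        rw [hkD, abs_of_nonneg (sq_nonneg (D ω))]

end IsPoissonProcess

/-! ### Fading gains and independence -/

/-- The Laplace transform of a gamma law; `θ` may be negative as long as the transform is finite. -/
theorem lintegral_exp_gammaMeasure {a r θ : ℝ} (ha : 0 < a) (hr : 0 < r) (hθ : 0 < r + θ) :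
    ∫⁻ t, ENNReal.ofReal (Real.exp (-(θ * t))) ∂gammaMeasure a r
      = ENNReal.ofReal ((1 + θ / r) ^ (-a)) := by
  have hm : Measurable (gammaPDF a r) := (measurable_gammaPDFReal a r).ennreal_ofReal
  rw [gammaMeasure, lintegral_withDensity_eq_lintegral_mul _ hm (by fun_prop)]
  have hpt : ∀ t, (gammaPDF a r * fun t => ENNReal.ofReal (Real.exp (-(θ * t)))) t
      = ENNReal.ofReal ((1 + θ / r) ^ (-a)) * gammaPDF a (r + θ) t := by
    intro t
    simp only [Pi.mul_apply, gammaPDF]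
    have h1 : 0 < 1 + θ / r := by
      rw [show 1 + θ / r = (r + θ) / r by field_simp]
      positivity
    rw [← ENNReal.ofReal_mul (gammaPDFReal_nonneg ha hr t), ← ENNReal.ofReal_mul (by positivity)]
    congr 1
    simp only [gammaPDFReal]
    split_ifs with ht
    · have h2 : Real.exp (-((r + θ) * t)) = Real.exp (-(r * t)) * Real.exp (-(θ * t)) := by
        rw [← Real.exp_add]
        ring_nf
      have h3 : (1 + θ / r) ^ (-a) * (r + θ) ^ a = r ^ a := by
        have h4 : 1 + θ / r = (r + θ) / r := by field_simp
        rw [h4, Real.rpow_neg (by positivity), Real.div_rpow hθ.le hr.le, inv_div]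
        field_simp
      rw [h2, ← h3]
      ring
    · simp
  simp_rw [hpt]
  rw [lintegral_const_mul' _ _ ENNReal.ofReal_ne_top, lintegral_gammaPDF_eq_one ha hθ, mul_one]

theorem ae_nonneg_gammaMeasure (a r : ℝ) : ∀ᵐ t ∂gammaMeasure a r, 0 ≤ t := by
  rw [ae_iff]
  have : {t : ℝ | ¬ 0 ≤ t} = Set.Iio 0 := by
    ext t
    simp
  rw [this, gammaMeasure, withDensity_apply _ measurableSet_Iio]
  exact lintegral_gammaPDF_of_nonpos le_rfl

/-- The exponential law has finite mean, as `t ≤ 2 exp (t / 2)`. -/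
theorem lintegral_ofReal_expMeasure_ne_top :
    ∫⁻ t, ENNReal.ofReal t ∂expMeasure 1 ≠ ⊤ := by
  have h := lintegral_exp_gammaMeasure (a := 1) (r := 1) (θ := -(1 / 2)) one_pos one_pos
    (by norm_num)
  have hle : ∫⁻ t, ENNReal.ofReal t ∂gammaMeasure 1 1
      ≤ ∫⁻ t, 2 * ENNReal.ofReal (Real.exp (-(-(1 / 2) * t))) ∂gammaMeasure 1 1 := by
    refine lintegral_mono fun t => ?_
    rw [← ENNReal.ofReal_ofNat, ← ENNReal.ofReal_mul (by norm_num)]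
    refine ENNReal.ofReal_le_ofReal ?_
    have := Real.add_one_le_exp (-(-(1 / 2) * t))
    linarith
  refine ne_top_of_le_ne_top ?_ hle
  rw [lintegral_const_mul' _ _ (by norm_num), h]
  exact ENNReal.mul_ne_top (by norm_num) ENNReal.ofReal_ne_top

/-- Two independent sources of randomness can be integrated out one after the other. -/
theorem lintegral_of_indepFun {Ω α β : Type*} [MeasurableSpace Ω] [MeasurableSpace α]
    [MeasurableSpace β] {μ : Measure Ω} [IsProbabilityMeasure μ] {V : Ω → α} {W : Ω → β}
    (hV : Measurable V) (hW : Measurable W) (h : IndepFun V W μ) {f : α × β → ℝ≥0∞}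
    (hf : Measurable f) :
    ∫⁻ ω, f (V ω, W ω) ∂μ = ∫⁻ ω, ∫⁻ ω', f (V ω, W ω') ∂μ ∂μ := by
  rw [← lintegral_map hf (hV.prodMk hW), h.map_prod_eq_prod_map_map hV.aemeasurable hW.aemeasurable,
    lintegral_prod _ hf.aemeasurable, lintegral_map hf.lintegral_prod_right' hV]
  refine lintegral_congr fun ω => ?_
  exact lintegral_map (hf.comp (measurable_prodMk_left (x := V ω))) hW

theorem lintegral_iprod_of_iIndepFun {Ω : Type*} [MeasurableSpace Ω] {μ : Measure Ω}
    [IsProbabilityMeasure μ] {u : ℕ → Ω → ℝ≥0∞} (hu : ∀ i, Measurable (u i))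
    (hu1 : ∀ i ω, u i ω ≤ 1) (hind : iIndepFun u μ) :
    ∫⁻ ω, iprod (fun i => u i ω) ∂μ = iprod fun i => ∫⁻ ω, u i ω ∂μ := by
  simp only [iprod]
  rw [lintegral_iInf]
  · refine iInf_congr fun n => ?_
    exact lintegral_prod_eq_prod_lintegral_of_indepFun _ _ hind hu
  · exact fun n => Finset.measurable_prod _ fun i _ => hu i
  · exact fun n m h ω => antitone_prod_range (fun i => hu1 i ω) h
  · simp

namespace Network

variable {p : Params} {Ω : Type*} [MeasurableSpace Ω] {μ : Measure Ω} (net : Network p μ)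

/-- The σ-algebra generated by one of the independent sources of randomness. -/
@[reducible]
noncomputable def sourceAlgebra (k : Source p.Nu) : MeasurableSpace Ω :=
  match k with
  | .bs => MeasurableSpace.comap (fun ω i => net.bs i ω) inferInstance
  | .bsFading i => MeasurableSpace.comap (net.bsFading i) inferInstance
  | .uav j => MeasurableSpace.comap (fun ω => (net.uav j ω, net.link j ω)) inferInstance
  | .uavFading j => MeasurableSpace.comap (fun ω ζ => net.uavFading j ζ ω) inferInstance

/-- The positions of the base stations. -/
def bsConfig (ω : Ω) : ℕ → Plane := fun i => net.bs i ω

/-- The fading gains of the base stations. -/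
def bsGains (ω : Ω) : ℕ → ℝ := fun i => net.bsFading i ω

/-- The positions of the UAVs and the states of their links. -/
def uavConfig (ω : Ω) : Fin p.Nu → Plane × Link := fun j => (net.uav j ω, net.link j ω)

/-- The fading gains of the UAVs. -/
def uavGains (ω : Ω) : Fin p.Nu → Link → ℝ := fun j ζ => net.uavFading j ζ ω

@[fun_prop]
theorem measurable_bsConfig : Measurable net.bsConfig :=
  measurable_pi_lambda _ net.bs_poisson.measurable

@[fun_prop]
theorem measurable_bsGains : Measurable net.bsGains :=
  measurable_pi_lambda _ net.bsFading_measurable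

@[fun_prop]
theorem measurable_uavConfig : Measurable net.uavConfig :=
  measurable_pi_lambda _ fun j => (net.uav_measurable j).prodMk (net.link_measurable j)

@[fun_prop]
theorem measurable_uavGains : Measurable net.uavGains :=
  measurable_pi_lambda _ fun j => measurable_pi_lambda _ fun ζ => net.uavFading_measurable j ζ

theorem sourceAlgebra_le (k : Source p.Nu) : net.sourceAlgebra k ≤ ‹MeasurableSpace Ω› := by
  cases k with
  | bs => exact net.measurable_bsConfig.comap_le
  | bsFading i => exact (net.bsFading_measurable i).comap_le
  | uav j => exact ((net.uav_measurable j).prodMk (net.link_measurable j)).comap_le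
  | uavFading j =>
    exact (measurable_pi_lambda _ fun ζ => net.uavFading_measurable j ζ : Measurable
      fun ω ζ => net.uavFading j ζ ω).comap_le

theorem iIndep_sourceAlgebra : iIndep net.sourceAlgebra μ := net.indep

/-- Functions of disjoint sets of sources are independent. -/
theorem indepFun_of_sources {α β : Type*} [MeasurableSpace α] [MeasurableSpace β] {V : Ω → α}
    {W : Ω → β} {S T : Set (Source p.Nu)} (hST : Disjoint S T)
    (hV : Measurable[⨆ k ∈ S, net.sourceAlgebra k] V)
    (hW : Measurable[⨆ k ∈ T, net.sourceAlgebra k] W) : IndepFun V W μ :=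
  indep_of_indep_of_le_right (indep_of_indep_of_le_left
    (indep_iSup_of_disjoint net.sourceAlgebra_le net.iIndep_sourceAlgebra hST) hV.comap_le)
    hW.comap_le

variable {S : Set (Source p.Nu)}

theorem measurable_source_bsConfig (h : Source.bs ∈ S) :
    Measurable[⨆ k ∈ S, net.sourceAlgebra k] net.bsConfig :=
  Measurable.of_comap_le (le_iSup₂_of_le (f := fun k _ => net.sourceAlgebra k) _ h le_rfl)

theorem measurable_source_bsGains (h : ∀ i, Source.bsFading i ∈ S) :
    Measurable[⨆ k ∈ S, net.sourceAlgebra k] net.bsGains :=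
  @measurable_pi_lambda _ _ _ (⨆ k ∈ S, net.sourceAlgebra k) _ net.bsGains fun i => Measurable.of_comap_le
    (le_iSup₂_of_le (f := fun k _ => net.sourceAlgebra k) _ (h i) le_rfl)

theorem measurable_source_uavConfig (h : ∀ i, Source.uav i ∈ S) :
    Measurable[⨆ k ∈ S, net.sourceAlgebra k] net.uavConfig :=
  @measurable_pi_lambda _ _ _ (⨆ k ∈ S, net.sourceAlgebra k) _ net.uavConfig fun i => Measurable.of_comap_le
    (le_iSup₂_of_le (f := fun k _ => net.sourceAlgebra k) _ (h i) le_rfl)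

theorem measurable_source_uavGains (h : ∀ i, Source.uavFading i ∈ S) :
    Measurable[⨆ k ∈ S, net.sourceAlgebra k] net.uavGains :=
  @measurable_pi_lambda _ _ _ (⨆ k ∈ S, net.sourceAlgebra k) _ net.uavGains fun i => Measurable.of_comap_le
    (le_iSup₂_of_le (f := fun k _ => net.sourceAlgebra k) _ (h i) le_rfl)

theorem indepFun_bsConfig_bsGains : IndepFun net.bsConfig net.bsGains μ := by
  refine net.indepFun_of_sources (S := {.bs}) (T := Set.range .bsFading) ?_
    (net.measurable_source_bsConfig rfl) (net.measurable_source_bsGains fun i => ⟨i, rfl⟩)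
  rw [Set.disjoint_left]
  rintro _ rfl ⟨i, hi⟩
  cases hi

theorem indepFun_uavConfig_uavGains : IndepFun net.uavConfig net.uavGains μ := by
  refine net.indepFun_of_sources (S := Set.range .uav) (T := Set.range .uavFading) ?_
    (net.measurable_source_uavConfig fun i => ⟨i, rfl⟩)
    (net.measurable_source_uavGains fun i => ⟨i, rfl⟩)
  rw [Set.disjoint_left]
  rintro _ ⟨i, rfl⟩ ⟨j, hj⟩
  cases hj

theorem indepFun_bs_uav :
    IndepFun (fun ω => (net.bsConfig ω, net.bsGains ω))
      (fun ω => (net.uavConfig ω, net.uavGains ω)) μ := by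
  refine net.indepFun_of_sources (S := {.bs} ∪ Set.range .bsFading)
    (T := Set.range .uav ∪ Set.range .uavFading) ?_
    ((net.measurable_source_bsConfig (Or.inl rfl)).prodMk
      (net.measurable_source_bsGains fun i => Or.inr ⟨i, rfl⟩))
    ((net.measurable_source_uavConfig fun i => Or.inl ⟨i, rfl⟩).prodMk
      (net.measurable_source_uavGains fun i => Or.inr ⟨i, rfl⟩))
  rw [Set.disjoint_left]
  rintro _ (rfl | ⟨i, rfl⟩) (⟨j, hj⟩ | ⟨j, hj⟩) <;> cases hj

theorem iIndepFun_bsFading : iIndepFun net.bsFading μ :=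
  net.iIndep_sourceAlgebra.precomp (g := Source.bsFading) fun i j h => by cases h; rfl

theorem iIndepFun_uav : iIndepFun (fun j ω => net.uavConfig ω j) μ :=
  net.iIndep_sourceAlgebra.precomp (g := Source.uav) fun i j h => by cases h; rfl

theorem iIndepFun_uavFading : iIndepFun (fun j ω => net.uavGains ω j) μ :=
  net.iIndep_sourceAlgebra.precomp (g := Source.uavFading) fun i j h => by cases h; rfl

end Network

/-! ### Interference of the base stations -/

namespace Network

variable {p : Params} {Ω : Type*} [MeasurableSpace Ω] {μ : Measure Ω} (net : Network p μ)

theorem bestDist_eq (ω : Ω) : net.bestDist ω = p.nearestDist (net.bsConfig ω) := rfl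

theorem bestDist_nonneg (ω : Ω) : 0 ≤ net.bestDist ω := dist_nonneg

@[fun_prop]
theorem measurable_bestDist : Measurable net.bestDist := by
  rw [funext net.bestDist_eq]
  fun_prop

theorem bsAvg_pos (i : ℕ) (ω : Ω) : 0 < net.bsAvg i ω := by
  have := p.Pg_pos
  have := p.hg_pos
  unfold bsAvg Params.bsMeanPower
  positivity

theorem measurable_bsAvg (i : ℕ) : Measurable (net.bsAvg i) :=
  p.measurable_bsMeanPower.comp (p.measurable_bsHorizDist.comp (net.bs_poisson.measurable i))

theorem ae_bsFading_nonneg : ∀ᵐ ω ∂μ, ∀ i, 0 ≤ net.bsFading i ω := by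
  refine ae_all_iff.2 fun i => ?_
  have := ae_nonneg_gammaMeasure 1 1
  rw [show gammaMeasure 1 1 = expMeasure 1 from rfl, ← net.bsFading_law i] at this
  exact ae_of_ae_map (net.bsFading_measurable i).aemeasurable this

/-- The mean power is integrable over the plane: it is bounded near the user equipment because of the
height of the stations, and decays fast enough because the path-loss exponent exceeds `2`. -/
theorem lintegral_bsMeanPower_ne_top (p : Params) :
    ∫⁻ y : Plane, ENNReal.ofReal (p.bsMeanPower (p.bsHorizDist y)) ≠ ⊤ := by
  have hη := p.etag_gt
  have hh := p.hg_pos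
  have hP := p.Pg_pos
  have hval := lintegral_Ioi_of_hasDerivAt (a := 0)
    (K := fun q => p.Pg / (p.etag / 2 - 1) * (q + p.hg ^ 2) ^ (-(p.etag / 2 - 1)))
    (k := fun q => p.Pg * (q + p.hg ^ 2) ^ (-p.etag / 2)) (fun q hq => ?_) (fun q hq => ?_) ?_
  · have hm : Measurable fun q => ENNReal.ofReal (p.Pg * (q + p.hg ^ 2) ^ (-p.etag / 2)) := by
      fun_prop
    have hcomp := lintegral_comp_sq_dist p.ue hm
    rw [hval] at hcomp
    have : (fun y : Plane => ENNReal.ofReal (p.bsMeanPower (p.bsHorizDist y)))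
        = fun y => ENNReal.ofReal (p.Pg * (dist y p.ue ^ 2 + p.hg ^ 2) ^ (-p.etag / 2)) := rfl
    rw [this, hcomp]
    exact ENNReal.mul_ne_top ENNReal.ofReal_ne_top ENNReal.ofReal_ne_top
  · have hpos : q + p.hg ^ 2 ≠ 0 := by positivity
    have h := ((Real.hasDerivAt_rpow_const (p := -(p.etag / 2 - 1)) (Or.inl hpos)).comp_add_const q
      (p.hg ^ 2)).const_mul (p.Pg / (p.etag / 2 - 1))
    refine h.congr_deriv ?_
    have h1 : -(p.etag / 2 - 1) - 1 = -p.etag / 2 := by ring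
    rw [h1]
    have h2 : p.etag / 2 - 1 ≠ 0 := by linarith
    have h3 : p.Pg / (p.etag / 2 - 1) * (p.etag / 2 - 1) = p.Pg := div_mul_cancel₀ _ h2
    linear_combination -(q + p.hg ^ 2) ^ (-p.etag / 2) * h3
  · positivity
  · have h1 : Tendsto (fun q : ℝ => q + p.hg ^ 2) atTop atTop :=
      tendsto_atTop_add_const_right _ _ tendsto_id
    have h2 := ((tendsto_rpow_neg_atTop (y := p.etag / 2 - 1) (by linarith)).comp h1).const_mul
      (p.Pg / (p.etag / 2 - 1))
    simpa using h2

/-- By Campbell's formula, the total power received from all base stations has finite mean. -/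
theorem summable_bsAvg_mul_bsFading [IsProbabilityMeasure μ] :
    ∀ᵐ ω ∂μ, Summable fun i => net.bsAvg i ω * net.bsFading i ω := by
  have hmA : ∀ i, Measurable fun ω => ENNReal.ofReal (net.bsAvg i ω) :=
    fun i => (net.measurable_bsAvg i).ennreal_ofReal
  have hmF : ∀ i, Measurable fun ω => ENNReal.ofReal (net.bsFading i ω) :=
    fun i => (net.bsFading_measurable i).ennreal_ofReal
  set C := ∫⁻ t, ENNReal.ofReal t ∂expMeasure 1 with hC
  have hfad : ∀ i, ∫⁻ ω, ENNReal.ofReal (net.bsFading i ω) ∂μ = C := by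
    intro i
    rw [hC, ← net.bsFading_law i, lintegral_map (by fun_prop) (net.bsFading_measurable i)]
  have hterm : ∀ i, ∫⁻ ω, ENNReal.ofReal (net.bsAvg i ω) * ENNReal.ofReal (net.bsFading i ω) ∂μ
      = (∫⁻ ω, ENNReal.ofReal (net.bsAvg i ω) ∂μ) * C := by
    intro i
    rw [← hfad i]
    refine lintegral_mul_eq_lintegral_mul_lintegral_of_indepFun (hmA i) (hmF i) ?_
    exact net.indepFun_bsConfig_bsGains.comp
      (φ := fun x : ℕ → Plane => ENNReal.ofReal (p.bsMeanPower (p.bsHorizDist (x i))))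
      (ψ := fun t : ℕ → ℝ => ENNReal.ofReal (t i)) (by fun_prop) (by fun_prop)
  have hfin : ∫⁻ ω, ∑' i, ENNReal.ofReal (net.bsAvg i ω) * ENNReal.ofReal (net.bsFading i ω) ∂μ
      ≠ ⊤ := by
    rw [lintegral_tsum (f := fun i ω =>
      ENNReal.ofReal (net.bsAvg i ω) * ENNReal.ofReal (net.bsFading i ω))
      fun i => ((hmA i).mul (hmF i)).aemeasurable]
    simp_rw [hterm]
    rw [ENNReal.tsum_mul_right, ← lintegral_tsum fun i => (hmA i).aemeasurable]
    refine ENNReal.mul_ne_top ?_ lintegral_ofReal_expMeasure_ne_top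
    have := net.bs_poisson.lintegral_tsum_points
      (f := fun y => ENNReal.ofReal (p.bsMeanPower (p.bsHorizDist y))) (by fun_prop)
    refine ne_of_eq_of_ne this ?_
    exact ENNReal.mul_ne_top ENNReal.ofReal_ne_top (lintegral_bsMeanPower_ne_top p)
  have hlt := ae_lt_top (Measurable.tsum fun i => (hmA i).mul (hmF i)) hfin
  filter_upwards [hlt, net.ae_bsFading_nonneg] with ω hω hf
  refine (ENNReal.summable_toReal hω.ne).congr fun i => ?_
  simp only [Pi.mul_apply]
  rw [ENNReal.toReal_mul, ENNReal.toReal_ofReal (net.bsAvg_pos i ω).le,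
    ENNReal.toReal_ofReal (hf i)]

theorem bsInterfTerm_nonneg {ω : Ω} (hf : ∀ i, 0 ≤ net.bsFading i ω) (i : ℕ) :
    0 ≤ net.bsInterfTerm i ω := by
  unfold bsInterfTerm
  split_ifs
  · exact le_rfl
  · exact mul_nonneg (net.bsAvg_pos i ω).le (hf i)

theorem summable_bsInterfTerm [IsProbabilityMeasure μ] :
    ∀ᵐ ω ∂μ, Summable fun i => net.bsInterfTerm i ω := by
  filter_upwards [net.summable_bsAvg_mul_bsFading, net.ae_bsFading_nonneg] with ω hω hf
  refine Summable.of_nonneg_of_le (net.bsInterfTerm_nonneg hf) (fun i => ?_) hω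
  unfold bsInterfTerm
  split_ifs
  · exact mul_nonneg (net.bsAvg_pos i ω).le (hf i)
  · exact le_rfl

theorem measurable_bsInterfTerm (i : ℕ) : Measurable (net.bsInterfTerm i) := by
  refine Measurable.ite ?_ measurable_const
    ((net.measurable_bsAvg i).mul (net.bsFading_measurable i))
  have h : Measurable net.bestBS := p.measurable_nearest.comp net.measurable_bsConfig
  exact measurableSet_eq_fun measurable_const h

theorem aemeasurable_bsInterf [IsProbabilityMeasure μ] : AEMeasurable net.bsInterf μ := by
  refine aemeasurable_of_tendsto_metrizable_ae atTop
    (f := fun n ω => ∑ i ∈ Finset.range n, net.bsInterfTerm i ω)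
    (fun n => (Finset.measurable_sum _ fun i _ => net.measurable_bsInterfTerm i).aemeasurable) ?_
  filter_upwards [net.summable_bsInterfTerm] with ω hω
  exact hω.hasSum.tendsto_sum_nat

theorem ae_bsInterf_nonneg : ∀ᵐ ω ∂μ, 0 ≤ net.bsInterf ω := by
  filter_upwards [net.ae_bsFading_nonneg] with ω hf
  exact tsum_nonneg (net.bsInterfTerm_nonneg hf)

/-- The factor by which the `i`-th base station enters the Laplace transform of the interference,
as a function of the configuration of base stations and of its fading gain. The absolute value is
immaterial almost surely. -/
noncomputable def bsFactor (p : Params) (s : ℝ) (x : ℕ → Plane) (i : ℕ) (t : ℝ) : ℝ≥0∞ :=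
  if i = p.nearest x then 1
  else ENNReal.ofReal (Real.exp (-(s * p.bsMeanPower (p.bsHorizDist (x i)) * |t|)))

theorem bsFactor_le_one (p : Params) {s : ℝ} (hs : 0 ≤ s) (x : ℕ → Plane) (i : ℕ) (t : ℝ) :
    bsFactor p s x i t ≤ 1 := by
  unfold bsFactor
  split_ifs
  · exact le_rfl
  · refine ENNReal.ofReal_le_one.2 (Real.exp_le_one_iff.2 (neg_nonpos.2 ?_))
    have := p.Pg_pos
    unfold Params.bsMeanPower
    positivity

theorem measurable_bsFactor (p : Params) (s : ℝ) (i : ℕ) :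
    Measurable fun z : (ℕ → Plane) × ℝ => bsFactor p s z.1 i z.2 := by
  refine Measurable.ite ?_ measurable_const (by fun_prop)
  exact measurableSet_eq_fun measurable_const (p.measurable_nearest.comp measurable_fst)

theorem measurable_bsFactor_right (p : Params) (s : ℝ) (x : ℕ → Plane) (i : ℕ) :
    Measurable (bsFactor p s x i) := by
  unfold bsFactor
  split_ifs
  · exact measurable_const
  · fun_prop

/-- The exponential of the interference is the infinite product of the factors of the base stations. -/
theorem exp_bsInterf_eq_iprod [IsProbabilityMeasure μ] {s : ℝ} (hs : 0 ≤ s) :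
    ∀ᵐ ω ∂μ, ENNReal.ofReal (Real.exp (-(s * net.bsInterf ω)))
      = iprod fun i => bsFactor p s (net.bsConfig ω) i (net.bsGains ω i) := by
  filter_upwards [net.summable_bsInterfTerm, net.ae_bsFading_nonneg] with ω hω hf
  have hfac : ∀ i, bsFactor p s (net.bsConfig ω) i (net.bsGains ω i)
      = ENNReal.ofReal (Real.exp (-(s * net.bsInterfTerm i ω))) := by
    intro i
    have hterm : net.bsInterfTerm i ω = if i = p.nearest (net.bsConfig ω) then 0
      else net.bsAvg i ω * net.bsFading i ω := rfl
    rw [hterm, bsFactor]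
    split_ifs
    · simp
    · have : |net.bsGains ω i| = net.bsFading i ω := abs_of_nonneg (hf i)
      rw [this, mul_assoc]
      rfl
  refine tendsto_nhds_unique ?_ (tendsto_iprod fun i => bsFactor_le_one p hs _ i _)
  have h1 : Tendsto (fun n => ∑ i ∈ Finset.range n, net.bsInterfTerm i ω) atTop
      (𝓝 (net.bsInterf ω)) := hω.hasSum.tendsto_sum_nat
  have h2 := ((ENNReal.continuous_ofReal.comp Real.continuous_exp).continuousAt.tendsto.comp
    (h1.const_mul s).neg)
  refine h2.congr fun n => ?_
  simp only [Function.comp_apply]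
  simp_rw [hfac]
  rw [Finset.mul_sum, ← Finset.sum_neg_distrib, Real.exp_sum,
    ENNReal.ofReal_prod_of_nonneg fun i _ => (Real.exp_pos _).le]

/-- The mean over the fading gain of the factor of one base station. -/
theorem lintegral_bsFactor {s : ℝ} (hs : 0 < s) (x : ℕ → Plane) (i : ℕ) :
    ∫⁻ ω, bsFactor p s x i (net.bsFading i ω) ∂μ = if i = p.nearest x then 1 else
      ENNReal.ofReal (1 - bsLoss (s * p.Pg) p.etag p.hg (p.bsHorizDist (x i) ^ 2)) := by
  have hP := p.Pg_pos
  have hh := p.hg_pos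
  rw [← lintegral_map (measurable_bsFactor_right p s x i) (net.bsFading_measurable i),
    net.bsFading_law i]
  have hae : ∀ᵐ t ∂expMeasure 1, bsFactor p s x i t = if i = p.nearest x then 1
      else ENNReal.ofReal (Real.exp (-(s * p.bsMeanPower (p.bsHorizDist (x i)) * t))) := by
    have h := ae_nonneg_gammaMeasure 1 1
    rw [show gammaMeasure 1 1 = expMeasure 1 from rfl] at h
    filter_upwards [h] with t ht
    rw [bsFactor, abs_of_nonneg ht]
  rw [lintegral_congr_ae hae]
  split_ifs
  · have : IsProbabilityMeasure (expMeasure 1) := isProbabilityMeasure_gammaMeasure one_pos one_pos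
    simp
  · have hpos : 0 < p.bsMeanPower (p.bsHorizDist (x i)) := by
      unfold Params.bsMeanPower
      positivity
    rw [expMeasure, lintegral_exp_gammaMeasure one_pos one_pos (by positivity), div_one,
      Real.rpow_neg_one]
    congr 1
    rw [Params.bsMeanPower, bsLoss, neg_div, Real.rpow_neg (by positivity)]
    field_simp
    ring

/-- The joint transform of the distance of the nearest base station and of the interference of the
other base stations. -/
theorem lintegral_mul_exp_bsInterf [IsProbabilityMeasure μ] {s : ℝ} (hs : 0 < s) {k : ℝ → ℝ≥0∞}
    (hk : Measurable k) :
    ∫⁻ ω, k (net.bestDist ω) *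
        iprod (fun i => bsFactor p s (net.bsConfig ω) i (net.bsGains ω i)) ∂μ
      = ∫⁻ ω, k (net.bestDist ω) * ENNReal.ofReal (Real.exp (-(Real.pi * p.lam *
          tailExponent (s * p.Pg) p.etag (net.bestDist ω ^ 2 + p.hg ^ 2)))) ∂μ := by
  have hf : Measurable fun z : (ℕ → Plane) × (ℕ → ℝ) =>
      k (p.nearestDist z.1) * iprod (fun i => bsFactor p s z.1 i (z.2 i)) := by
    refine (hk.comp (p.measurable_nearestDist.comp measurable_fst)).mul (measurable_iprod fun i => ?_)
    have h : Measurable fun z : (ℕ → Plane) × (ℕ → ℝ) => (z.1, z.2 i) := by fun_prop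
    simpa only [Function.comp_def] using (measurable_bsFactor p s i).comp h
  have h1 := lintegral_of_indepFun net.measurable_bsConfig net.measurable_bsGains
    net.indepFun_bsConfig_bsGains hf
  have h2 := net.bs_poisson.lintegral_nearest_mul_iprod (mul_pos hs p.Pg_pos) hk
  simp_rw [net.bestDist_eq]
  refine h1.trans (Eq.trans ?_ h2)
  refine lintegral_congr fun ω => ?_
  have hm : ∀ i, Measurable fun ω' => bsFactor p s (net.bsConfig ω) i (net.bsGains ω' i) :=
    fun i => (measurable_bsFactor_right p s _ i).comp (net.bsFading_measurable i)
  have hmi : Measurable fun ω' => iprod fun i =>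
      bsFactor p s (net.bsConfig ω) i (net.bsGains ω' i) := measurable_iprod hm
  simp only
  rw [lintegral_const_mul _ hmi, lintegral_iprod_of_iIndepFun hm
    (fun i ω' => bsFactor_le_one p hs.le _ i _)]
  · congr 2
    funext i
    exact net.lintegral_bsFactor hs _ i
  · exact net.iIndepFun_bsFading.comp (fun i => bsFactor p s (net.bsConfig ω) i)
      fun i => measurable_bsFactor_right p s _ i

end Network

/-! ### Distance between the user equipment and a UAV -/

/-- The measure of the directions whose cosine is at most `-c`. For `|c| > 1` this is all or none of
them, in agreement with the values of `arccos` outside `[-1, 1]`. -/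
theorem volume_cos_le (c : ℝ) :
    volume (Set.Ioo (-Real.pi) Real.pi ∩ {θ | Real.cos θ ≤ -c}) = ENNReal.ofReal (2 * Real.arccos c) := by
  set α := Real.arccos (-c) with hα
  have hα0 : 0 ≤ α := Real.arccos_nonneg _
  have hαπ : α ≤ Real.pi := Real.arccos_le_pi _
  have hset : Set.Ioo (-Real.pi) Real.pi ∩ {θ | Real.cos θ ≤ -c}
      = Set.Ioo (-Real.pi) Real.pi \ Set.Ioo (-α) α := by
    ext θ
    rw [Set.mem_inter_iff, Set.mem_sdiff, Set.mem_ofPred_eq, Set.mem_Ioo, Set.mem_Ioo, ← abs_lt,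
      ← abs_lt, not_lt, and_congr_right_iff]
    intro hθ
    rw [← Real.cos_abs]
    constructor
    · intro h
      have := Real.arccos_le_arccos h
      rwa [Real.arccos_cos (abs_nonneg _) hθ.le] at this
    · intro h
      rcases lt_or_ge (-c) (-1) with h1 | h1
      · rw [hα, Real.arccos_of_le_neg_one h1.le] at h
        exact absurd hθ (not_lt.2 h)
      rcases lt_or_ge 1 (-c) with h2 | h2
      · exact (Real.cos_le_one _).trans h2.le
      · rw [← Real.cos_arccos h1 h2]
        exact Real.cos_le_cos_of_nonneg_of_le_pi hα0 hθ.le h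
  rw [hset, measure_sdiff (Set.Ioo_subset_Ioo (neg_le_neg hαπ) hαπ)
    measurableSet_Ioo.nullMeasurableSet measure_Ioo_lt_top.ne, Real.volume_Ioo, Real.volume_Ioo,
    ← ENNReal.ofReal_sub _ (by linarith)]
  congr 1
  rw [hα, Real.arccos_neg]
  ring

/-- Integration in polar coordinates around an arbitrary centre `!₂[v, 0]`. -/
theorem lintegral_polar (v : ℝ) (f : Plane → ℝ≥0∞) :
    ∫⁻ y, f y = ∫⁻ q in Set.Ioi (0 : ℝ) ×ˢ Set.Ioo (-Real.pi) Real.pi,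
      ENNReal.ofReal q.1 * f (!₂[q.1 * Real.cos q.2 + v, q.1 * Real.sin q.2]) := by
  have hmp := Complex.orthonormalBasisOneI.measurePreserving_repr
  calc ∫⁻ y, f y = ∫⁻ y, f (y + !₂[v, 0]) := (lintegral_add_right_eq_self f _).symm
    _ = ∫⁻ z : ℂ, f (Complex.orthonormalBasisOneI.repr z + !₂[v, 0]) := by
        rw [← hmp.lintegral_comp_emb Complex.orthonormalBasisOneI.measurableEquiv.measurableEmbedding]
    _ = _ := by
        rw [← Complex.lintegral_comp_polarCoord_symm]
        refine lintegral_congr fun q => ?_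
        rw [smul_eq_mul]
        congr 2
        ext i
        fin_cases i <;>
          simp [Complex.orthonormalBasisOneI_repr_apply, Complex.cos_ofReal_re,
            Complex.sin_ofReal_re]

namespace Params

variable (p : Params)

@[fun_prop]
theorem measurable_uavDist : Measurable p.uavDist := by
  unfold uavDist
  fun_prop

@[fun_prop]
theorem measurable_fW : Measurable p.fW := by
  have h1 : MeasurableSet {w | p.hu ≤ w ∧ w ≤ p.wm} := measurableSet_Icc
  have h2 : MeasurableSet {w | p.wm ≤ w ∧ w ≤ p.wp} := measurableSet_Icc
  unfold fW
  refine Measurable.ite h1 (by fun_prop) (Measurable.ite h2 ?_ measurable_const)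
  exact Measurable.mul (by fun_prop) (Real.continuous_arccos.measurable.comp (by fun_prop))

theorem fW_nonneg (w : ℝ) : 0 ≤ p.fW w := by
  have hhu := p.hu_pos
  unfold fW
  split_ifs with h1 h2
  · have : 0 < w := hhu.trans_le h1.1
    positivity
  · have : 0 ≤ w := (Real.sqrt_nonneg _).trans h2.1
    have := Real.arccos_nonneg ((w ^ 2 + p.v0 ^ 2 - √(p.ru ^ 2 + p.hu ^ 2) ^ 2) /
        (2 * p.v0 * √(w ^ 2 - p.hu ^ 2)))
    positivity
  · exact le_rfl

theorem hu_le_wm : p.hu ≤ p.wm :=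
  Real.le_sqrt_of_sq_le (by nlinarith [sq_nonneg (p.ru - p.v0)])

theorem fW_eq_zero_of_lt {w : ℝ} (hw : w < p.hu) : p.fW w = 0 := by
  have := p.hu_le_wm
  rw [fW, if_neg fun h => not_le.2 hw h.1, if_neg fun h => not_le.2 hw (this.trans h.1)]

theorem fW_eq_zero_of_gt {w : ℝ} (hw : p.wp < w) : p.fW w = 0 := by
  have : p.wm ≤ p.wp := Real.sqrt_le_sqrt (by nlinarith [mul_nonneg p.ru_pos.le p.v0_nonneg])
  rw [fW, if_neg fun h => not_le.2 hw (h.2.trans this), if_neg fun h => not_le.2 hw h.2]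

/-- Seen from the user equipment, the directions in which the circle of radius `r` lies in the disk
of the UAVs. -/
theorem volume_directions (hv : p.v0 ≤ p.ru) {r : ℝ} (hr : 0 < r) :
    volume (Set.Ioo (-Real.pi) Real.pi ∩
        {θ | r ^ 2 + 2 * r * p.v0 * Real.cos θ + p.v0 ^ 2 ≤ p.ru ^ 2})
      = ENNReal.ofReal (Real.pi * p.ru ^ 2) *
        ENNReal.ofReal (p.fW (√(r ^ 2 + p.hu ^ 2)) / √(r ^ 2 + p.hu ^ 2)) := by
  have hru := p.ru_pos
  have hv0 := p.v0_nonneg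
  have hw : 0 < √(r ^ 2 + p.hu ^ 2) := by positivity
  have hwsq : √(r ^ 2 + p.hu ^ 2) ^ 2 = r ^ 2 + p.hu ^ 2 := Real.sq_sqrt (by positivity)
  have hr' : √(√(r ^ 2 + p.hu ^ 2) ^ 2 - p.hu ^ 2) = r := by
    rw [hwsq, add_sub_cancel_right, Real.sqrt_sq hr.le]
  have hle : ∀ R, 0 ≤ R → (√(r ^ 2 + p.hu ^ 2) ≤ √(R ^ 2 + p.hu ^ 2) ↔ r ≤ R) := fun R hR => by
    rw [Real.sqrt_le_sqrt_iff (by positivity), add_le_add_iff_right, sq_le_sq₀ hr.le hR]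
  have hge : ∀ R, 0 ≤ R → (√(R ^ 2 + p.hu ^ 2) ≤ √(r ^ 2 + p.hu ^ 2) ↔ R ≤ r) := fun R hR => by
    rw [Real.sqrt_le_sqrt_iff (by positivity), add_le_add_iff_right, sq_le_sq₀ hR hr.le]
  have hhw : p.hu ≤ √(r ^ 2 + p.hu ^ 2) := Real.le_sqrt_of_sq_le (by nlinarith)
  have hm : (√(r ^ 2 + p.hu ^ 2) ≤ p.wm ↔ r ≤ p.ru - p.v0) := hle _ (by linarith)
  have hm' : (p.wm ≤ √(r ^ 2 + p.hu ^ 2) ↔ p.ru - p.v0 ≤ r) := hge _ (by linarith)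
  have hp : (√(r ^ 2 + p.hu ^ 2) ≤ p.wp ↔ r ≤ p.ru + p.v0) := hle _ (by linarith)
  have hd : √(p.ru ^ 2 + p.hu ^ 2) ^ 2 = p.ru ^ 2 + p.hu ^ 2 := Real.sq_sqrt (by positivity)
  rw [← ENNReal.ofReal_mul (by positivity), fW]
  -- In terms of the horizontal distance `r`, the two thresholds are `ru - v0` and `ru + v0`.
  simp only [hm, hm', hp, hr']
  rw [hwsq, hd]
  generalize √(r ^ 2 + p.hu ^ 2) = w at *
  -- For `v0 = 0` the second case of `fW`, which divides by `v0`, is void.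
  rcases hv0.eq_or_lt with h0 | h0
  · rw [← h0]
    have hset : {θ : ℝ | r ^ 2 + 2 * r * 0 * Real.cos θ + 0 ^ 2 ≤ p.ru ^ 2} = {_θ | r ≤ p.ru} := by
      ext θ
      simp only [Set.mem_ofPred_eq]
      rw [← sq_le_sq₀ hr.le hru.le]
      ring_nf
    rw [hset]
    by_cases h : r ≤ p.ru
    · rw [if_pos ⟨hhw, by linarith⟩]
      simp only [h, Set.ofPred_true, Set.inter_univ, Real.volume_Ioo]
      congr 1
      field_simp
      ring
    · rw [if_neg fun h' => h (by linarith [h'.2]), if_neg fun h' => h (by linarith [h'.2])]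
      simp [h]
  · have hrv : 0 < 2 * p.v0 * r := by positivity
    set c := (r ^ 2 + p.v0 ^ 2 - p.ru ^ 2) / (2 * p.v0 * r) with hc
    have hcr : c * (2 * p.v0 * r) = r ^ 2 + p.v0 ^ 2 - p.ru ^ 2 := div_mul_cancel₀ _ hrv.ne'
    have hset : {θ : ℝ | r ^ 2 + 2 * r * p.v0 * Real.cos θ + p.v0 ^ 2 ≤ p.ru ^ 2}
        = {θ | Real.cos θ ≤ -c} := by
      ext θ
      simp only [Set.mem_ofPred_eq]
      rw [← mul_le_mul_iff_left₀ hrv (b := Real.cos θ), neg_mul, hcr]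
      constructor <;> intro h <;> linarith
    have harg : (r ^ 2 + p.hu ^ 2 + p.v0 ^ 2 - (p.ru ^ 2 + p.hu ^ 2)) / (2 * p.v0 * r) = c := by
      rw [hc]
      congr 1
      ring
    rw [hset, volume_cos_le, harg]
    congr 1
    by_cases h1 : r ≤ p.ru - p.v0
    · have hc1 : c ≤ -1 := by
        rw [hc, div_le_iff₀ hrv]
        nlinarith
      rw [if_pos ⟨hhw, h1⟩, Real.arccos_of_le_neg_one hc1]
      field_simp
    · rw [if_neg fun h => h1 h.2]
      by_cases h2 : r ≤ p.ru + p.v0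
      · rw [if_pos ⟨(not_le.1 h1).le, h2⟩]
        field_simp
      · have hc1 : 1 ≤ c := by
          rw [hc, le_div_iff₀ hrv]
          nlinarith [not_le.1 h2]
        rw [if_neg fun h => h2 h.2, Real.arccos_of_one_le hc1]
        simp

/-- The distance between the user equipment and a uniformly placed UAV has density `fW`. -/
theorem lintegral_uavDist (hv : p.v0 ≤ p.ru) {f : ℝ → ℝ≥0∞} (hf : Measurable f) :
    ∫⁻ y, f (p.uavDist y) ∂p.diskLaw = ∫⁻ w, f w * ENNReal.ofReal (p.fW w) := by
  have hru := p.ru_pos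
  have hhu := p.hu_pos
  have hvol : volume (Metric.closedBall (0 : Plane) p.ru) = ENNReal.ofReal (Real.pi * p.ru ^ 2) := by
    rw [EuclideanSpace.volume_closedBall_fin_two, ← ENNReal.ofReal_pow hru.le,
      ← ENNReal.ofReal_mul (by positivity), mul_comm]
  have hA0 : ENNReal.ofReal (Real.pi * p.ru ^ 2) ≠ 0 := (ENNReal.ofReal_pos.2 (by positivity)).ne'
  have hdist : ∀ r θ : ℝ, 0 < r →
      dist (!₂[r * Real.cos θ + p.v0, r * Real.sin θ] : Plane) p.ue = r := by
    intro r θ hr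
    rw [ue, EuclideanSpace.dist_eq, Fin.sum_univ_two]
    simp only [Real.dist_eq, sq_abs]
    have : (r * Real.cos θ) ^ 2 + (r * Real.sin θ) ^ 2 = r ^ 2 := by
      linear_combination r ^ 2 * Real.sin_sq_add_cos_sq θ
    simp [this, Real.sqrt_sq hr.le]
  have hball : ∀ r θ : ℝ,
      (!₂[r * Real.cos θ + p.v0, r * Real.sin θ] : Plane) ∈ Metric.closedBall (0 : Plane) p.ru ↔
        r ^ 2 + 2 * r * p.v0 * Real.cos θ + p.v0 ^ 2 ≤ p.ru ^ 2 := by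
    intro r θ
    rw [mem_closedBall_zero_iff, EuclideanSpace.norm_eq, Real.sqrt_le_left hru.le, Fin.sum_univ_two]
    simp only [Real.norm_eq_abs, sq_abs]
    have : (r * Real.cos θ + p.v0) ^ 2 + (r * Real.sin θ) ^ 2
        = r ^ 2 + 2 * r * p.v0 * Real.cos θ + p.v0 ^ 2 := by
      linear_combination r ^ 2 * Real.sin_sq_add_cos_sq θ
    simp [this]
  have hmset : MeasurableSet {q : ℝ × ℝ |
      q.1 ^ 2 + 2 * q.1 * p.v0 * Real.cos q.2 + p.v0 ^ 2 ≤ p.ru ^ 2} :=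
    measurableSet_le (by fun_prop) (by fun_prop)
  have hpolar : ∫⁻ y in Metric.closedBall (0 : Plane) p.ru, f (p.uavDist y)
      = ∫⁻ r in Set.Ioi (0 : ℝ), ENNReal.ofReal r * f (√(r ^ 2 + p.hu ^ 2)) *
          volume (Set.Ioo (-Real.pi) Real.pi ∩
            {θ | r ^ 2 + 2 * r * p.v0 * Real.cos θ + p.v0 ^ 2 ≤ p.ru ^ 2}) := by
    rw [← lintegral_indicator measurableSet_closedBall, lintegral_polar p.v0]
    have hcongr : ∀ q ∈ Set.Ioi (0 : ℝ) ×ˢ Set.Ioo (-Real.pi) Real.pi,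
        ENNReal.ofReal q.1 * (Metric.closedBall (0 : Plane) p.ru).indicator
          (fun y => f (p.uavDist y)) (!₂[q.1 * Real.cos q.2 + p.v0, q.1 * Real.sin q.2])
        = ENNReal.ofReal q.1 * f (√(q.1 ^ 2 + p.hu ^ 2)) * {q : ℝ × ℝ |
          q.1 ^ 2 + 2 * q.1 * p.v0 * Real.cos q.2 + p.v0 ^ 2 ≤ p.ru ^ 2}.indicator 1 q := by
      rintro ⟨r, θ⟩ ⟨hr, -⟩
      have hr' : 0 < r := hr
      by_cases h : r ^ 2 + 2 * r * p.v0 * Real.cos θ + p.v0 ^ 2 ≤ p.ru ^ 2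
      · have h1 : p.uavDist (!₂[r * Real.cos θ + p.v0, r * Real.sin θ]) = √(r ^ 2 + p.hu ^ 2) := by
          rw [uavDist]
          exact congrArg (fun d => √(d ^ 2 + p.hu ^ 2)) (hdist r θ hr')
        have h2 := Set.indicator_of_mem ((hball r θ).2 h) fun y => f (p.uavDist y)
        have h3 : (r, θ) ∈ {q : ℝ × ℝ |
          q.1 ^ 2 + 2 * q.1 * p.v0 * Real.cos q.2 + p.v0 ^ 2 ≤ p.ru ^ 2} := h
        rw [Set.indicator_of_mem h3, Pi.one_apply, mul_one, ← h1]
        exact congrArg (ENNReal.ofReal r * ·) h2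
      · have h2 := Set.indicator_of_notMem (fun h' => h ((hball r θ).1 h')) fun y => f (p.uavDist y)
        have h3 : (r, θ) ∉ {q : ℝ × ℝ |
          q.1 ^ 2 + 2 * q.1 * p.v0 * Real.cos q.2 + p.v0 ^ 2 ≤ p.ru ^ 2} := h
        rw [Set.indicator_of_notMem h3, mul_zero]
        exact (congrArg (ENNReal.ofReal r * ·) h2).trans (mul_zero _)
    rw [setLIntegral_congr_fun (measurableSet_Ioi.prod measurableSet_Ioo) hcongr,
      Measure.volume_eq_prod, setLIntegral_prod _ (by
        refine (Measurable.mul (Measurable.mul (by fun_prop) (hf.comp (by fun_prop))) ?_).aemeasurable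
        exact measurable_one.indicator hmset)]
    refine lintegral_congr fun r => ?_
    have hm : MeasurableSet {θ : ℝ | r ^ 2 + 2 * r * p.v0 * Real.cos θ + p.v0 ^ 2 ≤ p.ru ^ 2} :=
      measurableSet_le (by fun_prop) (by fun_prop)
    rw [Set.inter_comm, ← Measure.restrict_apply hm, ← lintegral_indicator_one hm]
    exact lintegral_const_mul (ENNReal.ofReal r * f √(r ^ 2 + p.hu ^ 2))
      (f := {θ : ℝ | r ^ 2 + 2 * r * p.v0 * Real.cos θ + p.v0 ^ 2 ≤ p.ru ^ 2}.indicator 1)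
      (measurable_one.indicator hm)
  -- The substitution `w = √(r ^ 2 + hu ^ 2)`.
  have himage : (fun r : ℝ => √(r ^ 2 + p.hu ^ 2)) '' Set.Ioi 0 = Set.Ioi p.hu := by
    ext w
    constructor
    · rintro ⟨r, hr, rfl⟩
      have hr' : 0 < r := hr
      exact Real.lt_sqrt_of_sq_lt (by nlinarith)
    · intro hw
      have hw' : p.hu < w := hw
      have hpos : 0 < w ^ 2 - p.hu ^ 2 := by nlinarith
      refine ⟨√(w ^ 2 - p.hu ^ 2), Real.sqrt_pos.2 hpos, ?_⟩
      simp only [Real.sq_sqrt hpos.le, sub_add_cancel]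
      exact Real.sqrt_sq (hhu.trans hw').le
  have hsub : ∫⁻ w in Set.Ioi p.hu, f w * ENNReal.ofReal (p.fW w)
      = ∫⁻ r in Set.Ioi (0 : ℝ), ENNReal.ofReal |r / √(r ^ 2 + p.hu ^ 2)| *
        (f (√(r ^ 2 + p.hu ^ 2)) * ENNReal.ofReal (p.fW (√(r ^ 2 + p.hu ^ 2)))) := by
    rw [← himage]
    refine lintegral_image_eq_lintegral_abs_deriv_mul measurableSet_Ioi (fun r _ => ?_) ?_
      fun w => f w * ENNReal.ofReal (p.fW w)
    · have h := ((hasDerivAt_pow 2 r).add_const (p.hu ^ 2)).sqrt (by positivity)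
      refine (h.congr_deriv ?_).hasDerivWithinAt
      field_simp
      simp
    · intro r hr r' hr' h
      have hr0 : 0 < r := hr
      have hr0' : 0 < r' := hr'
      have h' : r ^ 2 + p.hu ^ 2 = r' ^ 2 + p.hu ^ 2 :=
        (Real.sqrt_inj (by positivity) (by positivity)).1 h
      exact (pow_left_inj₀ hr0.le hr0'.le two_ne_zero).1 (by linarith)
  have hfull : ∫⁻ w, f w * ENNReal.ofReal (p.fW w)
      = ∫⁻ w in Set.Ioi p.hu, f w * ENNReal.ofReal (p.fW w) := by
    rw [setLIntegral_congr Ioi_ae_eq_Ici, ← lintegral_indicator measurableSet_Ici]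
    refine lintegral_congr fun w => ?_
    by_cases h : w ∈ Set.Ici p.hu
    · rw [Set.indicator_of_mem h]
    · rw [Set.indicator_of_notMem h, p.fW_eq_zero_of_lt (not_le.1 h)]
      simp
  rw [hfull, hsub, diskLaw, ProbabilityTheory.cond, lintegral_smul_measure, hpolar, smul_eq_mul,
    ← lintegral_const_mul' _ _ (by rw [hvol]; exact ENNReal.inv_ne_top.2 hA0)]
  refine setLIntegral_congr_fun measurableSet_Ioi fun r hr => ?_
  have hr' : 0 < r := hr
  rw [p.volume_directions hv hr', hvol, abs_of_pos (by positivity)]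
  have h1 : ENNReal.ofReal (r / √(r ^ 2 + p.hu ^ 2)) * ENNReal.ofReal (p.fW √(r ^ 2 + p.hu ^ 2))
      = ENNReal.ofReal r * ENNReal.ofReal (p.fW √(r ^ 2 + p.hu ^ 2) / √(r ^ 2 + p.hu ^ 2)) := by
    rw [← ENNReal.ofReal_mul (by positivity), ← ENNReal.ofReal_mul hr'.le]
    congr 1
    ring
  set A := ENNReal.ofReal (Real.pi * p.ru ^ 2)
  generalize ENNReal.ofReal (p.fW √(r ^ 2 + p.hu ^ 2) / √(r ^ 2 + p.hu ^ 2)) = B at *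
  calc A⁻¹ * (ENNReal.ofReal r * f √(r ^ 2 + p.hu ^ 2) * (A * B))
      = (A * A⁻¹) * (f √(r ^ 2 + p.hu ^ 2) * (ENNReal.ofReal r * B)) := by ring
    _ = _ := by
      rw [ENNReal.mul_inv_cancel hA0 ENNReal.ofReal_ne_top, one_mul, ← h1]
      ring

end Params

/-! ### One UAV, and the product over all UAVs -/

namespace Params

variable (p : Params)

theorem losProb_nonneg (r : ℝ) : 0 ≤ p.losProb r := by
  have := p.a_pos
  unfold losProb
  positivity

theorem losProb_le_one (r : ℝ) : p.losProb r ≤ 1 := by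
  have := p.a_pos
  unfold losProb
  rw [div_le_one (by positivity)]
  have : 0 < p.a * Real.exp (-p.b * (180 / Real.pi * p.elevation r - p.a)) := by positivity
  linarith

theorem kappa_nonneg (ζ : Link) (r : ℝ) : 0 ≤ p.kappa ζ r := by
  cases ζ
  · exact sub_nonneg.2 (p.losProb_le_one r)
  · exact p.losProb_nonneg r

theorem kappa_le_one (ζ : Link) (r : ℝ) : p.kappa ζ r ≤ 1 := by
  cases ζ
  · exact sub_le_self _ (p.losProb_nonneg r)
  · exact p.losProb_le_one r

@[fun_prop]
theorem measurable_kappa (ζ : Link) : Measurable (p.kappa ζ) := by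
  have h1 : Measurable p.elevation := by
    unfold elevation
    exact Measurable.ite (measurableSet_singleton _) measurable_const
      (Real.measurable_arctan.comp (by fun_prop))
  have h2 : Measurable p.losProb := by
    unfold losProb
    fun_prop
  cases ζ
  · exact measurable_const.sub h2
  · exact h2

@[fun_prop]
theorem measurable_uavMeanPower (ζ : Link) : Measurable (p.uavMeanPower ζ) := by
  unfold uavMeanPower
  fun_prop

theorem uavMeanPower_nonneg (ζ : Link) {z : ℝ} (hz : 0 ≤ z) : 0 ≤ p.uavMeanPower ζ z := by
  have := p.Pu_pos
  unfold uavMeanPower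
  positivity

theorem uavDist_nonneg (y : Plane) : 0 ≤ p.uavDist y := Real.sqrt_nonneg _

@[fun_prop]
theorem measurable_exclRadius (ζ : Link) : Measurable (p.exclRadius ζ) := by
  unfold exclRadius
  fun_prop

/-- A UAV is not stronger than a base station exactly if it lies outside the exclusion radius. -/
theorem uavMeanPower_le_bsMeanPower_iff (ζ : Link) {z d : ℝ} (hz : 0 < z) :
    p.uavMeanPower ζ z ≤ p.bsMeanPower d ↔ p.exclRadius ζ d ≤ z := by
  have hη := p.eta_pos ζ
  have hPu := p.Pu_pos
  have hPg := p.Pg_pos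
  have hh := p.hg_pos
  set U := d ^ 2 + p.hg ^ 2
  have hUpos : 0 < U := by positivity
  have hEpos : 0 < p.exclRadius ζ d := by
    unfold exclRadius
    positivity
  have hE : p.exclRadius ζ d ^ p.eta ζ = p.Pu / p.Pg * U ^ (p.etag / 2) := by
    rw [exclRadius, Real.mul_rpow (by positivity) (by positivity), ← Real.rpow_mul (by positivity),
      ← Real.rpow_mul (by positivity)]
    have h1 : 1 / p.eta ζ * p.eta ζ = 1 := by field_simp
    have h2 : p.etag / (2 * p.eta ζ) * p.eta ζ = p.etag / 2 := by field_simp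
    rw [h1, h2, Real.rpow_one]
  rw [← Real.rpow_le_rpow_iff hEpos.le hz.le hη, hE, uavMeanPower, bsMeanPower, neg_div,
    Real.rpow_neg hz.le, Real.rpow_neg hUpos.le]
  have hz' : 0 < z ^ p.eta ζ := by positivity
  have hU' : 0 < U ^ (p.etag / 2) := by positivity
  rw [← div_eq_mul_inv, ← div_eq_mul_inv, div_le_div_iff₀ hz' hU', div_mul_eq_mul_div,
    div_le_iff₀ hPg, mul_comm p.Pg]

theorem lintegral_fW (hv : p.v0 ≤ p.ru) : ∫⁻ w, ENNReal.ofReal (p.fW w) = 1 := by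
  have h := p.lintegral_uavDist hv (f := fun _ => 1) measurable_const
  have hvol : volume (Metric.closedBall (0 : Plane) p.ru) ≠ 0 :=
    (Metric.measure_closedBall_pos _ _ p.ru_pos).ne'
  have : IsProbabilityMeasure p.diskLaw := cond_isProbabilityMeasure_of_finite hvol
    measure_closedBall_lt_top.ne
  simpa using h.symm

theorem integrable_fW (hv : p.v0 ≤ p.ru) : Integrable p.fW :=
  (lintegral_ofReal_ne_top_iff_integrable p.measurable_fW.aestronglyMeasurable
    (Eventually.of_forall p.fW_nonneg)).1 (by rw [p.lintegral_fW hv]; exact ENNReal.one_ne_top)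

/-- The Laplace transform, at `s`, of the power received from a UAV at distance `v`. -/
noncomputable def uavLaplace (ζ : Link) (s v : ℝ) : ℝ :=
  (1 + s * p.Pu * v ^ (-p.eta ζ) / p.m ζ) ^ (-p.m ζ)

@[fun_prop]
theorem measurable_uavLaplace (ζ : Link) (s : ℝ) : Measurable (p.uavLaplace ζ s) := by
  unfold uavLaplace
  fun_prop

theorem uavLaplace_zero (ζ : Link) (v : ℝ) : p.uavLaplace ζ 0 v = 1 := by simp [uavLaplace]

theorem uavLaplace_nonneg (ζ : Link) {s v : ℝ} (hs : 0 ≤ s) (hv : 0 ≤ v) :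
    0 ≤ p.uavLaplace ζ s v := by
  have := p.Pu_pos
  have := p.m_pos ζ
  unfold uavLaplace
  positivity

/-- The Laplace transform of a nonnegative power is antitone. -/
theorem uavLaplace_anti (ζ : Link) {s t v : ℝ} (hs : 0 ≤ s) (hst : s ≤ t) (hv : 0 ≤ v) :
    p.uavLaplace ζ t v ≤ p.uavLaplace ζ s v := by
  have hP := p.Pu_pos
  have hm := p.m_pos ζ
  unfold uavLaplace
  refine Real.rpow_le_rpow_of_nonpos (by positivity) ?_ (by linarith)
  gcongr

theorem uavLaplace_le_one (ζ : Link) {s v : ℝ} (hs : 0 ≤ s) (hv : 0 ≤ v) :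
    p.uavLaplace ζ s v ≤ 1 :=
  (p.uavLaplace_anti ζ le_rfl hs hv).trans (p.uavLaplace_zero ζ v).le

/-- The contribution of the links of type `ζ` to the probability that a UAV is not stronger than a
base station at horizontal distance `d`, weighted by the Laplace transform of its power. -/
noncomputable def uavWeight (ζ : Link) (s d : ℝ) : ℝ :=
  ∫ v in (p.exclRadius ζ d)..p.wp, p.uavLaplace ζ s v * p.fW v * p.kappa ζ v

theorem uavWeight_integrand_nonneg (ζ : Link) {s : ℝ} (hs : 0 ≤ s) (v : ℝ) :
    0 ≤ p.uavLaplace ζ s v * p.fW v * p.kappa ζ v := by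
  rcases lt_or_ge v p.hu with h | h
  · rw [p.fW_eq_zero_of_lt h]
    simp
  · exact mul_nonneg (mul_nonneg (p.uavLaplace_nonneg ζ hs (p.hu_pos.le.trans h)) (p.fW_nonneg v))
      (p.kappa_nonneg ζ v)

theorem uavWeight_integrable (hv : p.v0 ≤ p.ru) (ζ : Link) {s : ℝ} (hs : 0 ≤ s) :
    Integrable fun v => p.uavLaplace ζ s v * p.fW v * p.kappa ζ v := by
  refine (p.integrable_fW hv).mono' (by fun_prop) (Eventually.of_forall fun v => ?_)
  rw [Real.norm_of_nonneg (p.uavWeight_integrand_nonneg ζ hs v)]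
  rcases lt_or_ge v p.hu with h | h
  · rw [p.fW_eq_zero_of_lt h]
    simp
  · have h0 := p.hu_pos.le.trans h
    have h1 := p.uavLaplace_le_one ζ hs h0
    have h3 := p.fW_nonneg v
    have h4 := p.kappa_nonneg ζ v
    have h5 := p.kappa_le_one ζ v
    calc p.uavLaplace ζ s v * p.fW v * p.kappa ζ v ≤ 1 * p.fW v * 1 := by gcongr
      _ = p.fW v := by ring

/-- As `fW` vanishes beyond `wp`, the interval integral is an integral over a half-line, also if the
exclusion radius exceeds `wp` and the interval is reversed. -/
theorem uavWeight_eq_setIntegral (ζ : Link) (s d : ℝ) :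
    p.uavWeight ζ s d
      = ∫ v in Set.Ioi (p.exclRadius ζ d), p.uavLaplace ζ s v * p.fW v * p.kappa ζ v := by
  have hzero : ∀ v, p.wp < v → p.uavLaplace ζ s v * p.fW v * p.kappa ζ v = 0 := fun v h => by
    rw [p.fW_eq_zero_of_gt h]
    simp
  rw [uavWeight]
  rcases le_total (p.exclRadius ζ d) p.wp with h | h
  · rw [intervalIntegral.integral_of_le h]
    refine Eq.symm (setIntegral_eq_of_subset_of_forall_sdiff_eq_zero measurableSet_Ioi
      (fun v hv => hv.1) fun v hv => hzero v (not_le.1 fun h' => hv.2 ⟨hv.1, h'⟩))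
  · have h1 : ∫ v in Set.Ioc p.wp (p.exclRadius ζ d),
        p.uavLaplace ζ s v * p.fW v * p.kappa ζ v = 0 :=
      setIntegral_eq_zero_of_forall_eq_zero fun v hv => hzero v hv.1
    have h2 : ∫ v in Set.Ioi (p.exclRadius ζ d),
        p.uavLaplace ζ s v * p.fW v * p.kappa ζ v = 0 :=
      setIntegral_eq_zero_of_forall_eq_zero fun v hv => hzero v (h.trans_lt hv)
    rw [intervalIntegral.integral_of_ge h, h1, h2, neg_zero]

theorem ofReal_uavWeight (hv : p.v0 ≤ p.ru) (ζ : Link) {s : ℝ} (hs : 0 ≤ s) (d : ℝ) :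
    ENNReal.ofReal (p.uavWeight ζ s d) = ∫⁻ v in Set.Ioi (p.exclRadius ζ d),
      ENNReal.ofReal (p.uavLaplace ζ s v * p.fW v * p.kappa ζ v) := by
  rw [uavWeight_eq_setIntegral, ofReal_integral_eq_lintegral_ofReal
    (p.uavWeight_integrable hv ζ hs).integrableOn
    (Eventually.of_forall (p.uavWeight_integrand_nonneg ζ hs))]

theorem uavWeight_nonneg (ζ : Link) {s : ℝ} (hs : 0 ≤ s) (d : ℝ) : 0 ≤ p.uavWeight ζ s d := by
  rw [uavWeight_eq_setIntegral]
  exact integral_nonneg (p.uavWeight_integrand_nonneg ζ hs)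

theorem uavWeight_anti (hv : p.v0 ≤ p.ru) (ζ : Link) {s t : ℝ} (hs : 0 ≤ s) (hst : s ≤ t) (d : ℝ) :
    p.uavWeight ζ t d ≤ p.uavWeight ζ s d := by
  rw [uavWeight_eq_setIntegral, uavWeight_eq_setIntegral]
  refine integral_mono (p.uavWeight_integrable hv ζ (hs.trans hst)).integrableOn
    (p.uavWeight_integrable hv ζ hs).integrableOn fun v => ?_
  rcases lt_or_ge v p.hu with h | h
  · simp [p.fW_eq_zero_of_lt h]
  · have h3 := p.fW_nonneg v
    have h4 := p.kappa_nonneg ζ v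
    have h5 := p.uavLaplace_anti ζ hs hst (p.hu_pos.le.trans h)
    simp only
    gcongr

theorem measurable_uavWeight (hv : p.v0 ≤ p.ru) (ζ : Link) {s : ℝ} (hs : 0 ≤ s) :
    Measurable (p.uavWeight ζ s) := by
  have h1 : p.uavWeight ζ s = fun d => (∫⁻ v, {z : ℝ × ℝ | p.exclRadius ζ z.1 < z.2}.indicator
      (fun z => ENNReal.ofReal (p.uavLaplace ζ s z.2 * p.fW z.2 * p.kappa ζ z.2)) (d, v)).toReal := by
    funext d
    rw [← ENNReal.toReal_ofReal (p.uavWeight_nonneg ζ hs d), p.ofReal_uavWeight hv ζ hs,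
      ← lintegral_indicator measurableSet_Ioi]
    rfl
  rw [h1]
  refine (Measurable.lintegral_prod_right' (Measurable.indicator (by fun_prop) ?_)).ennreal_toReal
  exact measurableSet_lt (by fun_prop) (by fun_prop)

end Params

namespace Network

variable {p : Params} {Ω : Type*} [MeasurableSpace Ω] {μ : Measure Ω} (net : Network p μ)

/-- Expectations over the position and the link state of a UAV. -/
theorem lintegral_uav_link (j : Fin p.Nu) {h : Plane × Link → ℝ≥0∞} (hh : Measurable h) :
    ∫⁻ ω, h (net.uavConfig ω j) ∂μ
      = ∫⁻ y, h (y, LOS) * ENNReal.ofReal (p.kappa LOS (p.uavDist y)) ∂p.diskLaw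
        + ∫⁻ y, h (y, NLOS) * ENNReal.ofReal (p.kappa NLOS (p.uavDist y)) ∂p.diskLaw := by
  have hlm : ∀ ζ, MeasurableSet {ω | net.link j ω = ζ} := fun ζ =>
    net.link_measurable j (measurableSet_singleton ζ)
  have hκ : ∀ ζ, Measurable fun y => ENNReal.ofReal (p.kappa ζ (p.uavDist y)) := fun ζ => by
    fun_prop
  have hmap : ∀ ζ, (μ.restrict {ω | net.link j ω = ζ}).map (net.uav j)
      = p.diskLaw.withDensity fun y => ENNReal.ofReal (p.kappa ζ (p.uavDist y)) := by
    intro ζ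
    ext A hA
    rw [Measure.map_apply (net.uav_measurable j) hA,
      Measure.restrict_apply (net.uav_measurable j hA), withDensity_apply _ hA, ← net.link_law j ζ A hA]
    rfl
  have hpart : ∀ ζ, ∫⁻ ω in {ω | net.link j ω = ζ}, h (net.uavConfig ω j) ∂μ
      = ∫⁻ y, h (y, ζ) * ENNReal.ofReal (p.kappa ζ (p.uavDist y)) ∂p.diskLaw := by
    intro ζ
    have hm : Measurable fun y => h (y, ζ) := hh.comp measurable_prodMk_right
    rw [setLIntegral_congr_fun (g := fun ω => h (net.uav j ω, ζ)) (hlm ζ) fun ω hω => by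
      have hω' : net.link j ω = ζ := hω
      simp only [uavConfig, hω'], ← lintegral_map hm (net.uav_measurable j), hmap ζ,
      lintegral_withDensity_eq_lintegral_mul _ (hκ ζ) hm]
    exact lintegral_congr fun y => mul_comm _ _
  rw [← hpart, ← hpart, ← lintegral_add_compl _ (hlm LOS)]
  congr 3
  ext ω
  simp

/-- The factor by which a UAV with position and link state `c` and fading gains `t` enters the
Laplace transform of the interference, on the event that its mean power is at most `P`. -/
noncomputable def uavFactor (p : Params) (s P : ℝ) (c : Plane × Link) (t : Link → ℝ) : ℝ≥0∞ :=
  if p.uavMeanPower c.2 (p.uavDist c.1) ≤ P then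
    ENNReal.ofReal (Real.exp (-(s * p.uavMeanPower c.2 (p.uavDist c.1) * t c.2))) else 0

theorem measurable_uavPower (p : Params) :
    Measurable fun c : Plane × Link => p.uavMeanPower c.2 (p.uavDist c.1) :=
  measurable_from_prod_countable_left fun ζ => (p.measurable_uavMeanPower ζ).comp p.measurable_uavDist

theorem measurable_uavFactor (p : Params) (s : ℝ) :
    Measurable fun z : ℝ × (Plane × Link) × (Link → ℝ) => uavFactor p s z.1 z.2.1 z.2.2 := by
  have hP : Measurable fun z : ℝ × (Plane × Link) × (Link → ℝ) =>
      p.uavMeanPower z.2.1.2 (p.uavDist z.2.1.1) :=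
    (measurable_uavPower p).comp (measurable_fst.comp measurable_snd)
  have ht : Measurable fun z : ℝ × (Plane × Link) × (Link → ℝ) => z.2.2 z.2.1.2 := by
    have h : Measurable fun w : (Link → ℝ) × Link => w.1 w.2 :=
      measurable_from_prod_countable_left fun ζ => measurable_pi_apply ζ
    exact h.comp (f := fun z : ℝ × (Plane × Link) × (Link → ℝ) => (z.2.2, z.2.1.2)) (by fun_prop)
  exact Measurable.ite (measurableSet_le hP measurable_fst)
    ((hP.const_mul s).mul ht).neg.exp.ennreal_ofReal measurable_const

/-- The mean over the fading gains of the factor of a UAV. -/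
theorem lintegral_uavFactor (j : Fin p.Nu) {s : ℝ} (hs : 0 ≤ s) (P : ℝ) (c : Plane × Link) :
    ∫⁻ ω, uavFactor p s P c (net.uavGains ω j) ∂μ
      = if p.uavMeanPower c.2 (p.uavDist c.1) ≤ P then
          ENNReal.ofReal (p.uavLaplace c.2 s (p.uavDist c.1)) else 0 := by
  have hm := p.m_pos c.2
  have hP := p.uavMeanPower_nonneg c.2 (p.uavDist_nonneg c.1)
  unfold uavFactor
  split_ifs with h
  · have hmap := lintegral_map (μ := μ) (f := fun t => ENNReal.ofReal
      (Real.exp (-(s * p.uavMeanPower c.2 (p.uavDist c.1) * t)))) (by fun_prop)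
      (net.uavFading_measurable j c.2)
    rw [net.uavFading_law] at hmap
    refine hmap.symm.trans ?_
    rw [lintegral_exp_gammaMeasure hm hm (by positivity), Params.uavLaplace, Params.uavMeanPower,
      mul_assoc]
  · simp

/-- Integrating out the gains and then the positions and link states, the UAVs being independent and
identically distributed. -/
theorem lintegral_prod_uavFactor [IsProbabilityMeasure μ] (hv : p.v0 ≤ p.ru) {s : ℝ} (hs : 0 ≤ s)
    (d : ℝ) :
    ∫⁻ ω, ∏ j, uavFactor p s (p.bsMeanPower d) (net.uavConfig ω j) (net.uavGains ω j) ∂μ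
      = ENNReal.ofReal (p.uavWeight LOS s d + p.uavWeight NLOS s d) ^ p.Nu := by
  set P := p.bsMeanPower d with hP
  have hm2 : Measurable fun z : (Plane × Link) × (Link → ℝ) => uavFactor p s P z.1 z.2 := by
    have h : Measurable fun z : (Plane × Link) × (Link → ℝ) => (P, z) := measurable_prodMk_left
    simpa only [Function.comp_def] using (measurable_uavFactor p s).comp h
  have hf : Measurable fun z : (Fin p.Nu → Plane × Link) × (Fin p.Nu → Link → ℝ) =>
      ∏ j, uavFactor p s P (z.1 j) (z.2 j) := by
    refine Finset.measurable_prod _ fun j _ => ?_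
    have hj : Measurable fun z : (Fin p.Nu → Plane × Link) × (Fin p.Nu → Link → ℝ) =>
        (z.1 j, z.2 j) := by fun_prop
    simpa only [Function.comp_def] using hm2.comp hj
  refine (lintegral_of_indepFun net.measurable_uavConfig net.measurable_uavGains
    net.indepFun_uavConfig_uavGains hf).trans ?_
  set h : Plane × Link → ℝ≥0∞ := fun c => if p.uavMeanPower c.2 (p.uavDist c.1) ≤ P then
    ENNReal.ofReal (p.uavLaplace c.2 s (p.uavDist c.1)) else 0
  have hhm : Measurable h := by
    refine Measurable.ite (measurableSet_le (measurable_uavPower p) measurable_const) ?_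
      measurable_const
    exact (measurable_from_prod_countable_left fun ζ =>
      (p.measurable_uavLaplace ζ s).comp p.measurable_uavDist :
        Measurable fun c : Plane × Link => p.uavLaplace c.2 s (p.uavDist c.1)).ennreal_ofReal
  have hinner : ∀ ω, ∫⁻ ω', ∏ j, uavFactor p s P (net.uavConfig ω j) (net.uavGains ω' j) ∂μ
      = ∏ j, h (net.uavConfig ω j) := by
    intro ω
    have hmj : ∀ j, Measurable fun t => uavFactor p s P (net.uavConfig ω j) t :=
      fun j => by
        have hc : Measurable fun t : Link → ℝ => (net.uavConfig ω j, t) := measurable_prodMk_left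
        simpa only [Function.comp_def] using hm2.comp hc
    rw [lintegral_prod_eq_prod_lintegral_of_indepFun Finset.univ
      (fun j ω' => uavFactor p s P (net.uavConfig ω j) (net.uavGains ω' j))
      (net.iIndepFun_uavFading.comp (fun j t => uavFactor p s P (net.uavConfig ω j) t) hmj)
      fun j => (hmj j).comp ((measurable_pi_apply j).comp net.measurable_uavGains)]
    exact Finset.prod_congr rfl fun j _ => net.lintegral_uavFactor j hs P _
  have hlink : ∀ ζ, ∫⁻ y, h (y, ζ) * ENNReal.ofReal (p.kappa ζ (p.uavDist y)) ∂p.diskLaw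
      = ENNReal.ofReal (p.uavWeight ζ s d) := by
    intro ζ
    have hg : Measurable fun w => (if p.uavMeanPower ζ w ≤ P then
        ENNReal.ofReal (p.uavLaplace ζ s w) else 0) * ENNReal.ofReal (p.kappa ζ w) :=
      (Measurable.ite (measurableSet_le (by fun_prop) measurable_const) (by fun_prop)
        measurable_const).mul (by fun_prop)
    refine (p.lintegral_uavDist hv hg).trans ?_
    rw [p.ofReal_uavWeight hv ζ hs, setLIntegral_congr Ioi_ae_eq_Ici,
      ← lintegral_indicator measurableSet_Ici]
    refine lintegral_congr fun w => ?_
    rcases lt_or_ge w p.hu with h0 | h0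
    · simp [Set.indicator_apply, p.fW_eq_zero_of_lt h0]
    · have hw := p.hu_pos.trans_le h0
      simp only [Set.indicator_apply, Set.mem_Ici,
        ← p.uavMeanPower_le_bsMeanPower_iff ζ (d := d) hw, ← hP]
      split_ifs
      · have h1 := p.uavLaplace_nonneg ζ hs hw.le
        rw [mul_right_comm (p.uavLaplace ζ s w), ENNReal.ofReal_mul
          (mul_nonneg h1 (p.kappa_nonneg ζ w)), ENNReal.ofReal_mul h1]
      · simp
  simp_rw [hinner]
  rw [lintegral_prod_eq_prod_lintegral_of_indepFun Finset.univ (fun j ω => h (net.uavConfig ω j))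
    (net.iIndepFun_uav.comp (fun _ => h) fun _ => hhm)
    fun j => hhm.comp ((measurable_pi_apply j).comp net.measurable_uavConfig)]
  simp_rw [net.lintegral_uav_link _ hhm, hlink]
  rw [Finset.prod_const, Finset.card_univ, Fintype.card_fin,
    ← ENNReal.ofReal_add (p.uavWeight_nonneg _ hs d) (p.uavWeight_nonneg _ hs d)]

end Network

/-! ### Conditional Laplace transforms -/

theorem continuousAt_laplace {ν : Measure ℝ} [IsFiniteMeasure ν] (hν : ∀ᵐ t ∂ν, 0 ≤ t) {s : ℝ}
    (hs : 0 < s) : ContinuousAt (laplace ν) s := by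
  refine continuousAt_of_dominated (bound := fun _ => 1)
    (Eventually.of_forall fun s => by fun_prop) ?_ (integrable_const _)
    (Eventually.of_forall fun t => by fun_prop)
  filter_upwards [lt_mem_nhds hs] with r hr
  filter_upwards [hν] with t ht
  rw [Real.norm_of_nonneg (Real.exp_pos _).le]
  exact Real.exp_le_one_iff.2 (by nlinarith)

/-- A family of Laplace transforms of a conditional law is identified by its integrals over the
events that the conditioning variable lies in a given set. The exceptional null set does not depend
on `s`: rational `s` suffice, as both sides are monotone and the left one is continuous. -/
theorem ae_laplace_condDistrib_eq {Ω : Type*} [MeasurableSpace Ω] {ν : Measure Ω}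
    [IsFiniteMeasure ν] {D Y : Ω → ℝ} (hD : Measurable D) (hY : AEMeasurable Y ν)
    (hD0 : ∀ ω, 0 ≤ D ω) (hY0 : ∀ᵐ ω ∂ν, 0 ≤ Y ω) {G : ℝ → ℝ → ℝ}
    (hGm : ∀ s, 0 < s → Measurable (G s)) (hG0 : ∀ s x, 0 < s → 0 ≤ x → 0 ≤ G s x)
    (hGanti : ∀ s t x, 0 < s → s ≤ t → 0 ≤ x → G t x ≤ G s x)
    (h : ∀ s, 0 < s → ∀ B, MeasurableSet B →
      ∫⁻ ω in D ⁻¹' B, ENNReal.ofReal (Real.exp (-(s * Y ω))) ∂ν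
        = ∫⁻ ω in D ⁻¹' B, ENNReal.ofReal (G s (D ω)) ∂ν) :
    ∀ᵐ x ∂ν.map D, ∀ s, 0 < s → laplace (condDistrib Y D ν x) s = G s x := by
  set K := condDistrib Y D ν
  have hcomp : (ν.map D) ⊗ₘ K = ν.map fun ω => (D ω, Y ω) := compProd_map_condDistrib hY
  have hDY : AEMeasurable (fun ω => (D ω, Y ω)) ν := hD.aemeasurable.prodMk hY
  have hKnn : ∀ᵐ x ∂ν.map D, ∀ᵐ t ∂K x, 0 ≤ t := by
    refine Measure.ae_ae_of_ae_compProd (p := fun z : ℝ × ℝ => 0 ≤ z.2) ?_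
    rw [hcomp, ae_map_iff hDY (measurableSet_le measurable_const measurable_snd)]
    exact hY0
  have hxnn : ∀ᵐ x ∂ν.map D, 0 ≤ x :=
    (ae_map_iff hD.aemeasurable measurableSet_Ici).2 (Eventually.of_forall hD0)
  have hrat : ∀ q : {q : ℚ // 0 < q}, ∀ᵐ x ∂ν.map D,
      ∫⁻ t, ENNReal.ofReal (Real.exp (-((q : ℚ) * t))) ∂K x
        = ENNReal.ofReal (G (q : ℚ) x) := by
    intro q
    have hq : (0 : ℝ) < (q : ℚ) := by exact_mod_cast q.2
    have hf : Measurable fun z : ℝ × ℝ => ENNReal.ofReal (Real.exp (-((q : ℚ) * z.2))) := by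
      fun_prop
    refine ae_eq_of_forall_setLIntegral_eq_of_sigmaFinite hf.lintegral_kernel_prod_right'
      (hGm _ hq).ennreal_ofReal fun B hB _ => ?_
    rw [setLIntegral_map hB (hGm _ hq).ennreal_ofReal hD, ← h _ hq B hB]
    have h1 := Measure.setLIntegral_compProd (μ := ν.map D) (κ := K) hf hB MeasurableSet.univ
    simp only [Measure.restrict_univ] at h1
    rw [← h1, hcomp, ← lintegral_indicator (hB.prod MeasurableSet.univ),
      lintegral_map' (hf.indicator (hB.prod MeasurableSet.univ)).aemeasurable hDY,
      ← lintegral_indicator (hD hB)]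
    refine lintegral_congr fun ω => ?_
    by_cases hω : D ω ∈ B <;> simp [hω]
  filter_upwards [hKnn, hxnn, ae_all_iff.2 hrat] with x hx hx0 hq s hs
  have hval : ∀ q : ℚ, 0 < q → laplace (K x) q = G q x := by
    intro q hq0
    have hq0' : (0 : ℝ) < q := by exact_mod_cast hq0
    rw [laplace, integral_eq_lintegral_of_nonneg_ae
      (Eventually.of_forall fun t => (Real.exp_pos _).le) (by fun_prop)]
    simp_rw [neg_mul]
    rw [hq ⟨q, hq0⟩, ENNReal.toReal_ofReal (hG0 _ _ hq0' hx0)]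
  have hcont := continuousAt_laplace hx hs
  refine le_antisymm (le_of_not_gt fun hlt => ?_) (le_of_not_gt fun hlt => ?_)
  · obtain ⟨u, hu, hsub⟩ := exists_Ico_subset_of_mem_nhds (hcont.eventually (lt_mem_nhds hlt))
      (exists_gt s)
    obtain ⟨q, hsq, hqu⟩ := exists_rat_btwn hu
    have h1 : G s x < laplace (K x) q := hsub ⟨hsq.le, hqu⟩
    rw [hval q (by exact_mod_cast hs.trans hsq)] at h1
    exact h1.not_ge (hGanti s q x hs hsq.le hx0)
  · obtain ⟨l, hl, hsub⟩ := exists_Ioc_subset_of_mem_nhds' (hcont.eventually (gt_mem_nhds hlt)) hs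
    obtain ⟨q, hlq, hqs⟩ := exists_rat_btwn hl.2
    have hq0 : (0 : ℝ) < q := hl.1.trans_lt hlq
    have h1 : laplace (K x) q < G s x := hsub ⟨hlq, hqs.le⟩
    rw [hval q (by exact_mod_cast hq0)] at h1
    exact h1.not_ge (hGanti q s x hq0 hqs.le hx0)

/-- The exponent increases with `A`, since the loss caused by each base station does. -/
theorem tailExponent_mono {A B η h t : ℝ} (hA : 0 < A) (hAB : A ≤ B) (hη : 2 < η) (hh : 0 < h)
    (ht : 0 ≤ t) : tailExponent A η (t + h ^ 2) ≤ tailExponent B η (t + h ^ 2) := by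
  have hB := hA.trans_le hAB
  rw [← ENNReal.ofReal_le_ofReal_iff (tailExponent_nonneg hB hη hh ht), ← lintegral_bsLoss hA hη hh ht,
    ← lintegral_bsLoss hB hη hh ht]
  refine setLIntegral_mono' measurableSet_Ioi fun q hq => ENNReal.ofReal_le_ofReal ?_
  have hq0 : 0 < q := ht.trans_lt hq
  have hD : 0 < (q + h ^ 2) ^ (η / 2) := by positivity
  rw [bsLoss, bsLoss, div_le_div_iff₀ (by positivity) (by positivity)]
  nlinarith

namespace Network

variable {p : Params} {Ω : Type*} [MeasurableSpace Ω] {μ : Measure Ω} (net : Network p μ)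

/-- The event that no UAV is stronger than the nearest base station. -/
def uavsWeaker : Set Ω := {ω | ∀ j, net.uavAvg j ω ≤ p.bsMeanPower (net.bestDist ω)}

theorem measurable_uavAvg (j : Fin p.Nu) : Measurable (net.uavAvg j) := by
  have h := (net.uav_measurable j).prodMk (net.link_measurable j)
  have h2 := (measurable_uavPower p).comp h
  simp only [Function.comp_def] at h2
  exact h2

theorem uavAvg_nonneg (j : Fin p.Nu) (ω : Ω) : 0 ≤ net.uavAvg j ω :=
  p.uavMeanPower_nonneg _ (p.uavDist_nonneg _)

theorem measurableSet_uavsWeaker : MeasurableSet net.uavsWeaker := by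
  rw [uavsWeaker, Set.ofPred_forall]
  exact MeasurableSet.iInter fun j => measurableSet_le (net.measurable_uavAvg j) (by fun_prop)

/-- Up to a null event, association with a base station only requires that no UAV is stronger than
the nearest base station. -/
theorem servedByBS_ae_eq [IsProbabilityMeasure μ] : net.servedByBS =ᵐ[μ] net.uavsWeaker := by
  filter_upwards [net.bs_poisson.ae_exists_nearest p] with ω hω
  have h : ∀ i, net.bsAvg i ω ≤ net.bsAvg (net.bestBS ω) ω := fun i =>
    (p.bsMeanPower_le_iff dist_nonneg dist_nonneg).2
      (p.nearest_spec (x := net.bsConfig ω) hω i)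
  exact propext ⟨fun h' => h'.2, fun h' => ⟨h, h'⟩⟩

theorem measurable_uavInterf : Measurable net.uavInterf := by
  refine Finset.measurable_sum _ fun j _ => (net.measurable_uavAvg j).mul ?_
  have h : Measurable fun w : (Link → ℝ) × Link => w.1 w.2 :=
    measurable_from_prod_countable_left fun ζ => measurable_pi_apply ζ
  exact h.comp ((measurable_pi_lambda (fun ω ζ => net.uavFading j ζ ω)
    (net.uavFading_measurable j)).prodMk (net.link_measurable j))

theorem ae_uavInterf_nonneg : ∀ᵐ ω ∂μ, 0 ≤ net.uavInterf ω := by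
  have h : ∀ᵐ ω ∂μ, ∀ j ζ, 0 ≤ net.uavFading j ζ ω := by
    refine ae_all_iff.2 fun j => ae_all_iff.2 fun ζ => ?_
    have := ae_nonneg_gammaMeasure (p.m ζ) (p.m ζ)
    rw [← net.uavFading_law j ζ] at this
    exact ae_of_ae_map (net.uavFading_measurable j ζ).aemeasurable this
  filter_upwards [h] with ω hω
  exact Finset.sum_nonneg fun j _ => mul_nonneg (net.uavAvg_nonneg j ω) (hω j _)

/-- The product of the factors of all the UAVs, given the nearest base station. -/
noncomputable def uavProd (s : ℝ) (ω : Ω) : ℝ≥0∞ :=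
  ∏ j, uavFactor p s (p.bsMeanPower (net.bestDist ω)) (net.uavConfig ω j) (net.uavGains ω j)

theorem uavProd_eq_indicator (s : ℝ) (ω : Ω) : net.uavProd s ω
    = net.uavsWeaker.indicator (fun ω => ENNReal.ofReal (Real.exp (-(s * net.uavInterf ω)))) ω := by
  by_cases h : ω ∈ net.uavsWeaker
  · rw [Set.indicator_of_mem h, uavInterf, Finset.mul_sum, ← Finset.sum_neg_distrib, Real.exp_sum,
      ENNReal.ofReal_prod_of_nonneg fun i _ => (Real.exp_pos _).le]
    refine Finset.prod_congr rfl fun j _ => ?_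
    rw [← mul_assoc]
    exact if_pos (h j)
  · rw [Set.indicator_of_notMem h]
    obtain ⟨j, hj⟩ := not_forall.1 h
    exact Finset.prod_eq_zero (Finset.mem_univ j) (if_neg hj)

theorem uavProd_zero (ω : Ω) : net.uavProd 0 ω = net.uavsWeaker.indicator 1 ω := by
  rw [uavProd_eq_indicator]
  simp only [zero_mul, neg_zero, Real.exp_zero, ENNReal.ofReal_one]
  rfl

/-- The conditional expectation of `uavProd` given that the nearest base station is at horizontal
distance `d`. -/
noncomputable def uavMean (s d : ℝ) : ℝ≥0∞ :=
  ∫⁻ ω, ∏ j, uavFactor p s (p.bsMeanPower d) (net.uavConfig ω j) (net.uavGains ω j) ∂μ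

theorem measurable_uavFactors (p : Params) (s : ℝ) :
    Measurable fun z : ℝ × (Fin p.Nu → Plane × Link) × (Fin p.Nu → Link → ℝ) =>
      ∏ j, uavFactor p s (p.bsMeanPower z.1) (z.2.1 j) (z.2.2 j) := by
  refine Finset.measurable_prod _ fun j _ => ?_
  have h : Measurable fun z : ℝ × (Fin p.Nu → Plane × Link) × (Fin p.Nu → Link → ℝ) =>
      (p.bsMeanPower z.1, z.2.1 j, z.2.2 j) := by fun_prop
  simpa only [Function.comp_def] using (measurable_uavFactor p s).comp h

theorem measurable_uavMean [IsProbabilityMeasure μ] (s : ℝ) : Measurable (net.uavMean s) := by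
  have h : Measurable fun z : ℝ × Ω => (z.1, net.uavConfig z.2, net.uavGains z.2) := by fun_prop
  have h2 := (measurable_uavFactors p s).comp h
  simp only [Function.comp_def] at h2
  exact h2.lintegral_prod_right'

/-- The UAVs enter an expectation only through their conditional expectation given the nearest base
station, as they are independent of the base stations. -/
theorem lintegral_mul_uavProd [IsProbabilityMeasure μ] (s : ℝ)
    {J : (ℕ → Plane) × (ℕ → ℝ) → ℝ≥0∞} (hJ : Measurable J) :
    ∫⁻ ω, J (net.bsConfig ω, net.bsGains ω) * net.uavProd s ω ∂μ
      = ∫⁻ ω, J (net.bsConfig ω, net.bsGains ω) * net.uavMean s (net.bestDist ω) ∂μ := by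
  have hf : Measurable fun z : ((ℕ → Plane) × (ℕ → ℝ)) ×
      ((Fin p.Nu → Plane × Link) × (Fin p.Nu → Link → ℝ)) => J z.1 *
      ∏ j, uavFactor p s (p.bsMeanPower (p.nearestDist z.1.1)) (z.2.1 j) (z.2.2 j) := by
    have h : Measurable fun z : ((ℕ → Plane) × (ℕ → ℝ)) ×
      ((Fin p.Nu → Plane × Link) × (Fin p.Nu → Link → ℝ)) => (p.nearestDist z.1.1, z.2) := by
      fun_prop
    have h2 := (measurable_uavFactors p s).comp h
    simp only [Function.comp_def] at h2
    exact (hJ.comp measurable_fst).mul h2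
  refine (lintegral_of_indepFun (net.measurable_bsConfig.prodMk net.measurable_bsGains)
    (net.measurable_uavConfig.prodMk net.measurable_uavGains) net.indepFun_bs_uav hf).trans ?_
  refine lintegral_congr fun ω => ?_
  simp only
  rw [lintegral_const_mul]
  · rfl
  have h : Measurable fun ω' =>
      (p.nearestDist (net.bsConfig ω), net.uavConfig ω', net.uavGains ω') := by fun_prop
  simpa only [Function.comp_def] using (measurable_uavFactors p s).comp h

/-- Conditioning on the association with a base station amounts to inserting the factor `uavProd 0`,
the indicator that no UAV is stronger than the nearest base station, and normalizing. -/
theorem setLIntegral_cond_servedByBS [IsProbabilityMeasure μ] {B : Set ℝ} (hB : MeasurableSet B)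
    (f : Ω → ℝ≥0∞) :
    ∫⁻ ω in net.bestDist ⁻¹' B, f ω ∂(ProbabilityTheory.cond μ net.servedByBS)
      = (μ net.servedByBS)⁻¹ *
        ∫⁻ ω, B.indicator 1 (net.bestDist ω) * (f ω * net.uavProd 0 ω) ∂μ := by
  have hB' := net.measurable_bestDist hB
  rw [ProbabilityTheory.cond, Measure.restrict_smul, lintegral_smul_measure, smul_eq_mul,
    Measure.restrict_congr_set net.servedByBS_ae_eq, Measure.restrict_restrict hB',
    ← lintegral_indicator (hB'.inter net.measurableSet_uavsWeaker)]
  congr 1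
  refine lintegral_congr fun ω => ?_
  rw [uavProd_zero]
  by_cases h1 : net.bestDist ω ∈ B <;> by_cases h2 : ω ∈ net.uavsWeaker <;>
    simp [h1, h2]

/-- The integrals that identify the conditional law of the interference of the base stations. The UAVs
only enter through `uavMean 0`, a function of the distance of the nearest base station. -/
theorem setLIntegral_exp_bsInterf [IsProbabilityMeasure μ] {s : ℝ} (hs : 0 < s) {B : Set ℝ}
    (hB : MeasurableSet B) :
    ∫⁻ ω in net.bestDist ⁻¹' B, ENNReal.ofReal (Real.exp (-(s * net.bsInterf ω)))
        ∂(ProbabilityTheory.cond μ net.servedByBS)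
      = ∫⁻ ω in net.bestDist ⁻¹' B, ENNReal.ofReal (Real.exp (-(Real.pi * p.lam *
          tailExponent (s * p.Pg) p.etag (net.bestDist ω ^ 2 + p.hg ^ 2))))
        ∂(ProbabilityTheory.cond μ net.servedByBS) := by
  have hη := p.etag_gt
  have hh := p.hg_pos
  have hkm : Measurable (B.indicator (1 : ℝ → ℝ≥0∞)) := measurable_one.indicator hB
  have hTm : Measurable fun d : ℝ => ENNReal.ofReal (Real.exp (-(Real.pi * p.lam *
      tailExponent (s * p.Pg) p.etag (d ^ 2 + p.hg ^ 2)))) := by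
    have := (continuous_tailExponent_comp (mul_pos hs p.Pg_pos) hη
      (f := fun d : ℝ => d ^ 2 + p.hg ^ 2) (by fun_prop) fun x => by positivity).measurable
    fun_prop
  rw [net.setLIntegral_cond_servedByBS hB, net.setLIntegral_cond_servedByBS hB]
  congr 1
  have hD : Measurable fun z : (ℕ → Plane) × (ℕ → ℝ) => p.nearestDist z.1 := by fun_prop
  have hprod : Measurable fun z : (ℕ → Plane) × (ℕ → ℝ) =>
      iprod fun i => bsFactor p s z.1 i (z.2 i) := by
    refine measurable_iprod fun i => ?_
    have h : Measurable fun z : (ℕ → Plane) × (ℕ → ℝ) => (z.1, z.2 i) := by fun_prop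
    simpa only [Function.comp_def] using (measurable_bsFactor p s i).comp h
  calc ∫⁻ ω, B.indicator 1 (net.bestDist ω) *
        (ENNReal.ofReal (Real.exp (-(s * net.bsInterf ω))) * net.uavProd 0 ω) ∂μ
    _ = ∫⁻ ω, B.indicator 1 (net.bestDist ω) *
          iprod (fun i => bsFactor p s (net.bsConfig ω) i (net.bsGains ω i)) *
          net.uavProd 0 ω ∂μ := by
        refine lintegral_congr_ae ?_
        filter_upwards [net.exp_bsInterf_eq_iprod hs.le] with ω hω
        rw [hω, mul_assoc]
    _ = ∫⁻ ω, B.indicator 1 (net.bestDist ω) *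
          iprod (fun i => bsFactor p s (net.bsConfig ω) i (net.bsGains ω i)) *
          net.uavMean 0 (net.bestDist ω) ∂μ :=
        net.lintegral_mul_uavProd 0 ((hkm.comp hD).mul hprod)
    _ = ∫⁻ ω, (B.indicator 1 (net.bestDist ω) * net.uavMean 0 (net.bestDist ω)) *
          iprod (fun i => bsFactor p s (net.bsConfig ω) i (net.bsGains ω i)) ∂μ :=
        lintegral_congr fun ω => mul_right_comm _ _ _
    _ = ∫⁻ ω, (B.indicator 1 (net.bestDist ω) * net.uavMean 0 (net.bestDist ω)) *
          ENNReal.ofReal (Real.exp (-(Real.pi * p.lam *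
            tailExponent (s * p.Pg) p.etag (net.bestDist ω ^ 2 + p.hg ^ 2)))) ∂μ :=
        net.lintegral_mul_exp_bsInterf hs (hkm.mul (net.measurable_uavMean 0))
    _ = ∫⁻ ω, (B.indicator 1 (net.bestDist ω) * ENNReal.ofReal (Real.exp (-(Real.pi * p.lam *
            tailExponent (s * p.Pg) p.etag (net.bestDist ω ^ 2 + p.hg ^ 2))))) *
          net.uavMean 0 (net.bestDist ω) ∂μ :=
        lintegral_congr fun ω => mul_right_comm _ _ _
    _ = ∫⁻ ω, (B.indicator 1 (net.bestDist ω) * ENNReal.ofReal (Real.exp (-(Real.pi * p.lam *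
            tailExponent (s * p.Pg) p.etag (net.bestDist ω ^ 2 + p.hg ^ 2))))) *
          net.uavProd 0 ω ∂μ :=
        (net.lintegral_mul_uavProd 0 ((hkm.comp hD).mul (hTm.comp hD))).symm
    _ = _ := lintegral_congr fun ω => mul_assoc _ _ _

/-- The conditional Laplace transform of the interference of the UAVs, given that they are not
stronger than a base station at horizontal distance `d`. -/
noncomputable def uavRatio (p : Params) (s d : ℝ) : ℝ :=
  (1 / (p.uavWeight LOS 0 d + p.uavWeight NLOS 0 d) *
    (p.uavWeight LOS s d + p.uavWeight NLOS s d)) ^ p.Nu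

theorem uavRatio_nonneg {s : ℝ} (hs : 0 ≤ s) (d : ℝ) : 0 ≤ uavRatio p s d := by
  have h1 := p.uavWeight_nonneg LOS le_rfl d
  have h2 := p.uavWeight_nonneg NLOS le_rfl d
  have h3 := p.uavWeight_nonneg LOS hs d
  have h4 := p.uavWeight_nonneg NLOS hs d
  unfold uavRatio
  positivity

theorem uavRatio_anti (hv : p.v0 ≤ p.ru) {s t : ℝ} (hs : 0 ≤ s) (hst : s ≤ t) (d : ℝ) :
    uavRatio p t d ≤ uavRatio p s d := by
  have h1 := p.uavWeight_nonneg LOS le_rfl d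
  have h2 := p.uavWeight_nonneg NLOS le_rfl d
  have h3 := p.uavWeight_nonneg LOS (hs.trans hst) d
  have h4 := p.uavWeight_nonneg NLOS (hs.trans hst) d
  have h5 := p.uavWeight_anti hv LOS hs hst d
  have h6 := p.uavWeight_anti hv NLOS hs hst d
  unfold uavRatio
  gcongr

theorem measurable_uavRatio (hv : p.v0 ≤ p.ru) {s : ℝ} (hs : 0 ≤ s) : Measurable (uavRatio p s) := by
  have h1 := p.measurable_uavWeight hv LOS le_rfl
  have h2 := p.measurable_uavWeight hv NLOS le_rfl
  have h3 := p.measurable_uavWeight hv LOS hs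
  have h4 := p.measurable_uavWeight hv NLOS hs
  unfold uavRatio
  fun_prop

/-- The quotient of `uavMean s d` by the probability `uavMean 0 d` of the conditioning event. -/
theorem uavMean_eq_mul [IsProbabilityMeasure μ] (hv : p.v0 ≤ p.ru) {s : ℝ} (hs : 0 ≤ s) (d : ℝ) :
    net.uavMean s d = ENNReal.ofReal (uavRatio p s d) * net.uavMean 0 d := by
  have h1 := p.uavWeight_nonneg LOS le_rfl d
  have h2 := p.uavWeight_nonneg NLOS le_rfl d
  have h3 := p.uavWeight_nonneg LOS hs d
  have h4 := p.uavWeight_nonneg NLOS hs d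
  have h5 := p.uavWeight_anti hv LOS le_rfl hs d
  have h6 := p.uavWeight_anti hv NLOS le_rfl hs d
  rw [uavMean, uavMean, net.lintegral_prod_uavFactor hv hs, net.lintegral_prod_uavFactor hv le_rfl,
    uavRatio, ENNReal.ofReal_pow (by positivity), ← mul_pow, ← ENNReal.ofReal_mul (by positivity)]
  congr 2
  -- if the probability `uavWeight LOS 0 d + uavWeight NLOS 0 d` vanishes, so does the numerator
  rcases (add_nonneg h1 h2).eq_or_lt with h0 | h0
  · rw [← h0]
    linarith
  · field_simp

/-- The integrals that identify the conditional law of the interference of the UAVs. -/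
theorem setLIntegral_exp_uavInterf [IsProbabilityMeasure μ] (hv : p.v0 ≤ p.ru) {s : ℝ} (hs : 0 ≤ s)
    {B : Set ℝ} (hB : MeasurableSet B) :
    ∫⁻ ω in net.bestDist ⁻¹' B, ENNReal.ofReal (Real.exp (-(s * net.uavInterf ω)))
        ∂(ProbabilityTheory.cond μ net.servedByBS)
      = ∫⁻ ω in net.bestDist ⁻¹' B, ENNReal.ofReal (uavRatio p s (net.bestDist ω))
        ∂(ProbabilityTheory.cond μ net.servedByBS) := by
  have hkm : Measurable (B.indicator (1 : ℝ → ℝ≥0∞)) := measurable_one.indicator hB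
  have hRm := (measurable_uavRatio (p := p) hv hs).ennreal_ofReal
  have hD : Measurable fun z : (ℕ → Plane) × (ℕ → ℝ) => p.nearestDist z.1 := by fun_prop
  rw [net.setLIntegral_cond_servedByBS hB, net.setLIntegral_cond_servedByBS hB]
  congr 1
  calc ∫⁻ ω, B.indicator 1 (net.bestDist ω) *
        (ENNReal.ofReal (Real.exp (-(s * net.uavInterf ω))) * net.uavProd 0 ω) ∂μ
    _ = ∫⁻ ω, B.indicator 1 (net.bestDist ω) * net.uavProd s ω ∂μ := by
        refine lintegral_congr fun ω => ?_
        rw [uavProd_zero, uavProd_eq_indicator]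
        by_cases h : ω ∈ net.uavsWeaker <;> simp [h]
    _ = ∫⁻ ω, B.indicator 1 (net.bestDist ω) * net.uavMean s (net.bestDist ω) ∂μ :=
        net.lintegral_mul_uavProd s (hkm.comp hD)
    _ = ∫⁻ ω, (B.indicator 1 (net.bestDist ω) * ENNReal.ofReal (uavRatio p s (net.bestDist ω))) *
          net.uavMean 0 (net.bestDist ω) ∂μ := by
        refine lintegral_congr fun ω => ?_
        rw [net.uavMean_eq_mul hv hs, mul_assoc]
    _ = ∫⁻ ω, (B.indicator 1 (net.bestDist ω) * ENNReal.ofReal (uavRatio p s (net.bestDist ω))) *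
          net.uavProd 0 ω ∂μ :=
        (net.lintegral_mul_uavProd 0 ((hkm.comp hD).mul (hRm.comp hD))).symm
    _ = _ := lintegral_congr fun ω => mul_assoc _ _ _

end Network

end HybridNet

theorem lemma3 (p : HybridNet.Params) {Ω : Type*} [MeasurableSpace Ω]
    (μ : Measure Ω) [IsProbabilityMeasure μ] (net : HybridNet.Network p μ) :
    -- the interference of the base stations is almost surely a convergent series
    (∀ᵐ ω ∂μ, Summable fun i => net.bsInterfTerm i ω) ∧
    -- conditional Laplace transform of the interference of the non-serving base stations,
    -- given that the UE is served by a base station at horizontal distance `x`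
    (∀ᵐ x ∂((ProbabilityTheory.cond μ net.servedByBS).map net.bestDist), ∀ s : ℝ, 0 < s →
      HybridNet.laplace
          (condDistrib net.bsInterf net.bestDist
            (ProbabilityTheory.cond μ net.servedByBS) x) s =
        Real.exp (-2 * Real.pi * p.lam * s * p.Pg * (x ^ 2 + p.hg ^ 2) /
            ((p.etag - 2) * ((x ^ 2 + p.hg ^ 2) ^ (p.etag / 2) + s * p.Pg)) *
          ordinaryHypergeometric (1 : ℝ) 1 (2 - 2 / p.etag)
            (1 / (1 + (x ^ 2 + p.hg ^ 2) ^ (p.etag / 2) / (s * p.Pg))))) ∧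
    -- conditional Laplace transform of the interference of the UAVs
    (p.v0 ≤ p.ru →
      ∀ᵐ x ∂((ProbabilityTheory.cond μ net.servedByBS).map net.bestDist), ∀ s : ℝ, 0 < s →
      HybridNet.laplace
          (condDistrib net.uavInterf net.bestDist
            (ProbabilityTheory.cond μ net.servedByBS) x) s =
        (1 / ((∫ w in (p.exclRadius HybridNet.LOS x)..p.wp, p.fW w * p.kappa HybridNet.LOS w) +
            ∫ w in (p.exclRadius HybridNet.NLOS x)..p.wp, p.fW w * p.kappa HybridNet.NLOS w) *
          ((∫ v in (p.exclRadius HybridNet.LOS x)..p.wp,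
              (1 + s * p.Pu * v ^ (-p.eta HybridNet.LOS) / p.m HybridNet.LOS) ^
                (-p.m HybridNet.LOS) * p.fW v * p.kappa HybridNet.LOS v) +
            ∫ v in (p.exclRadius HybridNet.NLOS x)..p.wp,
              (1 + s * p.Pu * v ^ (-p.eta HybridNet.NLOS) / p.m HybridNet.NLOS) ^
                (-p.m HybridNet.NLOS) * p.fW v * p.kappa HybridNet.NLOS v)) ^ p.Nu) := by
  have hμ' : ProbabilityTheory.cond μ net.servedByBS ≪ μ := cond_absolutelyContinuous
  refine ⟨net.summable_bsInterfTerm, ?_, fun hv => ?_⟩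
  · have hη := p.etag_gt
    have hh := p.hg_pos
    have hP := p.Pg_pos
    have hl := p.lam_pos
    refine (HybridNet.ae_laplace_condDistrib_eq net.measurable_bestDist
      (net.aemeasurable_bsInterf.mono_ac hμ') net.bestDist_nonneg (hμ'.ae_le net.ae_bsInterf_nonneg)
      (G := fun s x => Real.exp (-(Real.pi * p.lam *
        HybridNet.tailExponent (s * p.Pg) p.etag (x ^ 2 + p.hg ^ 2)))) ?_ ?_ ?_ ?_).mono ?_
    · intro s hs
      have := (HybridNet.continuous_tailExponent_comp (mul_pos hs hP) hη
        (f := fun d : ℝ => d ^ 2 + p.hg ^ 2) (by fun_prop) fun x => by positivity).measurable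
      fun_prop
    · exact fun s x _ _ => (Real.exp_pos _).le
    · intro s t x hs hst _
      have := HybridNet.tailExponent_mono (mul_pos hs hP) (by gcongr : s * p.Pg ≤ t * p.Pg) hη hh
        (sq_nonneg x)
      gcongr
    · exact fun s hs B hB => net.setLIntegral_exp_bsInterf hs hB
    · intro x hx s hs
      rw [hx s hs, HybridNet.tailExponent]
      congr 1
      have hU : 0 < (x ^ 2 + p.hg ^ 2) ^ (p.etag / 2) := by positivity
      generalize ordinaryHypergeometric (1 : ℝ) 1 (2 - 2 / p.etag)
        (1 / (1 + (x ^ 2 + p.hg ^ 2) ^ (p.etag / 2) / (s * p.Pg))) = F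
      generalize (x ^ 2 + p.hg ^ 2) ^ (p.etag / 2) = V at hU
      field_simp
      ring
  · refine (HybridNet.ae_laplace_condDistrib_eq net.measurable_bestDist
      net.measurable_uavInterf.aemeasurable net.bestDist_nonneg
      (hμ'.ae_le net.ae_uavInterf_nonneg) (G := HybridNet.Network.uavRatio p)
      (fun s hs => HybridNet.Network.measurable_uavRatio hv hs.le)
      (fun s x hs _ => HybridNet.Network.uavRatio_nonneg hs.le x)
      (fun s t x hs hst _ => HybridNet.Network.uavRatio_anti hv hs.le hst x)
      fun s hs B hB => net.setLIntegral_exp_uavInterf hv hs.le hB).mono ?_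
    intro x hx s hs
    rw [hx s hs]
    simp only [HybridNet.Network.uavRatio, HybridNet.Params.uavWeight,
      HybridNet.Params.uavLaplace_zero, one_mul]
    rfl
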